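/- Let $n>2$. Let $P\subset \mathrm{SL}(n+1)=\mathrm{SL}(n+1,\mathbb R)$ be the stabiliser of the ray $\mathbb R_+v_+$ through $v_+=(1,0,\dots,0)^t\in\mathbb R^{n+1}$, with Lie algebras $\mathfrak p\subset\mathfrak g=\mathfrak{sl}(n+1)$. Let $\mathbb R^{n+1,n+1}=E\oplus F$, $E=\mathbb R^{n+1}$, $F=(\mathbb R^{n+1})^*$, carry the split form $h=\begin{pmatrix}0&I_{n+1}\\ I_{n+1}&0\end{pmatrix}$; let $\mathrm{Spin}(n+1,n+1)$ be the (connected) spin group of $h$, and let $\tilde P\subset\mathrm{Spin}(n+1,n+1)$ be the stabiliser of the ray through the null vector $\tilde v_+=(1,0,\dots,0,1)^t$, with Lie algebras $\tilde{\mathfrak p}\subset\tilde{\mathfrak g}=\mathfrak{so}(n+1,n+1)$. Let $i:\mathrm{SL}(n+1)\hookrightarrow\mathrm{Spin}(n+1,n+1)$ be the inclusion onto the stabiliser of two pure spinors $s_E,s_F$ with kernels $E$ and $F$; it covers $A\mapsto\begin{pmatrix}A&0\\0&(A^{-1})^t\end{pmatrix}$ and has derivative $i'(A)=\begin{pmatrix}A&0\\0&-A^t\end{pmatrix}$.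 Put $Q=i^{-1}(\tilde P)$; then $Q\subset P$. For a Cartan connection $\omega$ of type $(\mathfrak g,P)$ or $(\tilde{\mathfrak g},\tilde P)$, let $K(\xi,\eta)=d\omega(\xi,\eta)+[\omega(\xi),\omega(\eta)]$ be its curvature and $\kappa(u)(X,Y)=K(\omega(u)^{-1}X,\omega(u)^{-1}Y)$ its curvature function. It is called flat if $K=0$, and normal if $\partial^*\kappa=0$, where $\partial^*$ is the Kostant codifferential, $$(\partial^*\kappa)(u)(X)=2\sum_i[\kappa(u)(X_i,X),Z_i]+\sum_i\kappa(u)(X_i,[Z_i,X]),$$ with $X_i\in\mathfrak g$ inducing a basis of $\mathfrak g/\mathfrak p$ and $Z_i\in\mathfrak p_+=\mathfrak p^\perp$ the dual basis with respect to the Killing form (and likewise with $\tilde{\mathfrak g},\tilde{\mathfrak p}$). Let $(\mathcal G\to M,\omega)$ be a smooth normal projective Cartan geometry over an $n$-dimensional manifold, i.e. a principal $P$-bundle with a normal Cartan connection $\omega\in\Omega^1(\mathcal G,\mathfrak g)$. Let $\tilde M=\mathcal G/Q$, let $\tilde{\mathcal G}=\mathcal G\times_Q\tilde P\to\tilde M$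 be the extended principal $\tilde P$-bundle, and let $\tilde\omega\in\Omega^1(\tilde{\mathcal G},\tilde{\mathfrak g})$ be the induced conformal Cartan connection, i.e. the unique Cartan connection on $\tilde{\mathcal G}$ whose pullback along $\mathcal G\to\tilde{\mathcal G}$, $u\mapsto[u,1]$, is $i'\circ\omega$. Then $\tilde\omega$ is normal if and only if $\omega$ is flat. Moreover, if $\omega$ is flat, then $\tilde\omega$ is flat as well. -/

import Mathlib

open scoped Manifold ContDiff Matrix

noncomputable section

namespace Fefferman

-- the commutator bracket of matrices
attribute [local instance 100] LieRing.ofAssociativeRing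

/-! ### Calculus on manifolds -/

section Calculus

variable {E : Type*} [NormedAddCommGroup E] [NormedSpace ℝ E]
  {X : Type*} [TopologicalSpace X] [ChartedSpace E X]

/-- A map `f` from a subset `s` of a manifold into a group `H` that sits (via `emb`) as a closed
Lie subgroup in the units of a finite-dimensional real algebra `W` is smooth: all its components
`ℓ ∘ emb ∘ f`, with `ℓ` a linear functional on `W`, are smooth.  As a closed Lie subgroup is an
embedded submanifold, this is smoothness as a map into the Lie group `H`. -/
def SmoothIntoOn {H W : Type*} [AddCommGroup W] [Module ℝ W] (emb : H → W)
    (f : X → H) (s : Set X) : Prop :=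
  ∀ ℓ : W →ₗ[ℝ] ℝ, ContMDiffOn 𝓘(ℝ, E) 𝓘(ℝ, ℝ) ∞ (fun x => ℓ (emb (f x))) s

/-- The value at `y` of the component, in the chart at `x` and along the constant vector `w`, of
a real-valued one-form `α`. -/
def chartComponent (α : ∀ x : X, TangentSpace 𝓘(ℝ, E) x →ₗ[ℝ] ℝ) (x : X) (w y : E) : ℝ :=
  α ((extChartAt 𝓘(ℝ, E) x).symm y)
    (mfderiv 𝓘(ℝ, E) 𝓘(ℝ, E) (extChartAt 𝓘(ℝ, E) x).symm y w)

/-- The exterior derivative `dα(v, w)` at `x` of a real-valued one-form `α`, computed in the chart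
at `x`: if `α = ∑ αᵢ dyⁱ`, then `dα(v, w) = ∑ (∂ᵢ αⱼ - ∂ⱼ αᵢ) vⁱ wʲ`. -/
def extDerivForm (α : ∀ x : X, TangentSpace 𝓘(ℝ, E) x →ₗ[ℝ] ℝ) (x : X)
    (v w : TangentSpace 𝓘(ℝ, E) x) : ℝ :=
  let φ := extChartAt 𝓘(ℝ, E) x
  let v' : E := mfderiv 𝓘(ℝ, E) 𝓘(ℝ, E) φ x v
  let w' : E := mfderiv 𝓘(ℝ, E) 𝓘(ℝ, E) φ x w
  fderiv ℝ (chartComponent α x w') (φ x) v' - fderiv ℝ (chartComponent α x v') (φ x) w'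

end Calculus

/-! ### Principal bundles and Cartan connections

The structure group `H` is a group with an embedding `emb` as a closed Lie subgroup in the units
of a finite-dimensional real algebra `W`; `rep : H →* Matrix ι ι ℝ` is a representation, and the
Lie algebra `𝔤` is a Lie algebra of `ι × ι` matrices on which `H` acts by conjugation through
`rep`. -/

/-- `π : B → X` is a smooth principal bundle for the right action `act : B → H → B`. -/
structure IsPrincipalBundle {H W : Type*} [Group H] [AddCommGroup W] [Module ℝ W] (emb : H → W)
    {E : Type*} [NormedAddCommGroup E] [NormedSpace ℝ E]
    {B : Type*} [TopologicalSpace B] [ChartedSpace E B]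
    {F : Type*} [NormedAddCommGroup F] [NormedSpace ℝ F]
    {X : Type*} [TopologicalSpace X] [ChartedSpace F X]
    (act : B → H → B) (π : B → X) : Prop where
  act_one : ∀ u, act u 1 = u
  act_mul : ∀ u g h, act u (g * h) = act (act u g) h
  free : ∀ u h, act u h = u → h = 1
  proj_eq_iff : ∀ u v, π u = π v ↔ ∃ h, v = act u h
  surjective : Function.Surjective π
  smooth_proj : ContMDiff 𝓘(ℝ, E) 𝓘(ℝ, F) ∞ π
  /-- The action `B × H → B` is smooth; smoothness is tested on smooth maps `ℝᵏ → B × H`. -/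
  smooth_act : ∀ (k : ℕ) (a : EuclideanSpace ℝ (Fin k) → B) (h : EuclideanSpace ℝ (Fin k) → H),
    ContMDiff 𝓘(ℝ, EuclideanSpace ℝ (Fin k)) 𝓘(ℝ, E) ∞ a →
    SmoothIntoOn (E := EuclideanSpace ℝ (Fin k)) emb h Set.univ →
    ContMDiff 𝓘(ℝ, EuclideanSpace ℝ (Fin k)) 𝓘(ℝ, E) ∞ (fun t => act (a t) (h t))
  /-- Locally over `X` there are a smooth section `s` and the smooth trivialisation
  `u ↦ (π u, τ u)` with inverse `(x, h) ↦ act (s x) h`. -/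
  locally_trivial : ∀ x : X, ∃ U : Set X, IsOpen U ∧ x ∈ U ∧ ∃ (s : X → B) (τ : B → H),
    ContMDiffOn 𝓘(ℝ, F) 𝓘(ℝ, E) ∞ s U ∧ SmoothIntoOn (E := E) emb τ (π ⁻¹' U) ∧
    (∀ y ∈ U, π (s y) = y) ∧ ∀ u, π u ∈ U → u = act (s (π u)) (τ u)

section Cartan

variable {ι : Type*} [Fintype ι] [DecidableEq ι]
  {E : Type*} [NormedAddCommGroup E] [NormedSpace ℝ E]
  {B : Type*} [TopologicalSpace B] [ChartedSpace E B]

/-- `θ` is a smooth Cartan connection with values in `𝔤` on the total space `B` of a principal bundle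
with right action `act` of the group `H`. -/
structure IsCartanConnection [IsManifold 𝓘(ℝ, E) ∞ B] {H W : Type*} [Group H] [AddCommGroup W] [Module ℝ W] (emb : H → W)
    (rep : H →* Matrix ι ι ℝ) (𝔤 : LieSubalgebra ℝ (Matrix ι ι ℝ)) (act : B → H → B)
    (θ : ∀ u : B, TangentSpace 𝓘(ℝ, E) u →ₗ[ℝ] Matrix ι ι ℝ) : Prop where
  smooth : ∀ i j, ContMDiff (𝓘(ℝ, E).tangent) 𝓘(ℝ, ℝ) ∞
    (fun p : TangentBundle 𝓘(ℝ, E) B => θ p.1 p.2 i j)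
  /-- `(R_h)^* θ = Ad(h⁻¹) ∘ θ`. -/
  equivariant : ∀ (h : H) (u : B) (v : TangentSpace 𝓘(ℝ, E) u),
    θ (act u h) (mfderiv 𝓘(ℝ, E) 𝓘(ℝ, E) (fun u' => act u' h) u v) =
      rep h⁻¹ * θ u v * rep h
  /-- `θ` reproduces the generators of fundamental vector fields: if `c` is a smooth curve in `H`
  with `c 0 = 1` and velocity `X = (rep ∘ c)'(0)`, then the velocity of `u · c(t)` at `t = 0` is
  the value `ζ_X(u)` of the fundamental field, and `θ (ζ_X(u)) = X`. -/
  fundamental : ∀ (u : B) (c : ℝ → H), SmoothIntoOn (E := ℝ) emb c Set.univ → c 0 = 1 →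
    ∀ i j, θ (act u (c 0)) (mfderiv 𝓘(ℝ, ℝ) 𝓘(ℝ, E) (fun t : ℝ => act u (c t)) 0 (1 : ℝ)) i j =
      deriv (fun t => rep (c t) i j) 0
  /-- Each `θ u` is a linear isomorphism from the tangent space onto `𝔤`. -/
  injective : ∀ u, Function.Injective (θ u)
  range_eq : ∀ u, LinearMap.range (θ u) = 𝔤.toSubmodule

/-- The curvature `K(v, w) = dθ(v, w) + [θ(v), θ(w)]`. -/
def curvature (θ : ∀ u : B, TangentSpace 𝓘(ℝ, E) u →ₗ[ℝ] Matrix ι ι ℝ) (u : B)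
    (v w : TangentSpace 𝓘(ℝ, E) u) : Matrix ι ι ℝ :=
  Matrix.of (fun i j => extDerivForm
    (fun u' => (Matrix.entryLinearMap ℝ ℝ i j) ∘ₗ (θ u')) u v w) + ⁅θ u v, θ u w⁆

/-- The Cartan connection `θ` is flat: its curvature vanishes. -/
def IsFlat (θ : ∀ u : B, TangentSpace 𝓘(ℝ, E) u →ₗ[ℝ] Matrix ι ι ℝ) : Prop :=
  ∀ u v w, curvature θ u v w = 0

/-- The curvature function `κ(u)(A, A') = K(θ(u)⁻¹ A, θ(u)⁻¹ A')`, for `A`, `A'` in `𝔤`. -/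
def curvatureFunction (θ : ∀ u : B, TangentSpace 𝓘(ℝ, E) u →ₗ[ℝ] Matrix ι ι ℝ) (u : B)
    (A A' : Matrix ι ι ℝ) : Matrix ι ι ℝ :=
  curvature θ u (Function.invFun (θ u) A) (Function.invFun (θ u) A')

/-- `A₁, …, Aₘ ∈ 𝔤` induce a basis of `𝔤/𝔭`, and `Z₁, …, Zₘ ∈ 𝔭₊ = 𝔭^⊥` represent the dual basis
under the identification `𝔭₊ ≅ (𝔤/𝔭)^*` given by the Killing form. -/
structure IsDualFrame {𝔤 : LieSubalgebra ℝ (Matrix ι ι ℝ)} (𝔭 : LieSubalgebra ℝ 𝔤) {m : ℕ}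
    (A Z : Fin m → 𝔤) : Prop where
  linearIndependent : LinearIndependent ℝ (fun i => 𝔭.toSubmodule.mkQ (A i))
  span_eq_top : Submodule.span ℝ (Set.range fun i => 𝔭.toSubmodule.mkQ (A i)) = ⊤
  orthogonal : ∀ i, ∀ X ∈ 𝔭, killingForm ℝ 𝔤 X (Z i) = 0
  dual : ∀ i j, killingForm ℝ 𝔤 (A i) (Z j) = if i = j then 1 else 0

/-- The Kostant codifferential of the curvature function,
`(∂^* κ)(u)(X) = 2 ∑ᵢ [κ(u)(Aᵢ, X), Zᵢ] + ∑ᵢ κ(u)(Aᵢ, [Zᵢ, X])`, computed in a dual frame. -/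
def codifferential {𝔤 : LieSubalgebra ℝ (Matrix ι ι ℝ)} {m : ℕ} (A Z : Fin m → 𝔤)
    (θ : ∀ u : B, TangentSpace 𝓘(ℝ, E) u →ₗ[ℝ] Matrix ι ι ℝ) (u : B) (X : 𝔤) : Matrix ι ι ℝ :=
  (2 : ℝ) • ∑ i, ⁅curvatureFunction θ u (A i) X, (Z i : Matrix ι ι ℝ)⁆ +
    ∑ i, curvatureFunction θ u (A i) (⁅Z i, X⁆ : 𝔤)

/-- The Cartan connection `θ` is normal: `∂^* κ = 0` (the codifferential does not depend on the
dual frame). -/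
def IsNormal {𝔤 : LieSubalgebra ℝ (Matrix ι ι ℝ)} (𝔭 : LieSubalgebra ℝ 𝔤)
    (θ : ∀ u : B, TangentSpace 𝓘(ℝ, E) u →ₗ[ℝ] Matrix ι ι ℝ) : Prop :=
  ∀ (m : ℕ) (A Z : Fin m → 𝔤), IsDualFrame 𝔭 A Z →
    ∀ (u : B) (X : 𝔤), codifferential A Z θ u X = 0

/-- The stabiliser in the matrix Lie algebra `𝔤` of the line through `v`. -/
def lineStabilizer (𝔤 : LieSubalgebra ℝ (Matrix ι ι ℝ)) (v : ι → ℝ) : LieSubalgebra ℝ 𝔤 where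
  carrier := {X | ∃ c : ℝ, (X : Matrix ι ι ℝ) *ᵥ v = c • v}
  add_mem' := by
    rintro X Y ⟨a, ha⟩ ⟨b, hb⟩
    exact ⟨a + b, by simp [Matrix.add_mulVec, ha, hb, add_smul]⟩
  zero_mem' := ⟨0, by simp⟩
  smul_mem' := by
    rintro r X ⟨a, ha⟩
    exact ⟨r * a, by simp [Matrix.smul_mulVec, ha, mul_smul]⟩
  lie_mem' := by
    rintro X Y ⟨a, ha⟩ ⟨b, hb⟩
    refine ⟨0, ?_⟩
    simp [Ring.lie_def, Matrix.sub_mulVec, ← Matrix.mulVec_mulVec, ha, hb, Matrix.mulVec_smul,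
      smul_smul, mul_comm]

/-- The stabiliser in a group `H`, acting through `rep`, of the ray through `v`. -/
def rayStabilizer {H : Type*} [Group H] (rep : H →* Matrix ι ι ℝ) (v : ι → ℝ) : Subgroup H where
  carrier := {h | ∃ c : ℝ, 0 < c ∧ rep h *ᵥ v = c • v}
  one_mem' := ⟨1, one_pos, by simp⟩
  mul_mem' := by
    rintro g h ⟨a, ha, hg⟩ ⟨b, hb, hh⟩
    exact ⟨b * a, mul_pos hb ha, by
      rw [map_mul, ← Matrix.mulVec_mulVec, hh, Matrix.mulVec_smul, hg, smul_smul]⟩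
  inv_mem' := by
    rintro g ⟨a, ha, hg⟩
    refine ⟨a⁻¹, inv_pos.2 ha, ?_⟩
    have h1 : rep g⁻¹ *ᵥ (rep g *ᵥ v) = v := by
      rw [Matrix.mulVec_mulVec, ← map_mul, inv_mul_cancel, map_one, Matrix.one_mulVec]
    rw [hg, Matrix.mulVec_smul] at h1
    calc rep g⁻¹ *ᵥ v = a⁻¹ • (a • (rep g⁻¹ *ᵥ v)) := by
          rw [smul_smul, inv_mul_cancel₀ ha.ne', one_smul]
      _ = a⁻¹ • v := by rw [h1]

end Cartan

/-! ### The projective model `(SL(n+1), P)` -/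

/-- The Lie algebra `𝔰𝔩(n+1, ℝ)`. -/
abbrev projAlg (n : ℕ) : LieSubalgebra ℝ (Matrix (Fin (n + 1)) (Fin (n + 1)) ℝ) :=
  LieAlgebra.SpecialLinear.sl (Fin (n + 1)) ℝ

/-- The vector `v₊ = (1, 0, …, 0)` of `ℝⁿ⁺¹`. -/
def vPlus (n : ℕ) : Fin (n + 1) → ℝ := Pi.single 0 1

/-- The standard representation of `SL(n+1, ℝ)`. -/
def slRep (n : ℕ) :
    Matrix.SpecialLinearGroup (Fin (n + 1)) ℝ →* Matrix (Fin (n + 1)) (Fin (n + 1)) ℝ where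
  toFun A := A.1
  map_one' := rfl
  map_mul' _ _ := rfl

/-- The parabolic subgroup `P ⊂ SL(n+1)`: the stabiliser of the ray through `v₊`. -/
def projP (n : ℕ) : Subgroup (Matrix.SpecialLinearGroup (Fin (n + 1)) ℝ) :=
  rayStabilizer (slRep n) (vPlus n)

/-- The Lie algebra `𝔭` of `P`. -/
def projAlgP (n : ℕ) : LieSubalgebra ℝ (projAlg n) := lineStabilizer (projAlg n) (vPlus n)

/-- The standard representation of `P`. -/
def projRep (n : ℕ) : projP n →* Matrix (Fin (n + 1)) (Fin (n + 1)) ℝ :=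
  (slRep n).comp (projP n).subtype

/-! ### The conformal model `(Spin(n+1,n+1), P̃)` -/

/-- The index set of `ℝⁿ⁺¹'ⁿ⁺¹ = E ⊕ F`, with `E = ℝⁿ⁺¹` and `F` its dual. -/
abbrev Idx (n : ℕ) : Type := Fin (n + 1) ⊕ Fin (n + 1)

/-- The quadratic form `v ↦ h(v, v)` of the split form `h` with matrix `(0 1; 1 0)`. -/
def splitForm (n : ℕ) : QuadraticForm ℝ (Idx n → ℝ) :=
  (Matrix.toBilin' (LieAlgebra.Orthogonal.JD (Fin (n + 1)) ℝ)).toQuadraticMap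

/-- The Lie algebra `𝔰𝔬(n+1, n+1)` of the split form `h`. -/
abbrev confAlg (n : ℕ) : LieSubalgebra ℝ (Matrix (Idx n) (Idx n) ℝ) :=
  LieAlgebra.Orthogonal.typeD (Fin (n + 1)) ℝ

/-- The (connected) group `Spin(n+1, n+1)`. -/
abbrev SpinG (n : ℕ) : Type := spinGroup (splitForm n)

/-- The inclusion of vectors in the Clifford algebra. -/
abbrev vec (n : ℕ) : (Idx n → ℝ) →ₗ[ℝ] CliffordAlgebra (splitForm n) :=
  CliffordAlgebra.ι (splitForm n)

theorem vec_injective (n : ℕ) : Function.Injective (vec n) :=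
  by
  intro v w h
  have h' := congrArg (CliffordAlgebra.equivExterior (splitForm n)) h
  simpa [vec, CliffordAlgebra.equivExterior] using h'

theorem spin_conj_mem (n : ℕ) (g : SpinG n) (v : Idx n → ℝ) :
    (g : CliffordAlgebra (splitForm n)) * vec n v * (g⁻¹ : SpinG n) ∈
      LinearMap.range (vec n) :=
  spinGroup.conjAct_smul_ι_mem_range_ι (x := spinGroup.toUnits g) g.2 v

/-- The action of an element of the spin group on vectors, `v ↦ g v g⁻¹`. -/
def spinVec (n : ℕ) (g : SpinG n) : (Idx n → ℝ) →ₗ[ℝ] (Idx n → ℝ) :=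
  (LinearEquiv.ofInjective (vec n) (vec_injective n)).symm.toLinearMap ∘ₗ
    LinearMap.codRestrict (LinearMap.range (vec n))
      (LinearMap.mulRight ℝ ((g⁻¹ : SpinG n) : CliffordAlgebra (splitForm n)) ∘ₗ
        LinearMap.mulLeft ℝ (g : CliffordAlgebra (splitForm n)) ∘ₗ vec n)
      (fun v => spin_conj_mem n g v)

theorem vec_spinVec (n : ℕ) (g : SpinG n) (v : Idx n → ℝ) :
    vec n (spinVec n g v) =
      (g : CliffordAlgebra (splitForm n)) * vec n v * (g⁻¹ : SpinG n) := by
  have h := LinearEquiv.apply_symm_apply (LinearEquiv.ofInjective (vec n) (vec_injective n))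
    (LinearMap.codRestrict (LinearMap.range (vec n))
      (LinearMap.mulRight ℝ ((g⁻¹ : SpinG n) : CliffordAlgebra (splitForm n)) ∘ₗ
        LinearMap.mulLeft ℝ (g : CliffordAlgebra (splitForm n)) ∘ₗ vec n)
      (fun v => spin_conj_mem n g v) v)
  exact congrArg Subtype.val h

/-- The vector representation `Spin(n+1, n+1) → SO(n+1, n+1)`, characterised by
`vec (spinRep g *ᵥ v) = g * vec v * g⁻¹`. -/
def spinRep (n : ℕ) : SpinG n →* Matrix (Idx n) (Idx n) ℝ where
  toFun g := LinearMap.toMatrix' (spinVec n g)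
  map_one' := by
    rw [← LinearMap.toMatrix'_one]
    congr 1
    refine LinearMap.ext fun v => vec_injective n ?_
    simp [vec_spinVec]
  map_mul' g h := by
    rw [← LinearMap.toMatrix'_mul]
    congr 1
    refine LinearMap.ext fun v => vec_injective n ?_
    simp [vec_spinVec, mul_assoc]

/-- The null vector `ṽ₊ = (1, 0, …, 0, 1)` of `ℝⁿ⁺¹'ⁿ⁺¹`. -/
def vTilde (n : ℕ) : Idx n → ℝ := Sum.elim (Pi.single 0 1) (Pi.single (Fin.last n) 1)

/-- The parabolic subgroup `P̃ ⊂ Spin(n+1, n+1)`: the stabiliser of the ray through `ṽ₊`. -/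
def confP (n : ℕ) : Subgroup (SpinG n) := rayStabilizer (spinRep n) (vTilde n)

/-- The Lie algebra `𝔭̃` of `P̃`. -/
def confAlgP (n : ℕ) : LieSubalgebra ℝ (confAlg n) := lineStabilizer (confAlg n) (vTilde n)

/-- The vector representation of `P̃`. -/
def confRep (n : ℕ) : confP n →* Matrix (Idx n) (Idx n) ℝ :=
  (spinRep n).comp (confP n).subtype

/-- The embedding of `P̃` in the Clifford algebra. -/
def confEmb (n : ℕ) (g : confP n) : CliffordAlgebra (splitForm n) := (g : SpinG n)

/-! ### The inclusion `SL(n+1) ↪ Spin(n+1,n+1)` -/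

/-- `A ↦ (A 0; 0 -Aᵀ)`, the inclusion of `𝔰𝔩(n+1)` in `𝔰𝔬(n+1, n+1)`. -/
def algIncl (n : ℕ) (A : Matrix (Fin (n + 1)) (Fin (n + 1)) ℝ) : Matrix (Idx n) (Idx n) ℝ :=
  Matrix.fromBlocks A 0 0 (-Aᵀ)

/-- `A ↦ (A 0; 0 (A⁻¹)ᵀ)`, the action of `SL(n+1)` on `E ⊕ F`. -/
def grpIncl (n : ℕ) : Matrix.SpecialLinearGroup (Fin (n + 1)) ℝ →* Matrix (Idx n) (Idx n) ℝ where
  toFun A := Matrix.fromBlocks A.1 0 0 (A⁻¹).1ᵀ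
  map_one' := by simp
  map_mul' A B := by
    rw [Matrix.fromBlocks_multiply, mul_inv_rev]
    simp [Matrix.SpecialLinearGroup.coe_mul, Matrix.transpose_mul,
      -Matrix.SpecialLinearGroup.coe_inv]

/-- The pure spinor `s_F = f₀ ⋯ fₙ`, in the model of the spin representation as the left ideal of
the Clifford algebra generated by `f₀ ⋯ fₙ`; it is annihilated exactly by the vectors in `F`. -/
def spinorF (n : ℕ) : CliffordAlgebra (splitForm n) :=
  (List.ofFn fun i : Fin (n + 1) => vec n (Pi.single (Sum.inr i) 1)).prod

/-- The pure spinor `s_E = e₀ ⋯ eₙ f₀ ⋯ fₙ` in the same left ideal; it is annihilated exactly by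
the vectors in `E`. -/
def spinorE (n : ℕ) : CliffordAlgebra (splitForm n) :=
  (List.ofFn fun i : Fin (n + 1) => vec n (Pi.single (Sum.inl i) 1)).prod * spinorF n

/-- The graph of the inclusion `i : SL(n+1) → Spin(n+1, n+1)`, an isomorphism onto the stabiliser
of the two spinors: `i(A) = g` if and only if `g` fixes `s_E` and `s_F` and acts on
`E ⊕ F` by `(A 0; 0 (A⁻¹)ᵀ)`. -/
structure IsSpinImage (n : ℕ) (A : Matrix.SpecialLinearGroup (Fin (n + 1)) ℝ) (g : SpinG n) :
    Prop where
  fix_E : (g : CliffordAlgebra (splitForm n)) * spinorE n = spinorE n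
  fix_F : (g : CliffordAlgebra (splitForm n)) * spinorF n = spinorF n
  rep_eq : spinRep n g = grpIncl n A

/-- The subgroup `Q = i⁻¹(P̃)` of `SL(n+1)`, contained in `P` (see `projQ_le`). -/
def projQ (n : ℕ) : Subgroup (Matrix.SpecialLinearGroup (Fin (n + 1)) ℝ) :=
  rayStabilizer (grpIncl n) (vTilde n)

theorem projQ_le (n : ℕ) : projQ n ≤ projP n := by
  rintro A ⟨c, hc, h⟩
  refine ⟨c, hc, ?_⟩
  funext i
  have := congrFun h (Sum.inl i)
  simpa [grpIncl, vTilde, vPlus, slRep, Matrix.fromBlocks_mulVec] using this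

/-- The inclusion `Q ⊂ P`. -/
def qToP (n : ℕ) (q : projQ n) : projP n := ⟨q.1, projQ_le n q.2⟩

/-- The embedding of `Q` in the algebra of matrices. -/
def qEmb (n : ℕ) (q : projQ n) : Matrix (Fin (n + 1)) (Fin (n + 1)) ℝ := q.1.1

/-! ### The Fefferman-type construction -/

section Construction

variable {n : ℕ} {G : Type*} (act : G → projP n → G)

/-- The restriction to `Q` of the right action of `P`. -/
def qAct (u : G) (q : projQ n) : G := act u (qToP n q)

/-- The correspondence space `M̃ = 𝒢/Q`. -/
def CorrSpace : Type _ := Quot fun u u' : G => ∃ q : projQ n, u' = qAct act u q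

/-- The projection `𝒢 → M̃ = 𝒢/Q`. -/
def toCorr (u : G) : CorrSpace act := Quot.mk _ u

/-- The extended bundle `𝒢̃ = 𝒢 ×_Q P̃`, where `(u, i(q) g) ∼ (u q, g)`. -/
def ExtBundle : Type _ := Quot fun a b : G × confP n => ∃ (q : projQ n) (k : confP n),
  IsSpinImage n q.1 k.1 ∧ b.1 = qAct act a.1 q ∧ a.2 = k * b.2

/-- The natural map `𝒢 → 𝒢̃`, `u ↦ [u, 1]`. -/
def toExt (u : G) : ExtBundle act := Quot.mk _ (u, 1)

/-- The right action of `P̃` on `𝒢̃`, `[u, g] h = [u, g h]`. -/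
def extAct (a : ExtBundle act) (h : confP n) : ExtBundle act :=
  Quot.map (fun p : G × confP n => (p.1, p.2 * h))
    (by rintro a b ⟨q, k, h1, h2, h3⟩; exact ⟨q, k, h1, h2, by simp [h3, mul_assoc]⟩) a

/-- The projection `𝒢̃ → M̃`, `[u, g] ↦ [u]`. -/
def extProj (a : ExtBundle act) : CorrSpace act :=
  Quot.map Prod.fst (by rintro a b ⟨q, _, _, h2, _⟩; exact ⟨q, h2⟩) a

end Construction

end Fefferman

end

/-!
If `θ` is flat, the curvature of `θ'` vanishes along the image of `𝒢` and hence, by equivariance,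
everywhere (`isFlat_of_isFlat`).  The substance is the converse: if both `θ` and `θ'` are normal,
then `θ` is flat.

A Cartan curvature vanishes on the generators of the structure group
(`IsCartanConnection.curvature_eq_zero_of_velocity`).  Enough of these generators are exhibited as
velocities of curves: all of `𝔭` for the projective connection (`exists_curve_projP`), and all
elements of `𝔰𝔬(n+1, n+1)` annihilating `ṽ₊` for the conformal one (`exists_curve_confP`,
`curvatureForm_eq_zero_of_mulVec_eq_zero`).  As `𝔰𝔩(n+1)` acts on `ṽ₊` with image all of `ṽ₊^⊥`
(`exists_algIncl_mulVec_eq`), the conformal curvature along the image of `𝒢` is the image under `i'`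
of the projective curvature `K` (`curvatureForm_eq_algIncl`).

Write `A_p = E_{p0}`, `p ≥ 1`, for the frame of `𝔤/𝔭`.  Normality of `θ` says that `K` has no
torsion and that `∑ᵢ K(A_i, X)_{iq} = K(A_q, X)_{00}`.  The conformal codifferential, in a frame
adapted to `ṽ₊`, then reduces to the condition that
`K(A_p, X)_{mq} + δ_{mq} K(A_p, X)_{00}` is symmetric in `p` and `q` for the last index `m = n`
(`IsNormal.isSymmAlong_last`).  The condition holds at all points of `𝒢`, and equivariance under the
transvections in `P` extends it to all `m` (`isSymmAlong_of_last`).  With `X = A_j` the expression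
is also antisymmetric in `p` and `j`, so it vanishes; as `K` is
trace-free and `n ≠ 1`, only the row `K_{0 *}` can be nonzero
(`apply_succ_eq_zero_of_isSymmAlong`).  Finally, for `n ≥ 3` the Bianchi identity, read in row `k`
with `k` different from `p` and `j`, gives `K(A_p, A_j)_{0 *} = 0`
(`isFlat_of_apply_succ_eq_zero`).

All statements about tangent vectors at a point are proved by extending them to a smooth map from a
Euclidean space (`exists_contMDiff_mfderiv_eq`), along which the curvature of a connection becomes
that of a matrix-valued form (`curvature_pullback`).
-/

noncomputable section

namespace Fefferman

attribute [local instance 100] LieRing.ofAssociativeRing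

/-! ### One-forms and their pullbacks -/

section Pullback

variable {E : Type*} [NormedAddCommGroup E] [NormedSpace ℝ E]
  {B : Type*} [TopologicalSpace B] [ChartedSpace E B] [IsManifold 𝓘(ℝ, E) ∞ B]
  {V : Type*} [NormedAddCommGroup V] [NormedSpace ℝ V]

theorem contMDiff_apply_mfderiv {α : ∀ x : B, TangentSpace 𝓘(ℝ, E) x →ₗ[ℝ] ℝ}
    (hα : ContMDiff 𝓘(ℝ, E).tangent 𝓘(ℝ, ℝ) ∞
      (fun p : TangentBundle 𝓘(ℝ, E) B => α p.1 p.2))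
    {Φ : V → B} (hΦ : ContMDiff 𝓘(ℝ, V) 𝓘(ℝ, E) ∞ Φ) (w : V) :
    ContDiff ℝ ∞ (fun q => α (Φ q) (mfderiv 𝓘(ℝ, V) 𝓘(ℝ, E) Φ q w)) := by
  rw [← contMDiff_iff_contDiff]
  have h1 : ContMDiff 𝓘(ℝ, V).tangent 𝓘(ℝ, E).tangent ∞ (tangentMap 𝓘(ℝ, V) 𝓘(ℝ, E) Φ) :=
    hΦ.contMDiff_tangentMap le_rfl
  have h2 : ContMDiff 𝓘(ℝ, V) 𝓘(ℝ, V).tangent ∞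
      (fun q : V => (⟨q, w⟩ : TangentBundle 𝓘(ℝ, V) V)) :=
    contMDiff_vectorSpace_iff_contDiff.2 (contDiff_const (c := w))
  exact hα.comp (h1.comp h2)

theorem contDiffOn_chartComponent {α : ∀ x : B, TangentSpace 𝓘(ℝ, E) x →ₗ[ℝ] ℝ}
    (hα : ContMDiff 𝓘(ℝ, E).tangent 𝓘(ℝ, ℝ) ∞
      (fun p : TangentBundle 𝓘(ℝ, E) B => α p.1 p.2)) (x : B) (w : E) :
    ContDiffOn ℝ ∞ (chartComponent α x w) (extChartAt 𝓘(ℝ, E) x).target := by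
  set S := (extChartAt 𝓘(ℝ, E) x).target
  have hS : IsOpen S := isOpen_extChartAt_target x
  rw [← contMDiffOn_iff_contDiffOn]
  have h0 : ContMDiffOn 𝓘(ℝ, E) 𝓘(ℝ, E) ∞ (extChartAt 𝓘(ℝ, E) x).symm S :=
    contMDiffOn_extChartAt_symm x
  have h1 := h0.contMDiffOn_tangentMapWithin (m := ∞) le_rfl hS.uniqueMDiffOn
  have h2 : ContMDiff 𝓘(ℝ, E) 𝓘(ℝ, E).tangent ∞
      (fun q : E => (⟨q, w⟩ : TangentBundle 𝓘(ℝ, E) E)) :=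
    contMDiff_vectorSpace_iff_contDiff.2 (contDiff_const (c := w))
  have h3 := hα.comp_contMDiffOn (h1.comp h2.contMDiffOn (s := S) (fun q hq => hq))
  refine h3.congr fun y hy => ?_
  simp only [chartComponent, Function.comp, tangentMapWithin]
  rw [mfderivWithin_of_isOpen hS hy]
  rfl

variable [FiniteDimensional ℝ E]

/-- Naturality of the exterior derivative: for a parametrised family `Φ : V → B`, the exterior
derivative of `α`, evaluated on velocities of `Φ`, is the exterior derivative of `Φ^* α`. -/
theorem extDerivForm_pullback {α : ∀ x : B, TangentSpace 𝓘(ℝ, E) x →ₗ[ℝ] ℝ}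
    (hα : ContMDiff 𝓘(ℝ, E).tangent 𝓘(ℝ, ℝ) ∞
      (fun p : TangentBundle 𝓘(ℝ, E) B => α p.1 p.2))
    {Φ : V → B} (hΦ : ContMDiff 𝓘(ℝ, V) 𝓘(ℝ, E) ∞ Φ) (p v w : V) :
    extDerivForm α (Φ p) (mfderiv 𝓘(ℝ, V) 𝓘(ℝ, E) Φ p v) (mfderiv 𝓘(ℝ, V) 𝓘(ℝ, E) Φ p w) =
      fderiv ℝ (fun q => α (Φ q) (mfderiv 𝓘(ℝ, V) 𝓘(ℝ, E) Φ q w)) p v -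
      fderiv ℝ (fun q => α (Φ q) (mfderiv 𝓘(ℝ, V) 𝓘(ℝ, E) Φ q v)) p w := by
  set φ := extChartAt 𝓘(ℝ, E) (Φ p) with hφ
  set ψ : V → E := fun q => φ (Φ q) with hψdef
  have hsrc : ∀ᶠ q in nhds p, Φ q ∈ φ.source :=
    hΦ.continuous.continuousAt.eventually (extChartAt_source_mem_nhds (I := 𝓘(ℝ, E)) (Φ p))
  have hS : IsOpen φ.target := isOpen_extChartAt_target (Φ p)
  have hψq : ∀ q, Φ q ∈ φ.source → ContDiffAt ℝ ∞ ψ q := by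
    intro q hq
    rw [← contMDiffAt_iff_contDiffAt]
    refine ContMDiffAt.comp (I' := 𝓘(ℝ, E)) q ?_ (hΦ q)
    exact contMDiffAt_extChartAt' (by simpa [hφ] using hq)
  have hp : Φ p ∈ φ.source := mem_extChartAt_source (Φ p)
  -- `A` is the form in the chart, so that `Φ^* α = A(ψ) dψ` near `p`
  let A : E → E →L[ℝ] ℝ := fun y => LinearMap.toContinuousLinearMap
    ((α (φ.symm y)) ∘ₗ (mfderiv 𝓘(ℝ, E) 𝓘(ℝ, E) φ.symm y).toLinearMap)
  have hA : ContDiffOn ℝ ∞ A φ.target :=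
    contDiffOn_clm_apply.2 fun w => contDiffOn_chartComponent hα (Φ p) w
  have hAp : DifferentiableAt ℝ A (ψ p) :=
    (hA.contDiffAt (hS.mem_nhds (φ.map_source hp))).differentiableAt (by simp)
  have hkey : ∀ w : V, (fun q => α (Φ q) (mfderiv 𝓘(ℝ, V) 𝓘(ℝ, E) Φ q w)) =ᶠ[nhds p]
      fun q => A (ψ q) (fderiv ℝ ψ q w) := by
    intro w
    filter_upwards [hsrc] with q hq
    have h1 : Φ =ᶠ[nhds q] φ.symm ∘ ψ := by
      have : ∀ᶠ q' in nhds q, Φ q' ∈ φ.source :=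
        hΦ.continuous.continuousAt.eventually
          ((isOpen_extChartAt_source (I := 𝓘(ℝ, E)) (Φ p)).mem_nhds hq)
      filter_upwards [this] with q' hq'
      exact (φ.left_inv hq').symm
    have h2 : MDifferentiableAt 𝓘(ℝ, E) 𝓘(ℝ, E) φ.symm (ψ q) :=
      ((contMDiffOn_extChartAt_symm (n := ∞) (Φ p)).contMDiffAt
        (hS.mem_nhds (φ.map_source hq))).mdifferentiableAt (by simp)
    have h3 : MDifferentiableAt 𝓘(ℝ, V) 𝓘(ℝ, E) ψ q :=
      ((hψq q hq).differentiableAt (by simp)).mdifferentiableAt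
    have h4 : mfderiv 𝓘(ℝ, V) 𝓘(ℝ, E) Φ q =
        (mfderiv 𝓘(ℝ, E) 𝓘(ℝ, E) φ.symm (ψ q)).comp (mfderiv 𝓘(ℝ, V) 𝓘(ℝ, E) ψ q) := by
      rw [← mfderiv_comp q h2 h3]
      exact h1.mfderiv_eq
    have h5 : φ.symm (ψ q) = Φ q := φ.left_inv hq
    have h6 : mfderiv 𝓘(ℝ, V) 𝓘(ℝ, E) Φ q w =
        mfderiv 𝓘(ℝ, E) 𝓘(ℝ, E) φ.symm (ψ q) (fderiv ℝ ψ q w) := by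
      rw [h4, mfderiv_eq_fderiv]; rfl
    rw [h6]
    change _ = α (φ.symm (ψ q)) (mfderiv 𝓘(ℝ, E) 𝓘(ℝ, E) φ.symm (ψ q) (fderiv ℝ ψ q w))
    rw [h5]
  have hψ : ContDiffAt ℝ ∞ ψ p := hψq p hp
  have hψ1 : DifferentiableAt ℝ ψ p := hψ.differentiableAt (by simp)
  have hψ2 : DifferentiableAt ℝ (fderiv ℝ ψ) p :=
    (hψ.fderiv_right (m := 1) (by norm_cast)).differentiableAt (by simp)
  have hder : ∀ v w : V, fderiv ℝ (fun q => α (Φ q) (mfderiv 𝓘(ℝ, V) 𝓘(ℝ, E) Φ q w)) p v =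
      fderiv ℝ A (ψ p) (fderiv ℝ ψ p v) (fderiv ℝ ψ p w) +
        A (ψ p) (fderiv ℝ (fderiv ℝ ψ) p v w) := by
    intro v w
    rw [(hkey w).fderiv_eq]
    have h1 : HasFDerivAt (fun q => A (ψ q)) ((fderiv ℝ A (ψ p)).comp (fderiv ℝ ψ p)) p :=
      hAp.hasFDerivAt.comp p hψ1.hasFDerivAt
    have h2 : HasFDerivAt (fun q => fderiv ℝ ψ q w)
        ((ContinuousLinearMap.apply ℝ E w).comp (fderiv ℝ (fderiv ℝ ψ) p)) p :=
      (ContinuousLinearMap.apply ℝ E w).hasFDerivAt.comp p hψ2.hasFDerivAt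
    rw [(h1.clm_apply h2).fderiv]
    simp [add_comm]
  -- the second derivatives of `ψ` are symmetric and drop out of the antisymmetrised derivative
  have hsymm : fderiv ℝ (fderiv ℝ ψ) p v w = fderiv ℝ (fderiv ℝ ψ) p w v :=
    (hψ.isSymmSndFDerivAt (by simpa using WithTop.coe_le_coe.2 (le_top : (2 : ℕ∞) ≤ ⊤))).eq v w
  have hchart : ∀ v : V, mfderiv 𝓘(ℝ, E) 𝓘(ℝ, E) φ (Φ p) (mfderiv 𝓘(ℝ, V) 𝓘(ℝ, E) Φ p v) =
      fderiv ℝ ψ p v := by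
    intro v
    have h2 : MDifferentiableAt 𝓘(ℝ, E) 𝓘(ℝ, E) φ (Φ p) :=
      (contMDiffAt_extChartAt (n := ∞)).mdifferentiableAt (by simp)
    have h3 : MDifferentiableAt 𝓘(ℝ, V) 𝓘(ℝ, E) Φ p := (hΦ p).mdifferentiableAt (by simp)
    rw [← mfderiv_eq_fderiv]
    change _ = mfderiv 𝓘(ℝ, V) 𝓘(ℝ, E) (φ ∘ Φ) p v
    rw [mfderiv_comp p h2 h3]; rfl
  have hcomp : ∀ a b : E, fderiv ℝ (chartComponent α (Φ p) b) (ψ p) a =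
      fderiv ℝ A (ψ p) a b := by
    intro a b
    have h2 : HasFDerivAt (fun y => A y b)
        ((ContinuousLinearMap.apply ℝ ℝ b).comp (fderiv ℝ A (ψ p))) (ψ p) :=
      (ContinuousLinearMap.apply ℝ ℝ b).hasFDerivAt.comp (ψ p) hAp.hasFDerivAt
    change fderiv ℝ (fun y => A y b) (ψ p) a = _
    rw [h2.fderiv]; rfl
  rw [hder v w, hder w v, hsymm]
  simp only [extDerivForm]
  rw [hchart v, hchart w]
  rw [hcomp, hcomp]
  ring

end Pullback

/-- Through any point of a manifold there is a smooth map from Euclidean space, defined everywhere,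
with prescribed partial derivatives at the origin.  This reduces identities between tangent vectors
at a point to calculus in Euclidean space. -/
theorem exists_contMDiff_mfderiv_eq {E : Type*} [NormedAddCommGroup E] [NormedSpace ℝ E]
    {B : Type*} [TopologicalSpace B] [ChartedSpace E B] [IsManifold 𝓘(ℝ, E) ∞ B]
    {k : ℕ} (x : B) (v : Fin k → TangentSpace 𝓘(ℝ, E) x) :
    ∃ Φ : EuclideanSpace ℝ (Fin k) → B,
      ContMDiff 𝓘(ℝ, EuclideanSpace ℝ (Fin k)) 𝓘(ℝ, E) ∞ Φ ∧ Φ 0 = x ∧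
      ∀ i, (mfderiv 𝓘(ℝ, EuclideanSpace ℝ (Fin k)) 𝓘(ℝ, E) Φ 0 (EuclideanSpace.single i 1) : E) =
        v i := by
  set φ := extChartAt 𝓘(ℝ, E) x with hφ
  have hS : IsOpen φ.target := isOpen_extChartAt_target x
  have hx : x ∈ φ.source := mem_extChartAt_source x
  obtain ⟨r, hr, hball⟩ := Metric.isOpen_iff.1 hS (φ x) (φ.map_source hx)
  let v' : Fin k → E := fun i => mfderiv 𝓘(ℝ, E) 𝓘(ℝ, E) φ x (v i)
  set C : ℝ := 1 + ∑ i, ‖v' i‖ with hC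
  have hCpos : 0 < C := by positivity
  set ε : ℝ := r / C with hε
  have hεpos : 0 < ε := by positivity
  -- the coordinates are rescaled to stay bounded, so that the image remains in the chart
  let χ : EuclideanSpace ℝ (Fin k) → E := fun q => φ x + ∑ i, (ε * Real.sin (q i / ε)) • v' i
  have hcoord : ∀ i, ContDiff ℝ ∞ (fun q : EuclideanSpace ℝ (Fin k) => q i) := fun i =>
    (EuclideanSpace.proj (𝕜 := ℝ) i).contDiff
  have hχ : ContDiff ℝ ∞ χ := by
    refine contDiff_const.add (ContDiff.sum fun i _ => ContDiff.smul ?_ contDiff_const)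
    exact contDiff_const.mul (Real.contDiff_sin.comp ((hcoord i).div_const ε))
  have hχmem : ∀ q, χ q ∈ φ.target := by
    intro q
    apply hball
    rw [mem_ball_iff_norm]
    simp only [χ, add_sub_cancel_left]
    calc ‖∑ i, (ε * Real.sin (q i / ε)) • v' i‖
        ≤ ∑ i, ‖(ε * Real.sin (q i / ε)) • v' i‖ := norm_sum_le _ _
      _ ≤ ∑ i, ε * ‖v' i‖ := by
          refine Finset.sum_le_sum fun i _ => ?_
          rw [norm_smul, norm_mul, Real.norm_of_nonneg hεpos.le]
          gcongr
          calc ε * ‖Real.sin (q i / ε)‖ ≤ ε * 1 := by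
                gcongr; exact Real.abs_sin_le_one _
            _ = ε := mul_one _
      _ = ε * (C - 1) := by rw [← Finset.mul_sum]; simp [hC]
      _ < ε * C := by gcongr; linarith
      _ = r := by rw [hε]; field_simp
  have hχ0 : χ 0 = φ x := by simp [χ]
  have hχd : ∀ i, fderiv ℝ χ 0 (EuclideanSpace.single i 1) = v' i := by
    intro i
    have h1 : ∀ j, HasFDerivAt (fun q : EuclideanSpace ℝ (Fin k) => ε * Real.sin (q j / ε))
        (EuclideanSpace.proj (𝕜 := ℝ) j : EuclideanSpace ℝ (Fin k) →L[ℝ] ℝ) 0 := by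
      intro j
      have h2 : HasDerivAt (fun s : ℝ => ε * Real.sin (s / ε)) 1
          ((EuclideanSpace.proj (𝕜 := ℝ) j : EuclideanSpace ℝ (Fin k) →L[ℝ] ℝ) 0) := by
        have h3 : HasDerivAt (fun s : ℝ => s / ε) (1 / ε)
          ((EuclideanSpace.proj (𝕜 := ℝ) j : EuclideanSpace ℝ (Fin k) →L[ℝ] ℝ) 0) :=
          (hasDerivAt_id _).div_const ε
        have h4 := (h3.sin).const_mul ε
        simpa [hεpos.ne'] using h4
      have h5 := h2.comp_hasFDerivAt (0 : EuclideanSpace ℝ (Fin k))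
        (EuclideanSpace.proj (𝕜 := ℝ) j : EuclideanSpace ℝ (Fin k) →L[ℝ] ℝ).hasFDerivAt
      simpa [Function.comp_def] using h5
    have h6 : HasFDerivAt χ (∑ j, (EuclideanSpace.proj (𝕜 := ℝ) j :
        EuclideanSpace ℝ (Fin k) →L[ℝ] ℝ).smulRight (v' j)) 0 := by
      refine HasFDerivAt.const_add _ (HasFDerivAt.fun_sum fun j _ => ?_)
      exact (h1 j).smul_const (v' j)
    rw [h6.fderiv]
    simp
  have hsymm : ContMDiffOn 𝓘(ℝ, E) 𝓘(ℝ, E) ∞ φ.symm φ.target := contMDiffOn_extChartAt_symm x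
  refine ⟨fun q => φ.symm (χ q), ?_, ?_, fun i => ?_⟩
  · exact hsymm.comp_contMDiff hχ.contMDiff hχmem
  · simp only [hχ0]; exact φ.left_inv hx
  · have h1 : MDifferentiableAt 𝓘(ℝ, E) 𝓘(ℝ, E) φ.symm (χ 0) :=
      (hsymm.contMDiffAt (hS.mem_nhds (hχmem 0))).mdifferentiableAt (by simp)
    have h2 : MDifferentiableAt 𝓘(ℝ, EuclideanSpace ℝ (Fin k)) 𝓘(ℝ, E) χ 0 :=
      hχ.contMDiff.contMDiffAt.mdifferentiableAt (by simp)
    have h3 := mfderiv_comp (0 : EuclideanSpace ℝ (Fin k)) h1 h2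
    have h4 : (mfderiv 𝓘(ℝ, EuclideanSpace ℝ (Fin k)) 𝓘(ℝ, E) (fun q => φ.symm (χ q)) 0
        (EuclideanSpace.single i 1) : E) = mfderiv 𝓘(ℝ, E) 𝓘(ℝ, E) φ.symm (φ x)
          (mfderiv 𝓘(ℝ, E) 𝓘(ℝ, E) φ x (v i)) := by
      change mfderiv 𝓘(ℝ, EuclideanSpace ℝ (Fin k)) 𝓘(ℝ, E) (φ.symm ∘ χ) 0
        (EuclideanSpace.single i 1) = _
      rw [h3, ← hχ0]
      change mfderiv 𝓘(ℝ, E) 𝓘(ℝ, E) φ.symm (χ 0)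
        (mfderiv 𝓘(ℝ, EuclideanSpace ℝ (Fin k)) 𝓘(ℝ, E) χ 0 (EuclideanSpace.single i 1)) = _
      rw [mfderiv_eq_fderiv]
      exact congrArg (mfderiv 𝓘(ℝ, E) 𝓘(ℝ, E) φ.symm (χ 0)) (hχd i)
    rw [h4]
    have h5 : MDifferentiableAt 𝓘(ℝ, E) 𝓘(ℝ, E) φ x :=
      (contMDiffAt_extChartAt (n := ∞)).mdifferentiableAt (by simp)
    have h6 : MDifferentiableAt 𝓘(ℝ, E) 𝓘(ℝ, E) φ.symm (φ x) := hχ0 ▸ h1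
    have h7 := mfderiv_comp x h6 h5
    have h8 : (φ.symm ∘ φ) =ᶠ[nhds x] id := by
      filter_upwards [extChartAt_source_mem_nhds (I := 𝓘(ℝ, E)) x] with y hy
      exact φ.left_inv hy
    rw [h8.mfderiv_eq] at h7
    have h9 := congrArg (fun L => (L (v i) : E)) h7
    rw [mfderiv_id] at h9
    exact h9.symm

/-! ### Matrix-valued forms on vector spaces and the Bianchi identity -/

section MatrixCalculus

variable {V : Type*} [NormedAddCommGroup V] [NormedSpace ℝ V] {ι κ : Type*}

/-- The derivative at `p` in direction `v` of a matrix-valued function, taken entry by entry. -/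
def matDeriv (M : V → Matrix ι κ ℝ) (p v : V) : Matrix ι κ ℝ :=
  Matrix.of fun i j => fderiv ℝ (fun q => M q i j) p v

theorem matDeriv_apply (M : V → Matrix ι κ ℝ) (p v : V) (i : ι) (j : κ) :
    matDeriv M p v i j = fderiv ℝ (fun q => M q i j) p v := rfl

theorem matDeriv_add {M N : V → Matrix ι κ ℝ} {p : V}
    (hM : ∀ i j, DifferentiableAt ℝ (fun q => M q i j) p)
    (hN : ∀ i j, DifferentiableAt ℝ (fun q => N q i j) p) (v : V) :
    matDeriv (fun q => M q + N q) p v = matDeriv M p v + matDeriv N p v := by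
  ext i j
  simp only [matDeriv_apply, Matrix.add_apply]
  rw [fderiv_fun_add (hM i j) (hN i j)]; rfl

theorem matDeriv_sub {M N : V → Matrix ι κ ℝ} {p : V}
    (hM : ∀ i j, DifferentiableAt ℝ (fun q => M q i j) p)
    (hN : ∀ i j, DifferentiableAt ℝ (fun q => N q i j) p) (v : V) :
    matDeriv (fun q => M q - N q) p v = matDeriv M p v - matDeriv N p v := by
  ext i j
  simp only [matDeriv_apply, Matrix.sub_apply]
  rw [fderiv_fun_sub (hM i j) (hN i j)]; rfl

theorem matDeriv_mul [Fintype ι] {M N : V → Matrix ι ι ℝ} {p : V}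
    (hM : ∀ i j, DifferentiableAt ℝ (fun q => M q i j) p)
    (hN : ∀ i j, DifferentiableAt ℝ (fun q => N q i j) p) (v : V) :
    matDeriv (fun q => M q * N q) p v = matDeriv M p v * N p + M p * matDeriv N p v := by
  ext i j
  simp only [matDeriv_apply, Matrix.mul_apply, Matrix.add_apply]
  have : HasFDerivAt (fun q => ∑ k, M q i k * N q k j)
      (∑ k, (M p i k • fderiv ℝ (fun q => N q k j) p + N p k j • fderiv ℝ (fun q => M q i k) p)) p :=
    HasFDerivAt.fun_sum fun k _ => (hM i k).hasFDerivAt.mul (hN k j).hasFDerivAt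
  rw [this.fderiv]
  simp only [sum_apply, ← Finset.sum_add_distrib]
  refine Finset.sum_congr rfl fun k _ => ?_
  simp
  ring

theorem differentiableAt_mul_apply [Fintype ι] {M N : V → Matrix ι ι ℝ} {p : V}
    (hM : ∀ i j, DifferentiableAt ℝ (fun q => M q i j) p)
    (hN : ∀ i j, DifferentiableAt ℝ (fun q => N q i j) p) (i j : ι) :
    DifferentiableAt ℝ (fun q => (M q * N q) i j) p := by
  simp only [Matrix.mul_apply]
  exact DifferentiableAt.fun_sum fun k _ => (hM i k).mul (hN k j)

theorem matDeriv_linearMap [Fintype ι] [DecidableEq ι] {M : V → Matrix ι ι ℝ}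
    (T : Matrix ι ι ℝ →ₗ[ℝ] Matrix κ κ ℝ) {p : V}
    (hM : ∀ i j, DifferentiableAt ℝ (fun q => M q i j) p) (v : V) :
    matDeriv (fun q => T (M q)) p v = T (matDeriv M p v) := by
  have hT : ∀ A : Matrix ι ι ℝ, ∀ a b, T A a b = ∑ k, ∑ l, A k l * T (Matrix.single k l 1) a b := by
    intro A a b
    conv_lhs => rw [Matrix.matrix_eq_sum_single A]
    simp only [map_sum, Matrix.sum_apply]
    refine Finset.sum_congr rfl fun k _ => Finset.sum_congr rfl fun l _ => ?_
    rw [← mul_one (A k l), ← smul_eq_mul, ← Matrix.smul_single, map_smul]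
    simp
  ext a b
  rw [matDeriv_apply, hT]
  simp_rw [hT (M _)]
  have : HasFDerivAt (fun q => ∑ k, ∑ l, M q k l * T (Matrix.single k l 1) a b)
      (∑ k, ∑ l, (T (Matrix.single k l 1) a b) • fderiv ℝ (fun q => M q k l) p) p :=
    HasFDerivAt.fun_sum fun k _ => HasFDerivAt.fun_sum fun l _ =>
      (hM k l).hasFDerivAt.mul_const _
  rw [this.fderiv]
  simp [matDeriv_apply, mul_comm]

theorem differentiable_matDeriv {M : V → Matrix ι κ ℝ}
    (hM : ∀ i j, ContDiff ℝ ∞ (fun q => M q i j)) (v : V) (i : ι) (j : κ) : Differentiable ℝ (fun q => matDeriv M q v i j) := by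
  simp only [matDeriv_apply]
  have : ContDiff ℝ 1 (fderiv ℝ (fun q => M q i j)) := (hM i j).fderiv_right (by norm_cast)
  exact (this.differentiable (by simp)).clm_apply (differentiable_const v)

theorem matDeriv_comm {M : V → Matrix ι κ ℝ} (hM : ∀ i j, ContDiff ℝ ∞ (fun q => M q i j))
    (p v w : V) :
    matDeriv (fun q => matDeriv M q v) p w = matDeriv (fun q => matDeriv M q w) p v := by
  ext i j
  simp only [matDeriv_apply]
  have h1 : DifferentiableAt ℝ (fderiv ℝ (fun q => M q i j)) p :=
    (((hM i j).fderiv_right (m := 1) (by norm_cast)).differentiable (by simp)) p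
  have h2 : ∀ v w, fderiv ℝ (fun q => fderiv ℝ (fun q => M q i j) q v) p w =
      fderiv ℝ (fderiv ℝ (fun q => M q i j)) p w v := by
    intro v w
    rw [fderiv_clm_apply h1 (differentiableAt_const v)]
    simp
  rw [h2, h2]
  exact ((hM i j).contDiffAt.isSymmSndFDerivAt
    (by simpa using WithTop.coe_le_coe.2 (le_top : (2 : ℕ∞) ≤ ⊤))).eq w v

/-- The curvature `dα(v, w) + [α(v), α(w)]` at `p` of a matrix-valued one-form `α` on a vector
space; `α v` is the component of the form along the constant field `v`. -/
def formCurvature [Fintype ι] (α : V → V → Matrix ι ι ℝ) (v w p : V) : Matrix ι ι ℝ :=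
  matDeriv (α w) p v - matDeriv (α v) p w + (α v p * α w p - α w p * α v p)

/-- The Bianchi identity. -/
theorem formCurvature_bianchi [Fintype ι] {α : V → V → Matrix ι ι ℝ}
    (hα : ∀ w i j, ContDiff ℝ ∞ (fun q => α w q i j)) (a b c p : V) :
    matDeriv (formCurvature α a b) p c + matDeriv (formCurvature α b c) p a +
        matDeriv (formCurvature α c a) p b =
      (formCurvature α a b p * α c p - α c p * formCurvature α a b p) +
      (formCurvature α b c p * α a p - α a p * formCurvature α b c p) +
      (formCurvature α c a p * α b p - α b p * formCurvature α c a p) := by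
  have hd : ∀ w q i j, DifferentiableAt ℝ (fun q => α w q i j) q :=
    fun w q i j => ((hα w i j).differentiable (by simp)) q
  have hdd : ∀ w v q i j, DifferentiableAt ℝ (fun q => matDeriv (α w) q v i j) q :=
    fun w v q i j => differentiable_matDeriv (hα w) v i j q
  have hF : ∀ a b c : V, matDeriv (formCurvature α a b) p c =
      matDeriv (fun q => matDeriv (α b) q a) p c - matDeriv (fun q => matDeriv (α a) q b) p c +
      ((matDeriv (α a) p c * α b p + α a p * matDeriv (α b) p c) -
        (matDeriv (α b) p c * α a p + α b p * matDeriv (α a) p c)) := by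
    intro a b c
    change matDeriv (fun q => (matDeriv (α b) q a - matDeriv (α a) q b) +
      (α a q * α b q - α b q * α a q)) p c = _
    have hm := fun a b : V => differentiableAt_mul_apply (hd a p) (hd b p)
    rw [matDeriv_add (M := fun q => matDeriv (α b) q a - matDeriv (α a) q b)
      (N := fun q => α a q * α b q - α b q * α a q)
      (fun i j => (hdd b a p i j).sub (hdd a b p i j))
      (fun i j => (hm a b i j).sub (hm b a i j)),
      matDeriv_sub (hdd b a p) (hdd a b p), matDeriv_sub (hm a b) (hm b a),
      matDeriv_mul (hd a p) (hd b p), matDeriv_mul (hd b p) (hd a p)]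
  rw [hF, hF, hF, matDeriv_comm (hα b) p a c, matDeriv_comm (hα c) p b a,
    matDeriv_comm (hα a) p c b]
  simp only [formCurvature]
  noncomm_ring

end MatrixCalculus

/-! ### Curvature of matrix-valued forms on manifolds -/

theorem contMDiff_entry {ι : Type*} {E : Type*} [NormedAddCommGroup E] [NormedSpace ℝ E]
    {B : Type*} [TopologicalSpace B] [ChartedSpace E B] [IsManifold 𝓘(ℝ, E) ∞ B]
    {θ : ∀ u : B, TangentSpace 𝓘(ℝ, E) u →ₗ[ℝ] Matrix ι ι ℝ}
    (hθ : ∀ i j, ContMDiff (𝓘(ℝ, E).tangent) 𝓘(ℝ, ℝ) ∞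
      (fun p : TangentBundle 𝓘(ℝ, E) B => θ p.1 p.2 i j)) (i j : ι) :
    ContMDiff (𝓘(ℝ, E).tangent) 𝓘(ℝ, ℝ) ∞ (fun p : TangentBundle 𝓘(ℝ, E) B =>
      ((Matrix.entryLinearMap ℝ ℝ i j) ∘ₗ (θ p.1)) p.2) := hθ i j

section Connection

variable {ι : Type*}
  {E : Type*} [NormedAddCommGroup E] [NormedSpace ℝ E]
  {B : Type*} [TopologicalSpace B] [ChartedSpace E B]
  {V : Type*} [NormedAddCommGroup V] [NormedSpace ℝ V]

/-- The component along the constant field `w` of the pullback `Φ^* θ`. -/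
def pullForm (θ : ∀ u : B, TangentSpace 𝓘(ℝ, E) u →ₗ[ℝ] Matrix ι ι ℝ) (Φ : V → B) (w q : V) :
    Matrix ι ι ℝ :=
  θ (Φ q) (mfderiv 𝓘(ℝ, V) 𝓘(ℝ, E) Φ q w)

theorem curvature_swap [Fintype ι] [DecidableEq ι]
    (θ : ∀ u : B, TangentSpace 𝓘(ℝ, E) u →ₗ[ℝ] Matrix ι ι ℝ) (u : B)
    (v w : TangentSpace 𝓘(ℝ, E) u) : curvature θ u w v = - curvature θ u v w := by
  unfold curvature
  rw [← lie_skew, neg_add, ← sub_eq_add_neg, ← sub_eq_add_neg]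
  congr 1
  ext i j
  simp [extDerivForm]

variable [IsManifold 𝓘(ℝ, E) ∞ B]

theorem contDiff_pullForm {θ : ∀ u : B, TangentSpace 𝓘(ℝ, E) u →ₗ[ℝ] Matrix ι ι ℝ}
    (hθ : ∀ i j, ContMDiff (𝓘(ℝ, E).tangent) 𝓘(ℝ, ℝ) ∞
      (fun p : TangentBundle 𝓘(ℝ, E) B => θ p.1 p.2 i j))
    {Φ : V → B} (hΦ : ContMDiff 𝓘(ℝ, V) 𝓘(ℝ, E) ∞ Φ) (w : V) (i j : ι) :
    ContDiff ℝ ∞ (fun q => pullForm θ Φ w q i j) :=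
  contMDiff_apply_mfderiv (α := fun u => (Matrix.entryLinearMap ℝ ℝ i j) ∘ₗ (θ u))
    (contMDiff_entry hθ i j) hΦ w

theorem differentiableAt_pullForm {θ : ∀ u : B, TangentSpace 𝓘(ℝ, E) u →ₗ[ℝ] Matrix ι ι ℝ}
    (hθ : ∀ i j, ContMDiff (𝓘(ℝ, E).tangent) 𝓘(ℝ, ℝ) ∞
      (fun p : TangentBundle 𝓘(ℝ, E) B => θ p.1 p.2 i j))
    {Φ : V → B} (hΦ : ContMDiff 𝓘(ℝ, V) 𝓘(ℝ, E) ∞ Φ) (w p : V) (i j : ι) :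
    DifferentiableAt ℝ (fun q => pullForm θ Φ w q i j) p :=
  (contDiff_pullForm hθ hΦ w i j).differentiable (by simp) p

variable [Fintype ι] [DecidableEq ι]

theorem curvature_add_smul_left {θ : ∀ u : B, TangentSpace 𝓘(ℝ, E) u →ₗ[ℝ] Matrix ι ι ℝ}
    (hθ : ∀ i j, ContMDiff (𝓘(ℝ, E).tangent) 𝓘(ℝ, ℝ) ∞
      (fun p : TangentBundle 𝓘(ℝ, E) B => θ p.1 p.2 i j)) (u : B) (r : ℝ)
    (v v' w : TangentSpace 𝓘(ℝ, E) u) :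
    curvature θ u (v + r • v') w = curvature θ u v w + r • curvature θ u v' w := by
  ext i j
  have hd : ∀ a : E, DifferentiableAt ℝ (chartComponent
      (fun u' => (Matrix.entryLinearMap ℝ ℝ i j) ∘ₗ (θ u')) u a) (extChartAt 𝓘(ℝ, E) u u) :=
    fun a => ((contDiffOn_chartComponent (contMDiff_entry hθ i j) u a).contDiffAt
      ((isOpen_extChartAt_target u).mem_nhds
        ((extChartAt 𝓘(ℝ, E) u).map_source (mem_extChartAt_source u)))).differentiableAt (by simp)
  have hc : ∀ a b : E, chartComponent (fun u' => (Matrix.entryLinearMap ℝ ℝ i j) ∘ₗ (θ u')) u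
      (a + r • b) = chartComponent (fun u' => (Matrix.entryLinearMap ℝ ℝ i j) ∘ₗ (θ u')) u a +
      r • chartComponent (fun u' => (Matrix.entryLinearMap ℝ ℝ i j) ∘ₗ (θ u')) u b := by
    intro a b
    funext y
    simp only [chartComponent, Pi.add_apply, Pi.smul_apply]
    rw [← map_smul, ← map_add]
    congr 1
    exact ((mfderiv 𝓘(ℝ, E) 𝓘(ℝ, E) (extChartAt 𝓘(ℝ, E) u).symm y).map_add a (r • b)).trans
      (congrArg _ ((mfderiv 𝓘(ℝ, E) 𝓘(ℝ, E) (extChartAt 𝓘(ℝ, E) u).symm y).map_smul r b))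
  have hext : extDerivForm (fun u' => (Matrix.entryLinearMap ℝ ℝ i j) ∘ₗ (θ u')) u (v + r • v') w =
      extDerivForm (fun u' => (Matrix.entryLinearMap ℝ ℝ i j) ∘ₗ (θ u')) u v w +
      r * extDerivForm (fun u' => (Matrix.entryLinearMap ℝ ℝ i j) ∘ₗ (θ u')) u v' w := by
    let D : E → E → ℝ := fun a b =>
      fderiv ℝ (chartComponent (fun u' => (Matrix.entryLinearMap ℝ ℝ i j) ∘ₗ (θ u')) u b)
        (extChartAt 𝓘(ℝ, E) u u) a -
      fderiv ℝ (chartComponent (fun u' => (Matrix.entryLinearMap ℝ ℝ i j) ∘ₗ (θ u')) u a)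
        (extChartAt 𝓘(ℝ, E) u u) b
    have hD : ∀ a b c : E, D (a + r • b) c = D a c + r * D b c := by
      intro a b c
      simp only [D]
      rw [hc, fderiv_add (hd a) ((hd b).const_smul r), fderiv_const_smul (hd b)]
      simp
      ring
    exact (congrArg (fun z : E => D z (mfderiv 𝓘(ℝ, E) 𝓘(ℝ, E) (extChartAt 𝓘(ℝ, E) u) u w))
      (((mfderiv 𝓘(ℝ, E) 𝓘(ℝ, E) (extChartAt 𝓘(ℝ, E) u) u).map_add v (r • v')).trans
      (congrArg _ ((mfderiv 𝓘(ℝ, E) 𝓘(ℝ, E) (extChartAt 𝓘(ℝ, E) u) u).map_smul r v')))).trans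
      (hD _ _ _)
  simp only [curvature, Matrix.add_apply, Matrix.of_apply, hext, map_add, map_smul, add_lie,
    smul_lie, Matrix.smul_apply, smul_eq_mul]
  ring

variable [FiniteDimensional ℝ E]

theorem curvature_pullback {θ : ∀ u : B, TangentSpace 𝓘(ℝ, E) u →ₗ[ℝ] Matrix ι ι ℝ}
    (hθ : ∀ i j, ContMDiff (𝓘(ℝ, E).tangent) 𝓘(ℝ, ℝ) ∞
      (fun p : TangentBundle 𝓘(ℝ, E) B => θ p.1 p.2 i j))
    {Φ : V → B} (hΦ : ContMDiff 𝓘(ℝ, V) 𝓘(ℝ, E) ∞ Φ) (p v w : V) :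
    curvature θ (Φ p) (mfderiv 𝓘(ℝ, V) 𝓘(ℝ, E) Φ p v) (mfderiv 𝓘(ℝ, V) 𝓘(ℝ, E) Φ p w) =
      formCurvature (pullForm θ Φ) v w p := by
  unfold curvature formCurvature
  congr 1
  ext i j
  exact extDerivForm_pullback (contMDiff_entry hθ i j) hΦ p v w

/-- If two pulled-back connection forms are intertwined by a homomorphism of matrix Lie algebras,
so are the curvatures. -/
theorem curvature_eq_of_pullForm_eq {κ : Type*} [Fintype κ] [DecidableEq κ]
    {E' : Type*} [NormedAddCommGroup E'] [NormedSpace ℝ E'] [FiniteDimensional ℝ E']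
    {B' : Type*} [TopologicalSpace B'] [ChartedSpace E' B'] [IsManifold 𝓘(ℝ, E') ∞ B']
    {θ : ∀ u : B, TangentSpace 𝓘(ℝ, E) u →ₗ[ℝ] Matrix ι ι ℝ}
    (hθ : ∀ i j, ContMDiff (𝓘(ℝ, E).tangent) 𝓘(ℝ, ℝ) ∞
      (fun p : TangentBundle 𝓘(ℝ, E) B => θ p.1 p.2 i j))
    {θ' : ∀ u : B', TangentSpace 𝓘(ℝ, E') u →ₗ[ℝ] Matrix κ κ ℝ}
    (hθ' : ∀ i j, ContMDiff (𝓘(ℝ, E').tangent) 𝓘(ℝ, ℝ) ∞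
      (fun p : TangentBundle 𝓘(ℝ, E') B' => θ' p.1 p.2 i j))
    {Φ : V → B} (hΦ : ContMDiff 𝓘(ℝ, V) 𝓘(ℝ, E) ∞ Φ)
    {Ψ : V → B'} (hΨ : ContMDiff 𝓘(ℝ, V) 𝓘(ℝ, E') ∞ Ψ)
    (T : Matrix ι ι ℝ →ₗ[ℝ] Matrix κ κ ℝ)
    (hT : ∀ A A', T (A * A' - A' * A) = T A * T A' - T A' * T A)
    (h : ∀ w q, pullForm θ' Ψ w q = T (pullForm θ Φ w q)) (p v w : V) :
    curvature θ' (Ψ p) (mfderiv 𝓘(ℝ, V) 𝓘(ℝ, E') Ψ p v) (mfderiv 𝓘(ℝ, V) 𝓘(ℝ, E') Ψ p w) =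
      T (curvature θ (Φ p) (mfderiv 𝓘(ℝ, V) 𝓘(ℝ, E) Φ p v) (mfderiv 𝓘(ℝ, V) 𝓘(ℝ, E) Φ p w)) := by
  rw [curvature_pullback hθ hΦ, curvature_pullback hθ' hΨ]
  have h' : ∀ w, pullForm θ' Ψ w = fun q => T (pullForm θ Φ w q) := fun w => funext (h w)
  unfold formCurvature
  rw [h', h', matDeriv_linearMap T (differentiableAt_pullForm hθ hΦ w p),
    matDeriv_linearMap T (differentiableAt_pullForm hθ hΦ v p), map_add, map_sub, hT]

end Connection

/-! ### Equivariance and horizontality of the curvature of a Cartan connection -/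

section Bundle

theorem mfderiv_comp_curve {E : Type*} [NormedAddCommGroup E] [NormedSpace ℝ E]
    {B : Type*} [TopologicalSpace B] [ChartedSpace E B]
    {V : Type*} [NormedAddCommGroup V] [NormedSpace ℝ V] {Ψ : V → B} {c : ℝ → V} {p v : V}
    {t : ℝ} (hΨ : MDifferentiableAt 𝓘(ℝ, V) 𝓘(ℝ, E) Ψ p) (hc : HasDerivAt c v t) (hp : c t = p) :
    (mfderiv 𝓘(ℝ, ℝ) 𝓘(ℝ, E) (fun t => Ψ (c t)) t (1 : ℝ) : E) =
      mfderiv 𝓘(ℝ, V) 𝓘(ℝ, E) Ψ p v := by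
  subst hp
  have h1 := mfderiv_comp t hΨ hc.differentiableAt.mdifferentiableAt
  have h2 := congrArg (fun L => (L (1 : ℝ) : E)) h1
  refine h2.trans ?_
  rw [mfderiv_eq_fderiv]
  have h3 : fderiv ℝ c t 1 = v := by rw [fderiv_apply_one_eq_deriv, hc.deriv]
  exact congrArg (mfderiv 𝓘(ℝ, V) 𝓘(ℝ, E) Ψ (c t)) h3

variable {ι : Type*} [Fintype ι] [DecidableEq ι]
  {E : Type*} [NormedAddCommGroup E] [NormedSpace ℝ E]
  {B : Type*} [TopologicalSpace B] [ChartedSpace E B] [IsManifold 𝓘(ℝ, E) ∞ B]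
  {F : Type*} [NormedAddCommGroup F] [NormedSpace ℝ F]
  {X : Type*} [TopologicalSpace X] [ChartedSpace F X]
  {H W : Type*} [Group H] [AddCommGroup W] [Module ℝ W] {emb : H → W}
  {rep : H →* Matrix ι ι ℝ} {𝔤 : LieSubalgebra ℝ (Matrix ι ι ℝ)} {act : B → H → B} {π : B → X}
  {θ : ∀ u : B, TangentSpace 𝓘(ℝ, E) u →ₗ[ℝ] Matrix ι ι ℝ}

theorem rep_mul_inv (rep : H →* Matrix ι ι ℝ) (h : H) : rep h * rep h⁻¹ = 1 := by
  rw [← map_mul, mul_inv_cancel, map_one]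

theorem rep_inv_mul (rep : H →* Matrix ι ι ℝ) (h : H) : rep h⁻¹ * rep h = 1 := by
  rw [← map_mul, inv_mul_cancel, map_one]

/-- Right translations are differentiable: otherwise `mfderiv` would take its default value `0`,
which equivariance and injectivity of the connection exclude. -/
theorem IsCartanConnection.mdifferentiableAt_act (hθ : IsCartanConnection emb rep 𝔤 act θ)
    (h : H) {u : B} {v : TangentSpace 𝓘(ℝ, E) u} (hv : v ≠ 0) :
    MDifferentiableAt 𝓘(ℝ, E) 𝓘(ℝ, E) (fun u' => act u' h) u := by
  by_contra hn
  have h1 := hθ.equivariant h u v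
  rw [mfderiv_zero_of_not_mdifferentiableAt hn] at h1
  have h2 : rep h * (rep h⁻¹ * θ u v * rep h) * rep h⁻¹ = 0 := by
    rw [← h1]
    change rep h * θ (act u h) 0 * rep h⁻¹ = 0
    simp
  have h3 : θ u v = 0 := by
    rw [← h2]
    simp only [mul_assoc, rep_mul_inv, mul_one]
    rw [← mul_assoc, rep_mul_inv, one_mul]
  exact hv (hθ.injective u (by rw [h3, map_zero]))

theorem IsCartanConnection.mfderiv_act_injective (hθ : IsCartanConnection emb rep 𝔤 act θ)
    (h : H) (u : B) :
    Function.Injective (mfderiv 𝓘(ℝ, E) 𝓘(ℝ, E) (fun u' => act u' h) u) := by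
  rw [injective_iff_map_eq_zero]
  intro v hv
  by_contra hv0
  have h1 := hθ.equivariant h u v
  rw [hv] at h1
  have h2 : rep h * (rep h⁻¹ * θ u v * rep h) * rep h⁻¹ = 0 := by
    rw [← h1]
    simp
  have h3 : θ u v = 0 := by
    rw [← h2]
    simp only [mul_assoc, rep_mul_inv, mul_one]
    rw [← mul_assoc, rep_mul_inv, one_mul]
  exact hv0 (hθ.injective u (by rw [h3, map_zero]))

theorem curvature_zero_left (hθ : ∀ i j, ContMDiff (𝓘(ℝ, E).tangent) 𝓘(ℝ, ℝ) ∞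
      (fun p : TangentBundle 𝓘(ℝ, E) B => θ p.1 p.2 i j)) (u : B) (w : TangentSpace 𝓘(ℝ, E) u) :
    curvature θ u 0 w = 0 := by
  have := curvature_add_smul_left hθ u 1 0 0 w
  simpa using this

theorem curvature_zero_right (hθ : ∀ i j, ContMDiff (𝓘(ℝ, E).tangent) 𝓘(ℝ, ℝ) ∞
      (fun p : TangentBundle 𝓘(ℝ, E) B => θ p.1 p.2 i j)) (u : B) (v : TangentSpace 𝓘(ℝ, E) u) :
    curvature θ u v 0 = 0 := by
  rw [curvature_swap, curvature_zero_left hθ, neg_zero]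

/-- Conjugation `A ↦ rep h⁻¹ * A * rep h`, as a linear map. -/
def conjLin (rep : H →* Matrix ι ι ℝ) (h : H) : Matrix ι ι ℝ →ₗ[ℝ] Matrix ι ι ℝ :=
  LinearMap.mulRight ℝ (rep h) ∘ₗ LinearMap.mulLeft ℝ (rep h⁻¹)

theorem conjLin_apply (rep : H →* Matrix ι ι ℝ) (h : H) (A : Matrix ι ι ℝ) :
    conjLin rep h A = rep h⁻¹ * A * rep h := rfl

theorem conjLin_bracket (rep : H →* Matrix ι ι ℝ) (h : H) (A A' : Matrix ι ι ℝ) :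
    conjLin rep h (A * A' - A' * A) =
      conjLin rep h A * conjLin rep h A' - conjLin rep h A' * conjLin rep h A := by
  simp only [conjLin_apply]
  have : ∀ A A' : Matrix ι ι ℝ, rep h⁻¹ * A * rep h * (rep h⁻¹ * A' * rep h) =
      rep h⁻¹ * (A * A') * rep h := by
    intro A A'
    calc _ = rep h⁻¹ * A * (rep h * rep h⁻¹) * A' * rep h := by simp only [mul_assoc]
      _ = _ := by rw [rep_mul_inv]; simp only [mul_assoc, one_mul]
  rw [this, this, mul_sub, sub_mul]

theorem smoothIntoOn_const {H : Type*} {emb : H → W} (h : H) (k : ℕ) :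
    SmoothIntoOn (E := EuclideanSpace ℝ (Fin k)) emb
      (fun _ : EuclideanSpace ℝ (Fin k) => h) Set.univ :=
  fun _ => contMDiffOn_const

variable [FiniteDimensional ℝ E]

/-- Equivariance of the curvature, `(R_h)^* K = Ad(h⁻¹) ∘ K`. -/
theorem IsCartanConnection.curvature_act
    (hB : IsPrincipalBundle (E := E) (F := F) emb act π)
    (hθ : IsCartanConnection emb rep 𝔤 act θ) (h : H) (u : B) (v w : TangentSpace 𝓘(ℝ, E) u) :
    curvature θ (act u h) (mfderiv 𝓘(ℝ, E) 𝓘(ℝ, E) (fun u' => act u' h) u v)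
      (mfderiv 𝓘(ℝ, E) 𝓘(ℝ, E) (fun u' => act u' h) u w) =
      rep h⁻¹ * curvature θ u v w * rep h := by
  -- a nonzero vector is what shows that the right translation is differentiable
  by_cases hv : v = 0
  · subst hv
    simp only [map_zero, curvature_zero_left hθ.smooth, mul_zero, zero_mul]
  obtain ⟨Φ, hΦ, hΦ0, hΦd⟩ := exists_contMDiff_mfderiv_eq u ![v, w]
  subst hΦ0
  have hΨ := hB.smooth_act 2 Φ (fun _ => h) hΦ (smoothIntoOn_const h 2)
  have hR : ∀ q, MDifferentiableAt 𝓘(ℝ, E) 𝓘(ℝ, E) (fun u' => act u' h) (Φ q) :=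
    fun q => hθ.mdifferentiableAt_act (v := (v : E)) h hv
  have hd : ∀ q a, (mfderiv 𝓘(ℝ, EuclideanSpace ℝ (Fin 2)) 𝓘(ℝ, E) (fun q => act (Φ q) h) q a : E) =
      mfderiv 𝓘(ℝ, E) 𝓘(ℝ, E) (fun u' => act u' h) (Φ q)
        (mfderiv 𝓘(ℝ, EuclideanSpace ℝ (Fin 2)) 𝓘(ℝ, E) Φ q a) := by
    intro q a
    have := mfderiv_comp q (hR q) ((hΦ q).mdifferentiableAt (by simp))
    exact congrArg (fun L => (L a : E)) this
  have key := curvature_eq_of_pullForm_eq hθ.smooth hθ.smooth hΦ hΨ (conjLin rep h)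
    (conjLin_bracket rep h) (fun a q => by
      have := hθ.equivariant h (Φ q) (mfderiv 𝓘(ℝ, EuclideanSpace ℝ (Fin 2)) 𝓘(ℝ, E) Φ q a)
      exact (congrArg (θ (act (Φ q) h)) (hd q a)).trans this)
    0 (EuclideanSpace.single 0 1) (EuclideanSpace.single 1 1)
  have e0 : mfderiv 𝓘(ℝ, EuclideanSpace ℝ (Fin 2)) 𝓘(ℝ, E) Φ 0 (EuclideanSpace.single 0 1) = v :=
    hΦd 0
  have e1 : mfderiv 𝓘(ℝ, EuclideanSpace ℝ (Fin 2)) 𝓘(ℝ, E) Φ 0 (EuclideanSpace.single 1 1) = w :=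
    hΦd 1
  have f0 := hd 0 (EuclideanSpace.single 0 1)
  have f1 := hd 0 (EuclideanSpace.single 1 1)
  rw [e0] at f0
  rw [e1] at f1
  rw [e0, e1] at key
  exact (congrArg₂ (fun a b : E => curvature θ (act (Φ 0) h) a b) f0.symm f1.symm).trans key

/-- The curvature is horizontal: it vanishes on the generators of the principal action.  On the
surface `(t, s) ↦ γ(s) · c(t)`, with `γ'(0) = η`, the pulled-back connection is known along both
axes, from the reproduction of generators and from equivariance, and this determines its curvature
at the origin. -/
theorem IsCartanConnection.curvature_eq_zero_of_velocity
    (hB : IsPrincipalBundle (E := E) (F := F) emb act π)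
    (hθ : IsCartanConnection emb rep 𝔤 act θ) {c : ℝ → H}
    (hc : SmoothIntoOn (E := ℝ) emb c Set.univ) (hc0 : c 0 = 1) {A : Matrix ι ι ℝ}
    (hA : ∀ i j, HasDerivAt (fun t => rep (c t) i j) (A i j) 0) (u : B)
    {ζ : TangentSpace 𝓘(ℝ, E) u} (hζ : θ u ζ = A) (η : TangentSpace 𝓘(ℝ, E) u) :
    curvature θ u ζ η = 0 := by
  by_cases hη : η = 0
  · rw [hη, curvature_zero_right hθ.smooth]
  obtain ⟨γ, hγ, hγ0, hγd⟩ := exists_contMDiff_mfderiv_eq u ![η]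
  subst hγ0
  have hγd' : (mfderiv 𝓘(ℝ, EuclideanSpace ℝ (Fin 1)) 𝓘(ℝ, E) γ 0 (EuclideanSpace.single 0 1) : E)
    = η := hγd 0
  -- the surface `(t, s) ↦ γ(s) · c(t)`
  let P0 : EuclideanSpace ℝ (Fin 2) →L[ℝ] ℝ := EuclideanSpace.proj 0
  let P1 : EuclideanSpace ℝ (Fin 2) →L[ℝ] EuclideanSpace ℝ (Fin 1) :=
    (EuclideanSpace.proj 1 : EuclideanSpace ℝ (Fin 2) →L[ℝ] ℝ).smulRight
      (EuclideanSpace.single 0 1)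
  let e0 : EuclideanSpace ℝ (Fin 2) := EuclideanSpace.single 0 1
  let e1 : EuclideanSpace ℝ (Fin 2) := EuclideanSpace.single 1 1
  let Ψ : EuclideanSpace ℝ (Fin 2) → B := fun q => act (γ (P1 q)) (c (P0 q))
  have hΨ : ContMDiff 𝓘(ℝ, EuclideanSpace ℝ (Fin 2)) 𝓘(ℝ, E) ∞ Ψ := by
    refine hB.smooth_act 2 (fun q => γ (P1 q)) (fun q => c (P0 q))
      (hγ.comp P1.contDiff.contMDiff) fun ℓ => ?_
    exact ((contMDiffOn_univ.1 (hc ℓ)).comp P0.contDiff.contMDiff).contMDiffOn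
  have hΨd : ∀ q, MDifferentiableAt 𝓘(ℝ, EuclideanSpace ℝ (Fin 2)) 𝓘(ℝ, E) Ψ q :=
    fun q => (hΨ q).mdifferentiableAt (by simp)
  have hP00 : P0 e0 = 1 := by simp [P0, e0]
  have hP01 : P0 e1 = 0 := by simp [P0, e1]
  have hP10 : P1 e0 = 0 := by simp [P1, e0]
  have hP11 : P1 e1 = EuclideanSpace.single 0 1 := by simp [P1, e1]
  have hline : ∀ (p v : EuclideanSpace ℝ (Fin 2)), HasDerivAt (fun t : ℝ => p + t • v) v 0 := by
    intro p v
    simpa using ((hasDerivAt_id (0 : ℝ)).smul_const v).const_add p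
  -- the `t`-component of the pulled-back connection is constant along `t = 0`
  have hvel : ∀ s : ℝ, (mfderiv 𝓘(ℝ, EuclideanSpace ℝ (Fin 2)) 𝓘(ℝ, E) Ψ (s • e1) e0 : E) =
      mfderiv 𝓘(ℝ, ℝ) 𝓘(ℝ, E) (fun t : ℝ => act (γ (P1 (s • e1))) (c t)) 0 (1 : ℝ) := by
    intro s
    have hfun : (fun t : ℝ => Ψ (s • e1 + t • e0)) =
        fun t : ℝ => act (γ (P1 (s • e1))) (c t) := by
      funext t
      simp only [Ψ, map_add, map_smul, hP00, hP01, hP10, smul_zero, zero_add, add_zero,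
        smul_eq_mul, mul_one, mul_zero]
    rw [← mfderiv_comp_curve (hΨd _) (hline (s • e1) e0) (by simp)]
    exact congrArg (fun f : ℝ → B => (mfderiv 𝓘(ℝ, ℝ) 𝓘(ℝ, E) f 0 (1 : ℝ) : E)) hfun
  have hΨs : ∀ s : ℝ, Ψ (s • e1) = act (γ (P1 (s • e1))) (c 0) := by
    intro s
    simp only [Ψ, map_smul, hP01, smul_zero]
  have hcongr : ∀ (a b : B) (v w : E), a = b → v = w → θ a v = θ b w := by
    rintro a b v w rfl rfl; rfl
  have hω0 : ∀ s : ℝ, pullForm θ Ψ e0 (s • e1) = A := by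
    intro s
    ext i j
    have := hθ.fundamental (γ (P1 (s • e1))) c hc hc0 i j
    rw [(hA i j).deriv] at this
    rw [← this]
    exact congrFun (congrFun (hcongr _ _ _ _ (hΨs s) (hvel s)) i) j
  have hD0 : matDeriv (pullForm θ Ψ e0) 0 e1 = 0 := by
    ext i j
    rw [matDeriv_apply]
    have h1 : HasFDerivAt (fun q => pullForm θ Ψ e0 q i j) _ (0 + (0 : ℝ) • e1) :=
      (differentiableAt_pullForm hθ.smooth hΨ e0 _ i j).hasFDerivAt
    have h2 := h1.comp_hasDerivAt (0 : ℝ) (hline 0 e1)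
    have h3 : ((fun q => pullForm θ Ψ e0 q i j) ∘ fun t : ℝ => 0 + t • e1) = fun _ => A i j := by
      funext t
      simp [hω0]
    rw [h3] at h2
    have h4 := h2.unique (hasDerivAt_const _ _)
    simpa using h4
  -- the `s`-component of the pulled-back connection along `s = 0` is given by equivariance
  have hη0 : (η : E) ≠ 0 := hη
  have hR : ∀ t, MDifferentiableAt 𝓘(ℝ, E) 𝓘(ℝ, E) (fun u' => act u' (c t)) (γ 0) :=
    fun t => hθ.mdifferentiableAt_act (v := η) (c t) hη
  have hvel1 : ∀ t : ℝ, (mfderiv 𝓘(ℝ, EuclideanSpace ℝ (Fin 2)) 𝓘(ℝ, E) Ψ (t • e0) e1 : E) =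
      mfderiv 𝓘(ℝ, E) 𝓘(ℝ, E) (fun u' => act u' (c t)) (γ 0) η := by
    intro t
    have hfun : (fun s : ℝ => Ψ (t • e0 + s • e1)) =
        fun s : ℝ => act (γ (s • EuclideanSpace.single 0 1)) (c t) := by
      funext s
      simp only [Ψ, map_add, map_smul, hP00, hP01, hP10, hP11, smul_zero, zero_add, add_zero,
        smul_eq_mul, mul_one, mul_zero]
    rw [← mfderiv_comp_curve (hΨd _) (hline (t • e0) e1) (by simp)]
    refine (congrArg (fun f : ℝ → B => (mfderiv 𝓘(ℝ, ℝ) 𝓘(ℝ, E) f 0 (1 : ℝ) : E)) hfun).trans ?_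
    have h1 : MDifferentiableAt 𝓘(ℝ, EuclideanSpace ℝ (Fin 1)) 𝓘(ℝ, E)
        (fun p => act (γ p) (c t)) 0 :=
      MDifferentiableAt.comp 0 (hR t) ((hγ 0).mdifferentiableAt (by simp))
    have h0 : HasDerivAt (fun s : ℝ => s • (EuclideanSpace.single 0 1 : EuclideanSpace ℝ (Fin 1)))
        (EuclideanSpace.single 0 1) 0 := by
      simpa using (hasDerivAt_id (0 : ℝ)).smul_const
        (EuclideanSpace.single 0 1 : EuclideanSpace ℝ (Fin 1))
    refine (mfderiv_comp_curve h1 h0 (by simp)).trans ?_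
    have h2 := mfderiv_comp (0 : EuclideanSpace ℝ (Fin 1)) (hR t)
      ((hγ 0).mdifferentiableAt (by simp))
    exact (congrArg (fun L => (L (EuclideanSpace.single 0 1) : E)) h2).trans
      (congrArg (fun v : E => (mfderiv 𝓘(ℝ, E) 𝓘(ℝ, E) (fun u' => act u' (c t)) (γ 0) v : E)) hγd')
  have hΨt : ∀ t : ℝ, Ψ (t • e0) = act (γ 0) (c t) := by
    intro t
    simp only [Ψ, map_smul, hP00, hP10, smul_zero, smul_eq_mul, mul_one]
  have hω1 : ∀ t : ℝ, rep (c t) * pullForm θ Ψ e1 (t • e0) = θ (γ 0) η * rep (c t) := by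
    intro t
    have h1 : pullForm θ Ψ e1 (t • e0) = rep (c t)⁻¹ * θ (γ 0) η * rep (c t) :=
      (hcongr _ _ _ _ (hΨt t) (hvel1 t)).trans (hθ.equivariant (c t) (γ 0) η)
    rw [h1, ← mul_assoc, ← mul_assoc, rep_mul_inv, one_mul]
  have hω10 : pullForm θ Ψ e1 0 = θ (γ 0) η := by
    have := hω1 0
    simpa [hc0] using this
  have hω00 : pullForm θ Ψ e0 0 = A := by simpa using hω0 0
  have hD1 : matDeriv (pullForm θ Ψ e1) 0 e0 = θ (γ 0) η * A - A * θ (γ 0) η := by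
    rw [eq_sub_iff_add_eq']
    ext i j
    have h1 : ∀ i j, HasDerivAt (fun t : ℝ => pullForm θ Ψ e1 (t • e0) i j)
        (matDeriv (pullForm θ Ψ e1) 0 e0 i j) 0 := by
      intro i j
      have h1 : HasFDerivAt (fun q => pullForm θ Ψ e1 q i j) _ (0 + (0 : ℝ) • e0) :=
        (differentiableAt_pullForm hθ.smooth hΨ e1 _ i j).hasFDerivAt
      have h2 := h1.comp_hasDerivAt (0 : ℝ) (hline 0 e0)
      simpa [Function.comp_def, matDeriv_apply] using h2
    have h2 : HasDerivAt (fun t => (rep (c t) * pullForm θ Ψ e1 (t • e0)) i j)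
        (∑ k, (A i k * pullForm θ Ψ e1 ((0 : ℝ) • e0) k j +
          rep (c 0) i k * matDeriv (pullForm θ Ψ e1) 0 e0 k j)) 0 := by
      simp only [Matrix.mul_apply]
      exact HasDerivAt.fun_sum fun k _ => (hA i k).mul (h1 k j)
    have h3 : HasDerivAt (fun t => (θ (γ 0) η * rep (c t)) i j)
        (∑ k, θ (γ 0) η i k * A k j) 0 := by
      simp only [Matrix.mul_apply]
      exact HasDerivAt.fun_sum fun k _ => (hA k j).const_mul _
    simp only [hω1] at h2
    have h4 := h2.unique h3
    rw [Matrix.add_apply, Matrix.mul_apply, Matrix.mul_apply, ← h4, Finset.sum_add_distrib,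
      zero_smul, hω10, hc0, map_one, ← Matrix.mul_apply, ← Matrix.mul_apply (M := 1), one_mul]
  have key := curvature_pullback hθ.smooth hΨ 0 e0 e1
  have hz : formCurvature (pullForm θ Ψ) e0 e1 0 = 0 := by
    unfold formCurvature
    rw [hD0, hD1, hω10, hω00]
    noncomm_ring
  rw [hz] at key
  have h0 : Ψ 0 = γ 0 := by simpa [hc0, hB.act_one] using hΨt 0
  have g1 : (mfderiv 𝓘(ℝ, EuclideanSpace ℝ (Fin 2)) 𝓘(ℝ, E) Ψ 0 e1 : E) = η := by
    have := hvel1 0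
    rw [zero_smul] at this
    rw [this]
    have h2 : (fun u' => act u' (c 0)) = id := by funext x; simp [hc0, hB.act_one]
    rw [h2]
    exact congrArg (fun L => (L η : E)) (mfderiv_id (I := 𝓘(ℝ, E)) (x := γ 0))
  have g0 : (mfderiv 𝓘(ℝ, EuclideanSpace ℝ (Fin 2)) 𝓘(ℝ, E) Ψ 0 e0 : E) = ζ := by
    refine hθ.injective (γ 0) ?_
    rw [hζ, ← hω00]
    exact (hcongr _ _ _ _ h0 rfl).symm
  have hcongr2 : ∀ (a b : B) (v w v' w' : E), a = b → v = v' → w = w' →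
      curvature θ a v w = curvature θ b v' w' := by
    rintro a b v w v' w' rfl rfl rfl; rfl
  exact (hcongr2 _ _ _ _ _ _ h0 g0 g1).symm.trans key

/-- The curvature takes values in trace-free matrices if the connection does. -/
theorem trace_curvature (hθ : ∀ i j, ContMDiff (𝓘(ℝ, E).tangent) 𝓘(ℝ, ℝ) ∞
      (fun p : TangentBundle 𝓘(ℝ, E) B => θ p.1 p.2 i j))
    (htr : ∀ u v, (θ u v).trace = 0) (u : B) (v w : TangentSpace 𝓘(ℝ, E) u) :
    (curvature θ u v w).trace = 0 := by
  obtain ⟨Φ, hΦ, hΦ0, hΦd⟩ := exists_contMDiff_mfderiv_eq u ![v, w]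
  subst hΦ0
  have e0 : mfderiv 𝓘(ℝ, EuclideanSpace ℝ (Fin 2)) 𝓘(ℝ, E) Φ 0 (EuclideanSpace.single 0 1) = v :=
    hΦd 0
  have e1 : mfderiv 𝓘(ℝ, EuclideanSpace ℝ (Fin 2)) 𝓘(ℝ, E) Φ 0 (EuclideanSpace.single 1 1) = w :=
    hΦd 1
  rw [← e0, ← e1, curvature_pullback hθ hΦ]
  have hD : ∀ a b, (matDeriv (pullForm θ Φ a) 0 b).trace = 0 := by
    intro a b
    simp only [Matrix.trace, Matrix.diag, matDeriv_apply]
    have h1 := HasFDerivAt.fun_sum (u := Finset.univ)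
      (fun i (_ : i ∈ Finset.univ) => (differentiableAt_pullForm hθ hΦ a 0 i i).hasFDerivAt)
    have h2 : (fun q => ∑ i, pullForm θ Φ a q i i) = fun _ => 0 :=
      funext fun q => htr (Φ q) _
    rw [h2] at h1
    have h3 := congrArg (fun L => L b) (h1.unique (hasFDerivAt_const _ _))
    simpa using h3
  unfold formCurvature
  rw [Matrix.trace_add, Matrix.trace_sub, Matrix.trace_sub, hD, hD, Matrix.trace_mul_comm]
  simp

end Bundle

/-! ### Curves in the projective parabolic `P` -/

section ProjectiveCurves

theorem eval_det_one_add_X_smul {ι : Type*} [Fintype ι] [DecidableEq ι] (A : Matrix ι ι ℝ) (s : ℝ) :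
    Polynomial.eval s (1 + (Polynomial.X : Polynomial ℝ) • A.map Polynomial.C).det =
      (1 + s • A).det := by
  rw [← Polynomial.coe_evalRingHom, RingHom.map_det]
  congr 1
  ext i j
  simp [Matrix.one_apply, apply_ite]
  exact mul_comm _ _

/-- Every element of `𝔭` is, up to scale, the velocity of a curve in `P`: the line `1 + s A`,
normalised to determinant `1` and reparametrised by a bounded function of time. -/
theorem exists_curve_projP {n : ℕ} {A : Matrix (Fin (n + 1)) (Fin (n + 1)) ℝ} (htr : A.trace = 0)
    {a : ℝ} (ha : A *ᵥ vPlus n = a • vPlus n) :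
    ∃ ε : ℝ, ε ≠ 0 ∧ ∃ c : ℝ → projP n, SmoothIntoOn (E := ℝ) (projRep n) c Set.univ ∧ c 0 = 1 ∧
      ∀ i j, HasDerivAt (fun t => projRep n (c t) i j) ((ε • A) i j) 0 := by
  set p : Polynomial ℝ := (1 + (Polynomial.X : Polynomial ℝ) • A.map Polynomial.C).det with hp
  have hpe : ∀ s, p.eval s = (1 + s • A).det := eval_det_one_add_X_smul A
  have hev : ∀ᶠ s in nhds (0 : ℝ), 0 < p.eval s ∧ 0 < 1 + s * a := by
    refine Filter.Eventually.and ?_ ?_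
    · refine p.continuous.continuousAt.eventually (lt_mem_nhds ?_)
      simp [hpe]
    · have h1 : Continuous fun s : ℝ => 1 + s * a := by fun_prop
      exact h1.continuousAt.eventually (lt_mem_nhds (by simp))
  obtain ⟨δ, hδ, hball⟩ := Metric.eventually_nhds_iff.1 hev
  set ε := δ / 2 with hε
  have hεpos : 0 < ε := by positivity
  let σ : ℝ → ℝ := fun t => ε * Real.sin t
  have hσd : ∀ t, dist (σ t) 0 < δ := by
    intro t
    rw [dist_zero_right, norm_mul, Real.norm_of_nonneg hεpos.le]
    calc ε * ‖Real.sin t‖ ≤ ε * 1 := by gcongr; exact Real.abs_sin_le_one t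
      _ < δ := by rw [hε]; linarith
  have hpos : ∀ t, 0 < p.eval (σ t) := fun t => (hball (hσd t)).1
  let f : ℝ → ℝ := fun t => p.eval (σ t) ^ (-(1 / ((n : ℝ) + 1)))
  have hfpos : ∀ t, 0 < f t := fun t => Real.rpow_pos_of_pos (hpos t) _
  have hdet : ∀ t, (f t • (1 + σ t • A)).det = 1 := by
    intro t
    rw [Matrix.det_smul, ← hpe, Fintype.card_fin]
    simp only [f]
    rw [← Real.rpow_natCast, ← Real.rpow_mul (hpos t).le]
    have : -(1 / ((n : ℝ) + 1)) * ((n + 1 : ℕ) : ℝ) = -1 := by push_cast; field_simp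
    rw [this, Real.rpow_neg_one, inv_mul_cancel₀ (hpos t).ne']
  let c : ℝ → projP n := fun t => ⟨⟨f t • (1 + σ t • A), hdet t⟩, f t * (1 + σ t * a),
    mul_pos (hfpos t) (hball (hσd t)).2, by
      change (f t • (1 + σ t • A)) *ᵥ vPlus n = _
      rw [Matrix.smul_mulVec, Matrix.add_mulVec, Matrix.one_mulVec, Matrix.smul_mulVec, ha]
      module⟩
  have hc : ∀ t, projRep n (c t) = f t • (1 + σ t • A) := fun t => rfl
  have hσs : ContDiff ℝ ∞ σ := contDiff_const.mul Real.contDiff_sin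
  have hfs : ContDiff ℝ ∞ f := by
    refine ContDiff.rpow_const_of_ne (f := fun t => p.eval (σ t)) ?_ fun t => (hpos t).ne'
    have : ContDiff ℝ ∞ fun s => p.eval s := by
      simpa using p.contDiff_aeval (𝕜 := ℝ) ∞
    exact this.comp hσs
  have hσ0 : σ 0 = 0 := by simp [σ]
  have hf0 : f 0 = 1 := by simp [f, hσ0, hpe]
  refine ⟨ε, hεpos.ne', c, fun ℓ => ?_, ?_, fun i j => ?_⟩
  · rw [contMDiffOn_iff_contDiffOn, contDiffOn_univ]
    simp only [hc, map_smul, map_add, smul_eq_mul]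
    exact hfs.mul (contDiff_const.add (hσs.mul contDiff_const))
  · apply Subtype.ext
    apply Subtype.ext
    change f 0 • (1 + σ 0 • A) = 1
    rw [hf0, hσ0]; simp
  · have hσ' : HasDerivAt σ ε 0 := by
      simpa using (Real.hasDerivAt_sin 0).const_mul ε
    have hp' : HasDerivAt (fun s => p.eval s) 0 (σ 0) := by
      have h1 : p.derivative.eval 0 = 0 := by
        rw [hp, Matrix.derivative_det_one_add_X_smul, htr]
      rw [hσ0]
      simpa only [h1] using p.hasDerivAt 0
    have hpσ : HasDerivAt (fun t => p.eval (σ t)) 0 0 := by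
      simpa [Function.comp_def] using hp'.comp 0 hσ'
    have hf' : HasDerivAt f 0 0 := by
      simpa only [zero_mul] using
        hpσ.rpow_const (p := -(1 / ((n : ℝ) + 1))) (Or.inl (hpos 0).ne')
    have h1 := hf'.mul ((hσ'.mul_const (A i j)).const_add ((1 : Matrix _ _ ℝ) i j))
    simp only [hc]
    convert! h1 using 1
    simp [hf0]

end ProjectiveCurves

/-! ### The split form and curves in the conformal parabolic `P̃` -/

section SplitForm

variable {n : ℕ}

/-- The split form `h`, as a bilinear form. -/
def hForm (n : ℕ) : LinearMap.BilinForm ℝ (Idx n → ℝ) :=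
  Matrix.toBilin' (LieAlgebra.Orthogonal.JD (Fin (n + 1)) ℝ)

theorem hForm_apply (x y : Idx n → ℝ) :
    hForm n x y = ∑ i, (x (Sum.inl i) * y (Sum.inr i) + x (Sum.inr i) * y (Sum.inl i)) := by
  rw [hForm, Matrix.toBilin'_apply', LieAlgebra.Orthogonal.JD, Matrix.fromBlocks_mulVec]
  simp [dotProduct, Fintype.sum_sum_type, Finset.sum_add_distrib]

theorem hForm_comm (x y : Idx n → ℝ) : hForm n x y = hForm n y x := by
  rw [hForm_apply, hForm_apply]
  exact Finset.sum_congr rfl fun i _ => by ring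

theorem splitForm_apply (x : Idx n → ℝ) : splitForm n x = hForm n x x := rfl

theorem hForm_single_right (x : Idx n → ℝ) (j : Idx n) :
    hForm n x (Pi.single j 1) = x j.swap := by
  rw [hForm_apply]
  rcases j with j | j <;> simp [Pi.single_apply]

/-- The bivector `x ∧ y`, as the matrix of the endomorphism `w ↦ h(y, w) x - h(x, w) y`. -/
def wedge (x y : Idx n → ℝ) : Matrix (Idx n) (Idx n) ℝ :=
  Matrix.of fun i j => y j.swap * x i - x j.swap * y i

theorem wedge_apply (x y : Idx n → ℝ) (i j : Idx n) :
    wedge x y i j = y j.swap * x i - x j.swap * y i := rfl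

theorem wedge_mulVec (x y w : Idx n → ℝ) :
    wedge x y *ᵥ w = hForm n y w • x - hForm n x w • y := by
  ext i
  simp only [Matrix.mulVec, dotProduct, wedge_apply, hForm_apply, Fintype.sum_sum_type,
    Sum.swap_inl, Sum.swap_inr, Pi.sub_apply, Pi.smul_apply, smul_eq_mul, Finset.sum_mul,
    ← Finset.sum_add_distrib, ← Finset.sum_sub_distrib]
  exact Finset.sum_congr rfl fun k _ => by ring

theorem vec_mul_vec_add_swap (x y : Idx n → ℝ) :
    vec n x * vec n y + vec n y * vec n x = algebraMap ℝ _ (2 * hForm n x y) := by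
  rw [CliffordAlgebra.ι_mul_ι_add_swap]
  congr 1
  simp only [QuadraticMap.polar, splitForm_apply, map_add, LinearMap.add_apply, hForm_comm y x]
  ring

theorem vec_mul_vec_self (x : Idx n → ℝ) : vec n x * vec n x = algebraMap ℝ _ (hForm n x x) :=
  CliffordAlgebra.ι_sq_scalar _ x

theorem vec_mul_vec_mul_self_mul_vec (x y : Idx n → ℝ) :
    (vec n y * vec n x) * (vec n x * vec n y) = algebraMap ℝ _ (hForm n x x * hForm n y y) := by
  rw [mul_assoc, ← mul_assoc (vec n x), vec_mul_vec_self, Algebra.left_comm,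
    vec_mul_vec_self, ← map_mul]

theorem vec_mul_vec_mem_spinGroup {x y : Idx n → ℝ} (h : hForm n x x * hForm n y y = 1) :
    vec n x * vec n y ∈ spinGroup (splitForm n) := by
  have hx : IsUnit (vec n x) := CliffordAlgebra.isUnit_ι_of_isUnit _
    (isUnit_iff_ne_zero.2 (left_ne_zero_of_mul_eq_one h))
  have hy : IsUnit (vec n y) := CliffordAlgebra.isUnit_ι_of_isUnit _
    (isUnit_iff_ne_zero.2 (right_ne_zero_of_mul_eq_one h))
  have hs : star (vec n x * vec n y) = vec n y * vec n x := by
    rw [star_mul, CliffordAlgebra.star_ι, CliffordAlgebra.star_ι, neg_mul_neg]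
  refine spinGroup.mem_iff.2 ⟨pinGroup.mem_iff.2 ⟨⟨hx.unit * hy.unit, ?_, rfl⟩, ?_, ?_⟩, ?_⟩
  · exact mul_mem (Subgroup.subset_closure ⟨x, rfl⟩) (Subgroup.subset_closure ⟨y, rfl⟩)
  · rw [hs, vec_mul_vec_mul_self_mul_vec, h, map_one]
  · rw [hs, vec_mul_vec_mul_self_mul_vec, mul_comm, h, map_one]
  · exact CliffordAlgebra.ι_mul_ι_mem_evenOdd_zero _ x y

/-- The product `x y` of two vectors with `h(x, x) h(y, y) = 1`, as an element of the spin group. -/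
def spinMul (x y : Idx n → ℝ) (h : hForm n x x * hForm n y y = 1) : SpinG n :=
  ⟨vec n x * vec n y, vec_mul_vec_mem_spinGroup h⟩

theorem coe_spinMul_inv (x y : Idx n → ℝ) (h : hForm n x x * hForm n y y = 1) :
    (((spinMul x y h)⁻¹ : SpinG n) : CliffordAlgebra (splitForm n)) = vec n y * vec n x := by
  rw [← spinGroup.star_eq_inv, spinGroup.coe_star]
  change star (vec n x * vec n y) = _
  rw [star_mul, CliffordAlgebra.star_ι, CliffordAlgebra.star_ι, neg_mul_neg]

theorem vec_spinVec_spinMul (x y w : Idx n → ℝ) (h : hForm n x x * hForm n y y = 1) :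
    vec n (spinVec n (spinMul x y h) w) =
      (vec n x * vec n y) * vec n w * (vec n y * vec n x) := by
  rw [vec_spinVec, coe_spinMul_inv]; rfl

theorem spinRep_mulVec (g : SpinG n) (w : Idx n → ℝ) : spinRep n g *ᵥ w = spinVec n g w :=
  LinearMap.toMatrix'_mulVec _ _

theorem spinRep_apply (g : SpinG n) (i j : Idx n) :
    spinRep n g i j = spinVec n g (Pi.single j 1) i :=
  LinearMap.toMatrix'_apply _ _ _

theorem vec_mul_eq_neg {x y : Idx n → ℝ} (h : hForm n x y = 0) :
    vec n x * vec n y = - (vec n y * vec n x) := by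
  have := vec_mul_vec_add_swap x y
  rw [h] at this
  simpa [eq_neg_iff_add_eq_zero] using this

/-- A product of two vectors orthogonal to `w` fixes `w`. -/
theorem spinVec_spinMul_of_orthogonal {x y w : Idx n → ℝ} (h : hForm n x x * hForm n y y = 1)
    (hx : hForm n x w = 0) (hy : hForm n y w = 0) : spinVec n (spinMul x y h) w = w := by
  apply vec_injective n
  rw [vec_spinVec_spinMul]
  have h1 : vec n x * vec n y * vec n w = vec n w * (vec n x * vec n y) := by
    rw [mul_assoc, vec_mul_eq_neg hy, mul_neg, ← mul_assoc, vec_mul_eq_neg hx, neg_mul, neg_neg,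
      mul_assoc]
  rw [h1, mul_assoc]
  have h2 := vec_mul_vec_mul_self_mul_vec y x
  rw [mul_comm (hForm n y y), h, map_one] at h2
  rw [h2, mul_one]

/-- For `x ⊥ y`, the Clifford bivector `y x` acts on vectors as `2 y ∧ x`. -/
theorem vec_bivector_action {x y : Idx n → ℝ} (h : hForm n x y = 0) (w : Idx n → ℝ) :
    vec n y * vec n x * vec n w + vec n w * vec n x * vec n y =
      vec n ((2 : ℝ) • (wedge y x *ᵥ w)) := by
  have h1 := vec_mul_vec_add_swap x w
  have h2 := vec_mul_vec_add_swap y w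
  have h3 := vec_mul_eq_neg h
  have h4 : vec n x * (vec n y * vec n w + vec n w * vec n y) =
      (vec n y * vec n w + vec n w * vec n y) * vec n x := by
    rw [h2, Algebra.commutes]
  have h5 : vec n ((2 : ℝ) • (wedge y x *ᵥ w)) =
      vec n y * (vec n x * vec n w + vec n w * vec n x) -
      vec n x * (vec n y * vec n w + vec n w * vec n y) := by
    rw [h1, h2, ← Algebra.commutes, ← Algebra.commutes, ← Algebra.smul_def, ← Algebra.smul_def,
      wedge_mulVec, map_smul, map_sub, map_smul, map_smul]
    module
  rw [h5]
  linear_combination (norm := noncomm_ring) h4 + vec n w * h3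

/-- The conjugation action of `(x + s y) (r x)`, for `x ⊥ y`, expanded in powers of `s`. -/
theorem vec_conj_expand {x y : Idx n → ℝ} (h : hForm n x y = 0) (s r : ℝ) (w : Idx n → ℝ) :
    vec n (x + s • y) * vec n (r • x) * vec n w * (vec n (r • x) * vec n (x + s • y)) =
      (r ^ 2) • ((hForm n x x ^ 2) • vec n w +
        (s * hForm n x x) • vec n ((2 : ℝ) • (wedge y x *ᵥ w)) +
        (s ^ 2) • (vec n y * vec n x * vec n w * vec n x * vec n y)) := by
  have hxx := vec_mul_vec_self x
  rw [Algebra.algebraMap_eq_smul_one] at hxx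
  rw [← vec_bivector_action h]
  generalize hForm n x x = q at *
  simp only [map_add, map_smul]
  generalize vec n x = X at *
  generalize vec n y = Y at *
  generalize vec n w = Z at *
  simp only [mul_add, add_mul, smul_mul_assoc, mul_smul_comm, ← mul_assoc, hxx, one_mul,
    mul_one, smul_add]
  module

/-- A smooth curve in `P̃` whose velocity is a multiple of `b ∧ a`: the curve of Clifford products
`f(t) (a + sin t b) a`, with the factor `f` normalising its spinor norm to `1`.  The hypothesis
`hlt` keeps `a + sin t b` from becoming null. -/
theorem exists_curve_confP {a b : Idx n → ℝ} (hab : hForm n a b = 0)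
    (hav : hForm n a (vTilde n) = 0) (hbv : hForm n b (vTilde n) = 0) (ha : hForm n a a ≠ 0)
    (hlt : |hForm n b b| < |hForm n a a|) :
    ∃ c : ℝ → confP n, SmoothIntoOn (E := ℝ) (confEmb n) c Set.univ ∧ c 0 = 1 ∧
      ∀ i j, HasDerivAt (fun t => confRep n (c t) i j)
        (((2 / hForm n a a) • wedge b a) i j) 0 := by
  set q := hForm n a a with hq
  set r := hForm n b b with hr
  -- `q N(t)` is the square of `a + sin t b`
  let N : ℝ → ℝ := fun t => 1 + Real.sin t ^ 2 * (r / q)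
  have hN : ∀ t, 0 < N t := by
    intro t
    have h1 : |r / q| < 1 := by rwa [abs_div, div_lt_one (abs_pos.2 ha)]
    have h2 : |Real.sin t ^ 2 * (r / q)| < 1 := by
      rw [abs_mul, abs_of_nonneg (sq_nonneg _)]
      calc Real.sin t ^ 2 * |r / q| ≤ 1 * |r / q| := by gcongr; exact Real.sin_sq_le_one t
        _ < 1 := by rwa [one_mul]
    have := (abs_lt.1 h2).1
    simp only [N]; linarith
  let f : ℝ → ℝ := fun t => (Real.sqrt (N t))⁻¹ / q
  have hfN : ∀ t, f t ^ 2 * N t * q ^ 2 = 1 := by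
    intro t
    simp only [f, div_pow, inv_pow, Real.sq_sqrt (hN t).le]
    have := (hN t).ne'
    field_simp
  have hx : ∀ t, hForm n (a + Real.sin t • b) (a + Real.sin t • b) = q * N t := by
    intro t
    simp only [map_add, map_smul, LinearMap.add_apply, LinearMap.smul_apply, smul_eq_mul,
      hForm_comm b a, hab, ← hq, ← hr, N]
    field_simp
    ring
  have hmem : ∀ t, hForm n (a + Real.sin t • b) (a + Real.sin t • b) *
      hForm n (f t • a) (f t • a) = 1 := by
    intro t
    rw [hx, ← hfN t]
    simp only [map_smul, LinearMap.smul_apply, smul_eq_mul, ← hq]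
    ring
  let c : ℝ → confP n := fun t => ⟨spinMul _ _ (hmem t), 1, one_pos, by
    rw [spinRep_mulVec, spinVec_spinMul_of_orthogonal, one_smul]
    · simp [hav, hbv]
    · simp [hav]⟩
  have hemb : ∀ t, confEmb n (c t) =
      f t • (algebraMap ℝ _ q + Real.sin t • (vec n b * vec n a)) := by
    intro t
    change vec n (a + Real.sin t • b) * vec n (f t • a) = _
    simp only [map_add, map_smul, add_mul, smul_mul_assoc, mul_smul_comm, vec_mul_vec_self, ← hq]
  have hNs : ContDiff ℝ ∞ N :=
    contDiff_const.add ((Real.contDiff_sin.pow 2).mul contDiff_const)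
  have hfs : ContDiff ℝ ∞ f :=
    ((hNs.sqrt fun t => (hN t).ne').inv fun t => (Real.sqrt_pos.2 (hN t)).ne').div_const q
  have hf0 : f 0 = 1 / q := by simp [f, N]
  refine ⟨c, fun ℓ => ?_, ?_, fun i j => ?_⟩
  · rw [contMDiffOn_iff_contDiffOn, contDiffOn_univ]
    simp only [hemb, map_smul, map_add, smul_eq_mul]
    exact hfs.mul (contDiff_const.add (Real.contDiff_sin.mul contDiff_const))
  · apply Subtype.ext
    apply Subtype.ext
    change confEmb n (c 0) = 1
    rw [hemb, hf0]
    simp only [Real.sin_zero, zero_smul, add_zero]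
    rw [Algebra.smul_def, ← map_mul, one_div, inv_mul_cancel₀ ha, map_one]
  · obtain ⟨p, hp⟩ := LinearMap.exists_leftInverse_of_injective (vec n)
      (LinearMap.ker_eq_bot.2 (vec_injective n))
    have hp' : ∀ x, p (vec n x) = x := fun x => congrArg (fun L => L x) hp
    set w : Idx n → ℝ := Pi.single j 1
    have hrep : ∀ t, confRep n (c t) i j =
        f t ^ 2 * (q ^ 2 * w i + Real.sin t * (q * (2 * (wedge b a *ᵥ w) i)) +
          Real.sin t ^ 2 * p (vec n b * vec n a * vec n w * vec n a * vec n b) i) := by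
      intro t
      have h1 : confRep n (c t) i j = p (vec n (spinVec n (spinMul _ _ (hmem t)) w)) i := by
        rw [hp']; exact spinRep_apply _ i j
      rw [h1, vec_spinVec_spinMul]
      rw [vec_conj_expand hab, ← hq]
      simp only [map_smul, map_add, hp', Pi.add_apply, Pi.smul_apply, smul_eq_mul]
      ring
    have hN' : HasDerivAt N 0 0 := by
      have := (((Real.hasDerivAt_sin 0).pow 2).mul_const (r / q)).const_add 1
      simpa [N] using this
    have hf' : HasDerivAt (fun t => f t ^ 2) 0 0 := by
      have h1 : (fun t => f t ^ 2) = fun t => (N t)⁻¹ / q ^ 2 := by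
        funext t
        simp only [f, div_pow, inv_pow, Real.sq_sqrt (hN t).le]
      rw [h1]
      simpa using (hN'.inv (hN 0).ne').div_const (q ^ 2)
    have hs := Real.hasDerivAt_sin 0
    have h2 := hf'.mul (((hs.mul_const (q * (2 * (wedge b a *ᵥ w) i))).const_add
      (q ^ 2 * w i)).add ((hs.pow 2).mul_const
        (p (vec n b * vec n a * vec n w * vec n a * vec n b) i)))
    have h3 : (wedge b a *ᵥ w) i = wedge b a i j := by
      simp [w]
    convert! h2 using 1
    · exact funext hrep
    · simp [hf0, h3]
      field_simp

end SplitForm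

/-! ### The Killing forms of `𝔰𝔩(n+1)` and `𝔰𝔬(n+1, n+1)` -/

section Killing

variable {ι : Type*} [Fintype ι] [DecidableEq ι]

theorem trace_eq_sum_single (f : Matrix ι ι ℝ →ₗ[ℝ] Matrix ι ι ℝ) :
    LinearMap.trace ℝ _ f = ∑ i, ∑ j, f (Matrix.single i j 1) i j := by
  rw [LinearMap.trace_eq_matrix_trace ℝ (Matrix.stdBasis ℝ ι ι), Matrix.trace, Fintype.sum_prod_type]
  refine Finset.sum_congr rfl fun i _ => Finset.sum_congr rfl fun j _ => ?_
  rw [Matrix.diag_apply, LinearMap.toMatrix_apply, Matrix.stdBasis_eq_single]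
  simp [Matrix.stdBasis]

/-- The linear map `A ↦ M A N`. -/
def sandwich (M N : Matrix ι ι ℝ) : Matrix ι ι ℝ →ₗ[ℝ] Matrix ι ι ℝ :=
  LinearMap.mulRight ℝ N ∘ₗ LinearMap.mulLeft ℝ M

theorem trace_sandwich (M N : Matrix ι ι ℝ) :
    LinearMap.trace ℝ _ (sandwich M N) = M.trace * N.trace := by
  rw [trace_eq_sum_single, Matrix.trace, Matrix.trace, Finset.sum_mul_sum]
  refine Finset.sum_congr rfl fun i _ => Finset.sum_congr rfl fun j _ => ?_
  change (M * Matrix.single i j (1 : ℝ) * N : Matrix ι ι ℝ) i j = _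
  simp [Matrix.mul_apply, Matrix.single_apply, ite_and, Finset.sum_ite_eq]

theorem trace_sandwich_transpose (M N : Matrix ι ι ℝ) :
    LinearMap.trace ℝ _ (sandwich M N ∘ₗ (Matrix.transposeLinearEquiv ι ι ℝ ℝ).toLinearMap) =
      (M * Nᵀ).trace := by
  rw [trace_eq_sum_single, Matrix.trace]
  refine Finset.sum_congr rfl fun i _ => ?_
  rw [Matrix.diag_apply, Matrix.mul_apply]
  refine Finset.sum_congr rfl fun j _ => ?_
  change (M * (Matrix.single i j (1 : ℝ))ᵀ * N : Matrix ι ι ℝ) i j = _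
  simp [Matrix.transpose_single, Matrix.mul_apply, Matrix.single_apply, ite_and,
    Finset.sum_ite_eq]

/-- The Killing form of a matrix Lie algebra `𝔤` is a trace over all matrices, by means of a
linear projection onto `𝔤`. -/
theorem killingForm_eq_trace {𝔤 : LieSubalgebra ℝ (Matrix ι ι ℝ)}
    (P : Matrix ι ι ℝ →ₗ[ℝ] Matrix ι ι ℝ) (hP : ∀ A, P A ∈ 𝔤) (hP' : ∀ A ∈ 𝔤, P A = A) (X Y : 𝔤) :
    killingForm ℝ 𝔤 X Y = LinearMap.trace ℝ _
      ((sandwich (X.1 * Y.1) 1 - sandwich X.1 Y.1 - sandwich Y.1 X.1 +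
        sandwich 1 (Y.1 * X.1)) ∘ₗ P) := by
  have hf : ∀ A, ((sandwich (X.1 * Y.1) 1 - sandwich X.1 Y.1 - sandwich Y.1 X.1 +
      sandwich 1 (Y.1 * X.1)) ∘ₗ P) A = ⁅X.1, ⁅Y.1, P A⁆⁆ := by
    intro A
    change X.1 * Y.1 * P A * 1 - X.1 * P A * Y.1 - Y.1 * P A * X.1 + 1 * P A * (Y.1 * X.1) = _
    simp only [Ring.lie_def]
    noncomm_ring
  have hmem : ∀ A, ((sandwich (X.1 * Y.1) 1 - sandwich X.1 Y.1 - sandwich Y.1 X.1 +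
      sandwich 1 (Y.1 * X.1)) ∘ₗ P) A ∈ 𝔤.toSubmodule := by
    intro A
    rw [hf]
    exact 𝔤.lie_mem X.2 (𝔤.lie_mem Y.2 (hP A))
  rw [← LinearMap.trace_restrict_eq_of_forall_mem 𝔤.toSubmodule _ hmem, killingForm_apply_apply]
  congr 1
  ext A : 2
  change _ = ((sandwich (X.1 * Y.1) 1 - sandwich X.1 Y.1 - sandwich Y.1 X.1 +
      sandwich 1 (Y.1 * X.1)) ∘ₗ P) A.1
  rw [hf, hP' _ A.2]
  rfl

theorem killingForm_projAlg (n : ℕ) (X Y : projAlg n) :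
    killingForm ℝ (projAlg n) X Y = (2 * (n + 1) : ℝ) * (X.1 * Y.1).trace := by
  have hmem : ∀ A : Matrix (Fin (n + 1)) (Fin (n + 1)) ℝ, A ∈ projAlg n ↔ A.trace = 0 :=
    fun A => Iff.rfl
  have hX := (hmem _).1 X.2
  have hY := (hmem _).1 Y.2
  -- the projection `A ↦ A - (tr A / (n + 1)) 1`
  rw [killingForm_eq_trace (LinearMap.id - (1 / ((n : ℝ) + 1)) •
    (Matrix.traceLinearMap (Fin (n + 1)) ℝ ℝ).smulRight 1)]
  · have h1 : (sandwich (X.1 * Y.1) 1 - sandwich X.1 Y.1 - sandwich Y.1 X.1 +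
        sandwich 1 (Y.1 * X.1)) ∘ₗ (LinearMap.id - (1 / ((n : ℝ) + 1)) •
        (Matrix.traceLinearMap (Fin (n + 1)) ℝ ℝ).smulRight 1) =
        sandwich (X.1 * Y.1) 1 - sandwich X.1 Y.1 - sandwich Y.1 X.1 +
        sandwich 1 (Y.1 * X.1) := by
      refine LinearMap.ext fun A => ?_
      rw [LinearMap.comp_apply, LinearMap.sub_apply, map_sub, LinearMap.id_apply, sub_eq_self,
        LinearMap.smul_apply, map_smul, LinearMap.smulRight_apply, map_smul]
      have : (sandwich (X.1 * Y.1) 1 - sandwich X.1 Y.1 - sandwich Y.1 X.1 +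
          sandwich 1 (Y.1 * X.1)) 1 = 0 := by
        change X.1 * Y.1 * 1 * 1 - X.1 * 1 * Y.1 - Y.1 * 1 * X.1 + 1 * 1 * (Y.1 * X.1) = 0
        noncomm_ring
      rw [this, smul_zero, smul_zero]
    rw [h1, map_add, map_sub, map_sub, trace_sandwich, trace_sandwich, trace_sandwich,
      trace_sandwich, hX, hY, Matrix.trace_one, Matrix.trace_mul_comm Y.1]
    simp
    ring
  · intro A
    rw [hmem]
    simp only [LinearMap.sub_apply, LinearMap.id_apply, LinearMap.smul_apply,
      LinearMap.smulRight_apply, Matrix.traceLinearMap_apply, Matrix.trace_sub, Matrix.trace_smul,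
      Matrix.trace_one, Fintype.card_fin, smul_eq_mul]
    push_cast
    field_simp
    ring
  · intro A hA
    rw [hmem] at hA
    simp [hA]

theorem JD_mul_JD (n : ℕ) : LieAlgebra.Orthogonal.JD (Fin (n + 1)) ℝ *
    LieAlgebra.Orthogonal.JD (Fin (n + 1)) ℝ = 1 := by
  simp [LieAlgebra.Orthogonal.JD, Matrix.fromBlocks_multiply]

theorem JD_transpose (n : ℕ) : (LieAlgebra.Orthogonal.JD (Fin (n + 1)) ℝ)ᵀ =
    LieAlgebra.Orthogonal.JD (Fin (n + 1)) ℝ := by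
  simp [LieAlgebra.Orthogonal.JD, Matrix.fromBlocks_transpose]

theorem mem_confAlg {n : ℕ} (X : Matrix (Idx n) (Idx n) ℝ) : X ∈ confAlg n ↔
    Xᵀ * LieAlgebra.Orthogonal.JD (Fin (n + 1)) ℝ =
      - (LieAlgebra.Orthogonal.JD (Fin (n + 1)) ℝ * X) := by
  rw [← mul_neg]
  simp [confAlg, LieAlgebra.Orthogonal.typeD, mem_skewAdjointMatricesLieSubalgebra,
    mem_skewAdjointMatricesSubmodule, Matrix.IsSkewAdjoint, Matrix.IsAdjointPair]

theorem killingForm_confAlg (n : ℕ) (X Y : confAlg n) :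
    killingForm ℝ (confAlg n) X Y = (2 * n : ℝ) * (X.1 * Y.1).trace := by
  set J := LieAlgebra.Orthogonal.JD (Fin (n + 1)) ℝ with hJ
  have hJJ : J * J = 1 := JD_mul_JD n
  have hJt : Jᵀ = J := JD_transpose n
  have hconj : ∀ A ∈ confAlg n, J * Aᵀ * J = -A := by
    intro A hA
    rw [mul_assoc, (mem_confAlg A).1 hA, mul_neg, ← mul_assoc, hJJ, one_mul]
  have htr : ∀ A ∈ confAlg n, A.trace = 0 := by
    intro A hA
    have h1 := congrArg Matrix.trace (hconj A hA)
    rw [Matrix.trace_mul_comm, ← mul_assoc, hJJ, one_mul, Matrix.trace_transpose,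
      Matrix.trace_neg] at h1
    linarith
  -- the projection `A ↦ (A - J Aᵀ J) / 2`
  rw [killingForm_eq_trace ((1 / 2 : ℝ) • (LinearMap.id - sandwich J J ∘ₗ
    (Matrix.transposeLinearEquiv (Idx n) (Idx n) ℝ ℝ).toLinearMap))]
  · have h1 : (sandwich (X.1 * Y.1) 1 - sandwich X.1 Y.1 - sandwich Y.1 X.1 +
        sandwich 1 (Y.1 * X.1)) ∘ₗ ((1 / 2 : ℝ) • (LinearMap.id - sandwich J J ∘ₗ
        (Matrix.transposeLinearEquiv (Idx n) (Idx n) ℝ ℝ).toLinearMap)) =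
        (1 / 2 : ℝ) • (sandwich (X.1 * Y.1) 1 - sandwich X.1 Y.1 - sandwich Y.1 X.1 +
        sandwich 1 (Y.1 * X.1) - (sandwich (X.1 * Y.1 * J) J - sandwich (X.1 * J) (J * Y.1) -
        sandwich (Y.1 * J) (J * X.1) + sandwich J (J * (Y.1 * X.1))) ∘ₗ
        (Matrix.transposeLinearEquiv (Idx n) (Idx n) ℝ ℝ).toLinearMap) := by
      rw [LinearMap.comp_smul, LinearMap.comp_sub, LinearMap.comp_id, ← LinearMap.comp_assoc]
      congr 3
      refine LinearMap.ext fun A => ?_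
      change X.1 * Y.1 * (J * A * J) * 1 - X.1 * (J * A * J) * Y.1 - Y.1 * (J * A * J) * X.1 +
        1 * (J * A * J) * (Y.1 * X.1) = X.1 * Y.1 * J * A * J - X.1 * J * A * (J * Y.1) -
        Y.1 * J * A * (J * X.1) + J * A * (J * (Y.1 * X.1))
      noncomm_ring
    have h2 : ∀ A B : Matrix (Idx n) (Idx n) ℝ, B ∈ confAlg n →
        (A * J * (J * B)ᵀ).trace = -(A * B).trace := by
      intro A B hB
      rw [Matrix.transpose_mul, hJt, mul_assoc, ← mul_assoc J, hconj B hB, mul_neg,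
        Matrix.trace_neg]
    have h3 : (X.1 * Y.1 * J * Jᵀ).trace = (X.1 * Y.1).trace := by
      rw [hJt, mul_assoc, hJJ, mul_one]
    have h4 : (J * (J * (Y.1 * X.1))ᵀ).trace = (X.1 * Y.1).trace := by
      rw [Matrix.transpose_mul J, hJt, Matrix.trace_mul_comm, mul_assoc, hJJ, mul_one,
        Matrix.trace_transpose, Matrix.trace_mul_comm]
    rw [h1, map_smul, map_sub, LinearMap.add_comp, LinearMap.sub_comp, LinearMap.sub_comp]
    simp only [map_add, map_sub, trace_sandwich, trace_sandwich_transpose, h2 _ _ X.2, h2 _ _ Y.2,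
      h3, h4, htr _ X.2, htr _ Y.2, Matrix.trace_one, Matrix.trace_mul_comm Y.1 X.1]
    simp
    ring
  · intro A
    rw [mem_confAlg]
    change ((1 / 2 : ℝ) • (A - J * Aᵀ * J))ᵀ * J = -(J * ((1 / 2 : ℝ) • (A - J * Aᵀ * J)))
    rw [Matrix.transpose_smul, Matrix.transpose_sub, Matrix.transpose_mul, Matrix.transpose_mul,
      hJt, Matrix.transpose_transpose, smul_mul_assoc, mul_smul_comm, ← smul_neg]
    congr 1
    have e1 : J * (A * J) * J = J * A := by rw [mul_assoc, mul_assoc, hJJ, mul_one]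
    have e2 : J * (J * Aᵀ * J) = Aᵀ * J := by rw [← mul_assoc, ← mul_assoc, hJJ, one_mul]
    rw [sub_mul, mul_sub, e1, e2, neg_sub]
  · intro A hA
    change (1 / 2 : ℝ) • (A - J * Aᵀ * J) = A
    rw [hconj A hA]
    module

end Killing

/-! ### The curvature function as a bilinear map, and normality in a frame -/

section CurvatureForm

variable {ι : Type*} [Fintype ι] [DecidableEq ι]
  {E : Type*} [NormedAddCommGroup E] [NormedSpace ℝ E]
  {B : Type*} [TopologicalSpace B] [ChartedSpace E B]
  {θ : ∀ u : B, TangentSpace 𝓘(ℝ, E) u →ₗ[ℝ] Matrix ι ι ℝ}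

theorem curvatureFunction_swap (u : B) (A A' : Matrix ι ι ℝ) :
    curvatureFunction θ u A' A = - curvatureFunction θ u A A' :=
  curvature_swap θ u _ _

variable [IsManifold 𝓘(ℝ, E) ∞ B] {H W : Type*} [Group H] [AddCommGroup W] [Module ℝ W]
  {emb : H → W} {rep : H →* Matrix ι ι ℝ} {𝔤 : LieSubalgebra ℝ (Matrix ι ι ℝ)} {act : B → H → B}

theorem IsCartanConnection.apply_mem (hθ : IsCartanConnection emb rep 𝔤 act θ) (u : B)
    (v : TangentSpace 𝓘(ℝ, E) u) : θ u v ∈ 𝔤 := by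
  have : θ u v ∈ LinearMap.range (θ u) := ⟨v, rfl⟩
  rwa [hθ.range_eq u] at this

theorem IsCartanConnection.apply_invFun (hθ : IsCartanConnection emb rep 𝔤 act θ) (u : B)
    {A : Matrix ι ι ℝ} (hA : A ∈ 𝔤) : θ u (Function.invFun (θ u) A) = A := by
  have : A ∈ LinearMap.range (θ u) := by rw [hθ.range_eq u]; exact hA
  exact Function.invFun_eq this

theorem IsCartanConnection.invFun_apply (hθ : IsCartanConnection emb rep 𝔤 act θ) (u : B)
    (v : TangentSpace 𝓘(ℝ, E) u) : Function.invFun (θ u) (θ u v) = v :=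
  Function.leftInverse_invFun (hθ.injective u) v

theorem IsCartanConnection.curvatureFunction_add_smul_left
    (hθ : IsCartanConnection emb rep 𝔤 act θ) (u : B) {A A' : Matrix ι ι ℝ} (hA : A ∈ 𝔤)
    (hA' : A' ∈ 𝔤) (r : ℝ) (C : Matrix ι ι ℝ) :
    curvatureFunction θ u (A + r • A') C =
      curvatureFunction θ u A C + r • curvatureFunction θ u A' C := by
  have h : Function.invFun (θ u) (A + r • A') =
      Function.invFun (θ u) A + r • Function.invFun (θ u) A' := by
    apply hθ.injective u
    rw [hθ.apply_invFun u (𝔤.add_mem hA (𝔤.smul_mem r hA')), map_add, map_smul,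
      hθ.apply_invFun u hA, hθ.apply_invFun u hA']
  unfold curvatureFunction
  rw [h, curvature_add_smul_left hθ.smooth]

/-- The curvature function at `u`, as a bilinear map on `𝔤`. -/
def curvatureForm (hθ : IsCartanConnection emb rep 𝔤 act θ) (u : B) :
    𝔤 →ₗ[ℝ] 𝔤 →ₗ[ℝ] Matrix ι ι ℝ :=
  LinearMap.mk₂ ℝ (fun A A' => curvatureFunction θ u A A')
    (fun A A' C => by
      have := hθ.curvatureFunction_add_smul_left u A.2 A'.2 1 C
      simpa using this)
    (fun r A C => by
      have := hθ.curvatureFunction_add_smul_left u 𝔤.zero_mem A.2 r C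
      have h0 := hθ.curvatureFunction_add_smul_left u 𝔤.zero_mem 𝔤.zero_mem 1 C
      simp only [smul_zero, add_zero, one_smul, left_eq_add] at h0
      simpa [h0] using this)
    (fun C A A' => by
      have := hθ.curvatureFunction_add_smul_left u A.2 A'.2 1 C
      rw [curvatureFunction_swap u _ (C : Matrix ι ι ℝ),
        curvatureFunction_swap u _ (C : Matrix ι ι ℝ),
        curvatureFunction_swap u _ (C : Matrix ι ι ℝ), ← neg_add]
      exact congrArg Neg.neg (by simpa using this))
    (fun r C A => by
      have := hθ.curvatureFunction_add_smul_left u 𝔤.zero_mem A.2 r C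
      have h0 := hθ.curvatureFunction_add_smul_left u 𝔤.zero_mem 𝔤.zero_mem 1 C
      simp only [smul_zero, add_zero, one_smul, left_eq_add] at h0
      rw [curvatureFunction_swap u _ (C : Matrix ι ι ℝ),
        curvatureFunction_swap u _ (C : Matrix ι ι ℝ), smul_neg]
      simpa [h0] using this)

theorem curvatureForm_apply (hθ : IsCartanConnection emb rep 𝔤 act θ) (u : B) (A A' : 𝔤) :
    curvatureForm hθ u A A' = curvatureFunction θ u A A' := rfl

theorem curvatureForm_swap (hθ : IsCartanConnection emb rep 𝔤 act θ) (u : B) (A A' : 𝔤) :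
    curvatureForm hθ u A' A = - curvatureForm hθ u A A' :=
  curvatureFunction_swap u _ _

theorem curvatureForm_of_eq (hθ : IsCartanConnection emb rep 𝔤 act θ) (u : B) {A A' : 𝔤}
    {v w : TangentSpace 𝓘(ℝ, E) u} (hv : θ u v = A) (hw : θ u w = A') :
    curvatureForm hθ u A A' = curvature θ u v w := by
  rw [curvatureForm_apply, ← hv, ← hw, curvatureFunction, hθ.invFun_apply, hθ.invFun_apply]

theorem IsFlat.of_curvatureForm (hθ : IsCartanConnection emb rep 𝔤 act θ)
    (h : ∀ u A A', curvatureForm hθ u A A' = 0) : IsFlat θ := by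
  intro u v w
  rw [← curvatureForm_of_eq hθ u (A := ⟨θ u v, hθ.apply_mem u v⟩)
    (A' := ⟨θ u w, hθ.apply_mem u w⟩) rfl rfl, h]

/-- The first argument of the curvature matters only modulo the elements on which the curvature
vanishes. -/
theorem curvatureForm_left_congr (hθ : IsCartanConnection emb rep 𝔤 act θ) (u : B) {A A' : 𝔤}
    (h : ∀ C, curvatureForm hθ u (A - A') C = 0) (C : 𝔤) :
    curvatureForm hθ u A C = curvatureForm hθ u A' C := by
  have := h C
  rwa [map_sub, LinearMap.sub_apply, sub_eq_zero] at this

theorem curvatureForm_right_eq_zero (hθ : IsCartanConnection emb rep 𝔤 act θ) (u : B) {A : 𝔤}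
    (h : ∀ C, curvatureForm hθ u A C = 0) (C : 𝔤) : curvatureForm hθ u C A = 0 := by
  rw [curvatureForm_swap, h, neg_zero]

/-- The dual frame conditions, for an arbitrary finite index type; the spanning property is given
by an expansion of every element of `𝔤` modulo `𝔭`. -/
theorem isDualFrame_of_expansion {𝔤 : LieSubalgebra ℝ (Matrix ι ι ℝ)} {𝔭 : LieSubalgebra ℝ 𝔤}
    {m : ℕ} {A Z : Fin m → 𝔤}
    (horth : ∀ i, ∀ X ∈ 𝔭, killingForm ℝ 𝔤 X (Z i) = 0)
    (hdual : ∀ i j, killingForm ℝ 𝔤 (A i) (Z j) = if i = j then 1 else 0)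
    (hexp : ∀ X : 𝔤, ∃ c : Fin m → ℝ, X - ∑ i, c i • A i ∈ 𝔭) : IsDualFrame 𝔭 A Z where
  linearIndependent := by
    rw [Fintype.linearIndependent_iff]
    intro c hc j
    have h1 : ∑ i, c i • A i ∈ 𝔭 := by
      have h2 : 𝔭.toSubmodule.mkQ (∑ i, c i • A i) = 0 := by
        rw [map_sum, ← hc]
        exact Finset.sum_congr rfl fun i _ => map_smul _ _ _
      rwa [Submodule.mkQ_apply, Submodule.Quotient.mk_eq_zero] at h2
    have h2 := horth j _ h1
    simpa [map_sum, LinearMap.sum_apply, hdual] using h2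
  span_eq_top := by
    rw [eq_top_iff]
    intro x _
    obtain ⟨X, rfl⟩ := 𝔭.toSubmodule.mkQ_surjective x
    obtain ⟨c, hc⟩ := hexp X
    have h1 : 𝔭.toSubmodule.mkQ X = ∑ i, c i • 𝔭.toSubmodule.mkQ (A i) := by
      have h2 : 𝔭.toSubmodule.mkQ (X - ∑ i, c i • A i) = 0 := by
        rw [Submodule.mkQ_apply, Submodule.Quotient.mk_eq_zero]; exact hc
      rw [map_sub, sub_eq_zero, map_sum] at h2
      rw [h2]
      exact Finset.sum_congr rfl fun i _ => map_smul _ _ _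
    rw [h1]
    exact Submodule.sum_mem _ fun i _ => Submodule.smul_mem _ _ (Submodule.subset_span ⟨i, rfl⟩)
  orthogonal := horth
  dual := hdual

/-- Normality, tested on a dual frame indexed by an arbitrary finite type. -/
theorem IsNormal.sum_eq_zero (hθ : IsCartanConnection emb rep 𝔤 act θ) {𝔭 : LieSubalgebra ℝ 𝔤}
    (hN : IsNormal 𝔭 θ) {τ : Type*} [Fintype τ] [DecidableEq τ] (A Z : τ → 𝔤)
    (horth : ∀ i, ∀ X ∈ 𝔭, killingForm ℝ 𝔤 X (Z i) = 0)
    (hdual : ∀ i j, killingForm ℝ 𝔤 (A i) (Z j) = if i = j then 1 else 0)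
    (hexp : ∀ X : 𝔤, ∃ c : τ → ℝ, X - ∑ i, c i • A i ∈ 𝔭) (u : B) (X : 𝔤) :
    (2 : ℝ) • ∑ i, ⁅curvatureForm hθ u (A i) X, (Z i : Matrix ι ι ℝ)⁆ +
      ∑ i, curvatureForm hθ u (A i) ⁅Z i, X⁆ = 0 := by
  let e := Fintype.equivFin τ
  have hD : IsDualFrame 𝔭 (A ∘ e.symm) (Z ∘ e.symm) := by
    refine isDualFrame_of_expansion (fun i => horth _) (fun i j => ?_) fun X => ?_
    · simp [hdual]
    · obtain ⟨c, hc⟩ := hexp X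
      refine ⟨c ∘ e.symm, ?_⟩
      rwa [← e.symm.sum_comp (fun i => c i • A i)] at hc
  rw [← hN _ _ _ hD u X, codifferential,
    ← e.symm.sum_comp (fun i => ⁅curvatureForm hθ u (A i) X, (Z i : Matrix ι ι ℝ)⁆),
    ← e.symm.sum_comp (fun i => curvatureForm hθ u (A i) ⁅Z i, X⁆)]
  rfl

end CurvatureForm

/-! ### Bivectors in `𝔰𝔬(n+1, n+1)` -/

section ConformalAlgebra

variable {n : ℕ}

theorem mem_confAlg_iff (X : Matrix (Idx n) (Idx n) ℝ) :
    X ∈ confAlg n ↔ ∀ i j, X j.swap i = - X i.swap j := by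
  have h1 : ∀ i j, (Xᵀ * LieAlgebra.Orthogonal.JD (Fin (n + 1)) ℝ) i j = X j.swap i := by
    intro i j
    rcases j with j | j <;>
      simp [Matrix.mul_apply, LieAlgebra.Orthogonal.JD, Fintype.sum_sum_type, Matrix.one_apply]
  have h2 : ∀ i j, (LieAlgebra.Orthogonal.JD (Fin (n + 1)) ℝ * X) i j = X i.swap j := by
    intro i j
    rcases i with i | i <;>
      simp [Matrix.mul_apply, LieAlgebra.Orthogonal.JD, Fintype.sum_sum_type, Matrix.one_apply]
  rw [mem_confAlg, ← Matrix.ext_iff]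
  simp only [h1, Matrix.neg_apply, h2]

theorem wedge_mem (x y : Idx n → ℝ) : wedge x y ∈ confAlg n := by
  rw [mem_confAlg_iff]
  intro i j
  simp only [wedge_apply]
  ring

theorem hForm_eq_sum_swap (x y : Idx n → ℝ) : hForm n x y = ∑ i, x i * y i.swap := by
  rw [hForm_apply, Fintype.sum_sum_type, Finset.sum_add_distrib]
  simp

theorem hForm_mulVec_left {X : Matrix (Idx n) (Idx n) ℝ} (hX : X ∈ confAlg n) (x y : Idx n → ℝ) :
    hForm n (X *ᵥ x) y = - hForm n x (X *ᵥ y) := by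
  simp only [hForm_eq_sum_swap, Matrix.mulVec, dotProduct, Finset.sum_mul, Finset.mul_sum,
    ← Finset.sum_neg_distrib]
  rw [Finset.sum_comm]
  refine Finset.sum_congr rfl fun i _ => ?_
  rw [← (Equiv.sumComm (Fin (n + 1)) (Fin (n + 1))).sum_comp]
  refine Finset.sum_congr rfl fun j _ => ?_
  have := (mem_confAlg_iff X).1 hX i j
  simp only [Equiv.sumComm_apply, Sum.swap_swap, this]
  ring

theorem mul_wedge (X : Matrix (Idx n) (Idx n) ℝ) (x y : Idx n → ℝ) (i j : Idx n) :
    (X * wedge x y) i j = y j.swap * (X *ᵥ x) i - x j.swap * (X *ᵥ y) i := by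
  simp only [Matrix.mul_apply, wedge_apply, Matrix.mulVec, dotProduct, Finset.mul_sum,
    ← Finset.sum_sub_distrib]
  exact Finset.sum_congr rfl fun k _ => by ring

theorem wedge_mul {X : Matrix (Idx n) (Idx n) ℝ} (hX : X ∈ confAlg n) (x y : Idx n → ℝ)
    (i j : Idx n) :
    (wedge x y * X) i j = (X *ᵥ x) j.swap * y i - (X *ᵥ y) j.swap * x i := by
  have h : ∀ z : Idx n → ℝ, (X *ᵥ z) j.swap = - ∑ k, z k.swap * X k j := by
    intro z
    simp only [Matrix.mulVec, dotProduct]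
    rw [← (Equiv.sumComm (Fin (n + 1)) (Fin (n + 1))).sum_comp, ← Finset.sum_neg_distrib]
    refine Finset.sum_congr rfl fun k _ => ?_
    have := (mem_confAlg_iff X).1 hX k.swap j
    simp only [Sum.swap_swap] at this
    simp only [Equiv.sumComm_apply, this]
    ring
  rw [h, h]
  simp only [Matrix.mul_apply, wedge_apply, neg_mul, Finset.sum_mul, sub_neg_eq_add]
  rw [neg_add_eq_sub, ← Finset.sum_sub_distrib]
  exact Finset.sum_congr rfl fun k _ => by ring

theorem lie_wedge {X : Matrix (Idx n) (Idx n) ℝ} (hX : X ∈ confAlg n) (x y : Idx n → ℝ) :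
    ⁅X, wedge x y⁆ = wedge (X *ᵥ x) y + wedge x (X *ᵥ y) := by
  ext i j
  rw [Ring.lie_def, Matrix.sub_apply, mul_wedge, wedge_mul hX, Matrix.add_apply, wedge_apply,
    wedge_apply]
  ring

theorem trace_mul_wedge {X : Matrix (Idx n) (Idx n) ℝ} (hX : X ∈ confAlg n) (x y : Idx n → ℝ) :
    (X * wedge x y).trace = 2 * hForm n y (X *ᵥ x) := by
  have h1 : (X * wedge x y).trace = hForm n (X *ᵥ x) y - hForm n (X *ᵥ y) x := by
    rw [hForm_eq_sum_swap, hForm_eq_sum_swap, ← Finset.sum_sub_distrib, Matrix.trace]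
    refine Finset.sum_congr rfl fun i _ => ?_
    rw [Matrix.diag_apply, mul_wedge]
    ring
  rw [h1, hForm_mulVec_left hX y x, hForm_comm _ y]
  ring

theorem wedge_add_smul_left (x x' y : Idx n → ℝ) (r : ℝ) :
    wedge (x + r • x') y = wedge x y + r • wedge x' y := by
  ext i j
  simp [wedge_apply]
  ring

theorem wedge_add_smul_right (x y y' : Idx n → ℝ) (r : ℝ) :
    wedge x (y + r • y') = wedge x y + r • wedge x y' := by
  ext i j
  simp [wedge_apply]
  ring

theorem wedge_self (x : Idx n → ℝ) : wedge x x = 0 := by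
  ext i j
  simp [wedge_apply]

theorem wedge_smul_left (x y : Idx n → ℝ) (r : ℝ) : wedge (r • x) y = r • wedge x y := by
  ext i j
  simp [wedge_apply]
  ring

/-- An element of `𝔰𝔬(n+1, n+1)` annihilating `v` is a combination of bivectors orthogonal to `v`;
`v'` is any vector with `h(v, v') = 1`. -/
theorem eq_sum_wedge_of_mulVec_eq_zero {X : Matrix (Idx n) (Idx n) ℝ} (hX : X ∈ confAlg n)
    {v : Idx n → ℝ} (hXv : X *ᵥ v = 0) (v' : Idx n → ℝ) :
    X = (1 / 2 : ℝ) • ∑ k, wedge (X *ᵥ Pi.single k 1) (Pi.single k.swap 1 - v k • v') := by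
  have h1 : ∑ k, v k • (X *ᵥ Pi.single k 1) = 0 := by
    rw [← hXv]
    ext i
    simp [Matrix.mulVec, dotProduct, mul_comm]
  ext i j
  have h2 := congrFun h1 i
  have h3 := congrFun h1 j.swap
  simp only [Matrix.mulVec_single_one, Finset.sum_apply, Pi.smul_apply, smul_eq_mul, Pi.zero_apply,
    Matrix.col_apply] at h2 h3
  rw [Matrix.smul_apply, Matrix.sum_apply]
  simp only [wedge_apply, Matrix.mulVec_single_one, Pi.sub_apply, Pi.smul_apply, smul_eq_mul,
    Matrix.col_apply, sub_mul, mul_sub, Finset.sum_sub_distrib]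
  have h4 : ∑ k, v k * v' j.swap * X i k = 0 := by
    rw [← mul_zero (v' j.swap), ← h2, Finset.mul_sum]
    exact Finset.sum_congr rfl fun k _ => by ring
  have h5 : ∑ k, X j.swap k * (v k * v' i) = 0 := by
    rw [← mul_zero (v' i), ← h3, Finset.mul_sum]
    exact Finset.sum_congr rfl fun k _ => by ring
  have h6 : ∑ k : Idx n, (Pi.single k.swap 1 : Idx n → ℝ) j.swap * X i k = X i j := by
    rw [Finset.sum_eq_single j]
    · simp
    · intro k _ hk
      rw [Pi.single_eq_of_ne, zero_mul]
      exact fun h => hk (by simpa using (congrArg Sum.swap h).symm)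
    · simp
  have h7 : ∑ k : Idx n, X j.swap k * (Pi.single k.swap 1 : Idx n → ℝ) i = - X i j := by
    rw [Finset.sum_eq_single i.swap]
    · have := (mem_confAlg_iff X).1 hX i.swap j
      simp only [Sum.swap_swap] at this
      simp [this]
    · intro k _ hk
      rw [Pi.single_eq_of_ne, mul_zero]
      exact fun h => hk (by simpa using (congrArg Sum.swap h).symm)
    · simp
  rw [h4, h5, h6, h7]
  simp
  ring

end ConformalAlgebra

/-! ### Algebraic projective curvature tensors -/

section ProjectiveAlgebra

variable {n : ℕ}

theorem vPlus_mulVec (A : Matrix (Fin (n + 1)) (Fin (n + 1)) ℝ) (i : Fin (n + 1)) :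
    (A *ᵥ vPlus n) i = A i 0 := by
  simp [vPlus]

theorem mem_projAlgP_iff (X : projAlg n) : X ∈ projAlgP n ↔ ∀ i : Fin n, X.1 i.succ 0 = 0 := by
  have h := vPlus_mulVec X.1
  constructor
  · rintro ⟨c, hc⟩ i
    have := congrFun hc i.succ
    rw [h] at this
    simpa [vPlus] using this
  · intro hX
    refine ⟨X.1 0 0, ?_⟩
    ext i
    rw [h]
    refine Fin.cases ?_ (fun i => ?_) i
    · simp [vPlus]
    · simp [vPlus, hX]

/-- The basis `E_{i0}`, `i ≥ 1`, of a complement of `𝔭` in `𝔰𝔩(n+1)`. -/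
def projFrame (n : ℕ) (i : Fin n) : projAlg n :=
  LieAlgebra.SpecialLinear.single i.succ 0 (Fin.succ_ne_zero i) (1 : ℝ)

/-- The basis of `𝔭₊` dual to `projFrame` for the Killing form. -/
def projCoframe (n : ℕ) (i : Fin n) : projAlg n :=
  (1 / (2 * (n + 1)) : ℝ) •
    LieAlgebra.SpecialLinear.single 0 i.succ (Fin.succ_ne_zero i).symm (1 : ℝ)

theorem projFrame_coe (i : Fin n) :
    (projFrame n i : Matrix (Fin (n + 1)) (Fin (n + 1)) ℝ) = Matrix.single i.succ 0 1 := rfl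

theorem projCoframe_coe (i : Fin n) :
    (projCoframe n i : Matrix (Fin (n + 1)) (Fin (n + 1)) ℝ) =
      (1 / (2 * (n + 1)) : ℝ) • Matrix.single 0 i.succ 1 := rfl

theorem killingForm_projCoframe (X : projAlg n) (i : Fin n) :
    killingForm ℝ (projAlg n) X (projCoframe n i) = X.1 i.succ 0 := by
  rw [killingForm_projAlg, projCoframe_coe, Matrix.mul_smul, Matrix.trace_smul,
    Matrix.trace_mul_single]
  have : (n : ℝ) + 1 ≠ 0 := by positivity
  simp
  field_simp

theorem sub_sum_projFrame_mem (X : projAlg n) :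
    X - ∑ i : Fin n, X.1 i.succ 0 • projFrame n i ∈ projAlgP n := by
  rw [mem_projAlgP_iff]
  intro i
  have h1 : ∀ j : Fin n, (X.1 j.succ 0 • projFrame n j).1 i.succ 0 =
      if j = i then X.1 j.succ 0 else 0 := by
    intro j
    change X.1 j.succ 0 * (projFrame n j).1 i.succ 0 = _
    rw [projFrame_coe]
    simp [Matrix.single_apply]
  have h2 : (X - ∑ j : Fin n, X.1 j.succ 0 • projFrame n j).1 i.succ 0 =
      X.1 i.succ 0 - ∑ j : Fin n, (X.1 j.succ 0 • projFrame n j).1 i.succ 0 := by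
    simp [Matrix.sum_apply]
  rw [h2]
  simp only [h1]
  simp

section Tensor

variable {K : projAlg n →ₗ[ℝ] projAlg n →ₗ[ℝ] Matrix (Fin (n + 1)) (Fin (n + 1)) ℝ}

theorem eq_sum_projFrame_left (hK : ∀ X ∈ projAlgP n, ∀ Y, K X Y = 0) (X Y : projAlg n) :
    K X Y = ∑ i : Fin n, X.1 i.succ 0 • K (projFrame n i) Y := by
  have h := hK _ (sub_sum_projFrame_mem X) Y
  rw [map_sub, LinearMap.sub_apply, sub_eq_zero] at h
  rw [h]
  simp [map_sum, LinearMap.sum_apply]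

/-- An entry of a curvature tensor vanishes if it does so on the frame. -/
theorem eq_zero_of_projFrame (hK : ∀ X ∈ projAlgP n, ∀ Y, K X Y = 0)
    (hs : ∀ X Y, K Y X = - K X Y) (a b : Fin (n + 1))
    (h : ∀ i j, K (projFrame n i) (projFrame n j) a b = 0) (X Y : projAlg n) : K X Y a b = 0 := by
  rw [eq_sum_projFrame_left hK X Y, Matrix.sum_apply]
  refine Finset.sum_eq_zero fun i _ => ?_
  rw [Matrix.smul_apply, hs, eq_sum_projFrame_left hK Y, Matrix.neg_apply, Matrix.sum_apply]
  rw [Finset.sum_eq_zero fun j _ => ?_, neg_zero, smul_zero]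
  rw [Matrix.smul_apply, h, smul_zero]

/-- A tensor antisymmetric in two of its arguments and symmetric in another pair vanishes. -/
theorem eq_zero_of_antisymm_of_symm {τ : Type*} {V : τ → τ → τ → ℝ}
    (h1 : ∀ p j q, V j p q = - V p j q) (h2 : ∀ p j q, V q j p = V p j q) (p j q : τ) :
    V p j q = 0 := by
  have a1 := h2 p j q
  have a2 := h1 q j p
  have a3 := h2 p q j
  have a4 := h1 p q j
  have a5 := h2 q p j
  have a6 := h1 p j q
  linarith

/-- The symmetry condition forced on a normal projective curvature by normality of the induced
conformal connection, paired with a covector `c` that annihilates `v₊`. -/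
def IsSymmAlong (K : projAlg n →ₗ[ℝ] projAlg n →ₗ[ℝ] Matrix (Fin (n + 1)) (Fin (n + 1)) ℝ)
    (c : Fin (n + 1) → ℝ) : Prop :=
  ∀ X Y B : projAlg n,
    c ⬝ᵥ (K X B *ᵥ (Y.1 *ᵥ vPlus n)) + (c ⬝ᵥ (Y.1 *ᵥ vPlus n)) * K X B 0 0 =
      c ⬝ᵥ (K Y B *ᵥ (X.1 *ᵥ vPlus n)) + (c ⬝ᵥ (X.1 *ᵥ vPlus n)) * K Y B 0 0

theorem IsSymmAlong.sub {c c' : Fin (n + 1) → ℝ} (h : IsSymmAlong K c) (h' : IsSymmAlong K c') :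
    IsSymmAlong K (c - c') := by
  intro X Y B
  have := h X Y B
  have := h' X Y B
  simp only [sub_dotProduct]
  linarith

theorem projFrame_mulVec (i : Fin n) :
    (projFrame n i).1 *ᵥ vPlus n = Pi.single i.succ 1 := by
  rw [projFrame_coe, vPlus]
  ext k
  simp [Matrix.single_apply, Pi.single_apply, eq_comm]

/-- If the symmetry condition holds in all directions, then a torsion-free trace-free projective
curvature takes values in `𝔭₊`. -/
theorem apply_succ_eq_zero_of_isSymmAlong (hn : n ≠ 1) (hK : ∀ X ∈ projAlgP n, ∀ Y, K X Y = 0)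
    (hs : ∀ X Y, K Y X = - K X Y) (htor : ∀ X Y (i : Fin n), K X Y i.succ 0 = 0)
    (htr : ∀ X Y, (K X Y).trace = 0)
    (hsym : ∀ m : Fin n, IsSymmAlong K (Pi.single m.succ 1)) (X Y : projAlg n) (m : Fin n)
    (b : Fin (n + 1)) : K X Y m.succ b = 0 := by
  -- antisymmetric in `p`, `j` and symmetric in `p`, `q`
  have hV : ∀ m p j q : Fin n, K (projFrame n p) (projFrame n j) m.succ q.succ +
      (if m = q then 1 else 0) * K (projFrame n p) (projFrame n j) 0 0 = 0 := by
    intro m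
    refine eq_zero_of_antisymm_of_symm (V := fun p j q =>
      K (projFrame n p) (projFrame n j) m.succ q.succ +
      (if m = q then 1 else 0) * K (projFrame n p) (projFrame n j) 0 0) ?_ ?_
    · intro p j q
      rw [hs (projFrame n p) (projFrame n j), Matrix.neg_apply, Matrix.neg_apply]
      ring
    · intro p j q
      have := hsym m (projFrame n p) (projFrame n q) (projFrame n j)
      simp only [projFrame_mulVec, Matrix.mulVec_single_one, single_one_dotProduct,
        Matrix.col_apply, Pi.single_apply, Fin.succ_inj] at this
      exact this.symm
  -- by `hV`, the trace of the curvature is `1 - n` times its upper left entry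
  have h00 : ∀ p j, K (projFrame n p) (projFrame n j) 0 0 = 0 := by
    intro p j
    have h1 := htr (projFrame n p) (projFrame n j)
    rw [Matrix.trace, Fin.sum_univ_succ] at h1
    have h2 : ∀ q : Fin n, (K (projFrame n p) (projFrame n j)).diag q.succ =
        - K (projFrame n p) (projFrame n j) 0 0 := by
      intro q
      have := hV q p j q
      simp only [if_true, one_mul] at this
      exact eq_neg_of_add_eq_zero_left this
    simp only [h2, Finset.sum_const, Finset.card_univ, Fintype.card_fin, Matrix.diag_apply,
      nsmul_eq_mul] at h1
    have h3 : ((n : ℝ) - 1) ≠ 0 := by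
      rw [sub_ne_zero]; exact_mod_cast hn
    have h4 : ((n : ℝ) - 1) * K (projFrame n p) (projFrame n j) 0 0 = 0 := by linarith
    exact (mul_eq_zero.1 h4).resolve_left h3
  refine eq_zero_of_projFrame hK hs _ _ (fun p j => ?_) X Y
  refine Fin.cases (htor _ _ m) (fun q => ?_) b
  have := hV m p j q
  rwa [h00, mul_zero, add_zero] at this

end Tensor

end ProjectiveAlgebra

/-! ### Normal projective Cartan connections -/

section ProjectiveGeometry

variable {n : ℕ} {E : Type*} [NormedAddCommGroup E] [NormedSpace ℝ E] [FiniteDimensional ℝ E]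
  {G : Type*} [TopologicalSpace G] [ChartedSpace E G] [IsManifold 𝓘(ℝ, E) ∞ G]
  {F : Type*} [NormedAddCommGroup F] [NormedSpace ℝ F]
  {M : Type*} [TopologicalSpace M] [ChartedSpace F M]
  {act : G → projP n → G} {π : G → M}
  {θ : ∀ u : G, TangentSpace 𝓘(ℝ, E) u →ₗ[ℝ] Matrix (Fin (n + 1)) (Fin (n + 1)) ℝ}

/-- The projective curvature descends to `𝔤/𝔭`. -/
theorem curvatureForm_eq_zero_of_mem_projAlgP
    (hG : IsPrincipalBundle (E := E) (F := F) (projRep n) act π)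
    (hθ : IsCartanConnection (projRep n) (projRep n) (projAlg n) act θ) (u : G) (X : projAlg n)
    (hX : X ∈ projAlgP n) (Y : projAlg n) : curvatureForm hθ u X Y = 0 := by
  obtain ⟨a, ha⟩ := hX
  obtain ⟨ε, hε, c, hc, hc0, hd⟩ := exists_curve_projP (A := X.1) X.2 ha
  have h1 : curvatureForm hθ u (ε • X) Y = 0 := by
    rw [curvatureForm_apply, curvatureFunction]
    refine hθ.curvature_eq_zero_of_velocity hG hc hc0 hd u ?_ _
    exact hθ.apply_invFun u (ε • X).2
  rw [map_smul, LinearMap.smul_apply] at h1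
  exact (smul_eq_zero.1 h1).resolve_left hε

theorem lie_single_apply (A : Matrix (Fin (n + 1)) (Fin (n + 1)) ℝ) (s a b : Fin (n + 1)) :
    ⁅A, Matrix.single 0 s (1 : ℝ)⁆ a b =
      (if s = b then A a 0 else 0) - (if a = 0 then A s b else 0) := by
  rw [Ring.lie_def, Matrix.sub_apply, Matrix.mul_apply, Matrix.mul_apply]
  congr 1
  · simp [Matrix.single_apply, ite_and, eq_comm]
  · simp [Matrix.single_apply, ite_and, eq_comm]

/-- For a projective Cartan connection the second sum in the codifferential vanishes. -/
theorem IsNormal.sum_lie_projFrame_eq_zero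
    (hG : IsPrincipalBundle (E := E) (F := F) (projRep n) act π)
    (hθ : IsCartanConnection (projRep n) (projRep n) (projAlg n) act θ)
    (hN : IsNormal (projAlgP n) θ) (u : G) (X : projAlg n) :
    ∑ i : Fin n, ⁅curvatureForm hθ u (projFrame n i) X,
      (Matrix.single 0 i.succ 1 : Matrix (Fin (n + 1)) (Fin (n + 1)) ℝ)⁆ = 0 := by
  have h := hN.sum_eq_zero hθ (projFrame n) (projCoframe n)
    (fun i X hX => by rw [killingForm_projCoframe, (mem_projAlgP_iff X).1 hX])
    (fun i j => by
      rw [killingForm_projCoframe, projFrame_coe]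
      simp [Matrix.single_apply])
    (fun X => ⟨_, sub_sum_projFrame_mem X⟩) u X
  rw [Finset.sum_eq_zero (s := Finset.univ) (f := fun i =>
    curvatureForm hθ u (projFrame n i) ⁅projCoframe n i, X⁆), add_zero] at h
  · have h2 : (2 : ℝ) * (1 / (2 * (n + 1))) ≠ 0 := by positivity
    refine (smul_eq_zero.1 ?_).resolve_left h2
    rw [← h, mul_smul, Finset.smul_sum]
    congr 1
    refine Finset.sum_congr rfl fun i _ => ?_
    rw [projCoframe_coe, Ring.lie_def, Ring.lie_def, Matrix.mul_smul, Matrix.smul_mul, smul_sub]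
  · intro i _
    refine curvatureForm_right_eq_zero hθ u
      (curvatureForm_eq_zero_of_mem_projAlgP hG hθ u _ ?_) _
    rw [mem_projAlgP_iff]
    intro j
    rw [LieSubalgebra.coe_bracket, projCoframe_coe, Ring.lie_def, Matrix.sub_apply,
      Matrix.mul_apply, Matrix.mul_apply]
    simp [(Fin.succ_ne_zero _).symm]

/-- A normal projective Cartan connection is torsion-free. -/
theorem IsNormal.torsion_eq_zero
    (hG : IsPrincipalBundle (E := E) (F := F) (projRep n) act π)
    (hθ : IsCartanConnection (projRep n) (projRep n) (projAlg n) act θ)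
    (hN : IsNormal (projAlgP n) θ) (u : G) (X Y : projAlg n) (i : Fin n) :
    curvatureForm hθ u X Y i.succ 0 = 0 := by
  refine eq_zero_of_projFrame (curvatureForm_eq_zero_of_mem_projAlgP hG hθ u)
    (curvatureForm_swap hθ u) _ _ (fun p q => ?_) X Y
  have h := congrFun₂ (hN.sum_lie_projFrame_eq_zero hG hθ u (projFrame n q)) i.succ p.succ
  rw [Matrix.sum_apply] at h
  simpa [lie_single_apply] using h

/-- For a normal projective Cartan connection, the Ricci-type contraction of the curvature is given
by its upper left entry. -/
theorem IsNormal.sum_apply_succ_succ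
    (hG : IsPrincipalBundle (E := E) (F := F) (projRep n) act π)
    (hθ : IsCartanConnection (projRep n) (projRep n) (projAlg n) act θ)
    (hN : IsNormal (projAlgP n) θ) (u : G) (X : projAlg n) (j : Fin n) :
    ∑ i : Fin n, curvatureForm hθ u (projFrame n i) X i.succ j.succ =
      curvatureForm hθ u (projFrame n j) X 0 0 := by
  have h := congrFun₂ (hN.sum_lie_projFrame_eq_zero hG hθ u X) 0 j.succ
  rw [Matrix.sum_apply] at h
  simp [lie_single_apply] at h
  linarith

theorem curvatureForm_act
    (hG : IsPrincipalBundle (E := E) (F := F) (projRep n) act π)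
    (hθ : IsCartanConnection (projRep n) (projRep n) (projAlg n) act θ) (u : G) (h : projP n)
    {X Y X' Y' : projAlg n} (hX : X'.1 = projRep n h⁻¹ * X.1 * projRep n h)
    (hY : Y'.1 = projRep n h⁻¹ * Y.1 * projRep n h) :
    curvatureForm hθ (act u h) X' Y' =
      projRep n h⁻¹ * curvatureForm hθ u X Y * projRep n h := by
  have key : ∀ {X X' : projAlg n}, X'.1 = projRep n h⁻¹ * X.1 * projRep n h →
      θ (act u h) (mfderiv 𝓘(ℝ, E) 𝓘(ℝ, E) (fun u' => act u' h) u
        (Function.invFun (θ u) X.1)) = X' := by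
    intro X X' hX
    rw [hθ.equivariant, hθ.apply_invFun u X.2, hX]
  rw [curvatureForm_of_eq hθ (act u h) (key hX) (key hY), hθ.curvature_act hG]
  rfl

/-- The symmetry condition transforms equivariantly under the elements of `P` that fix `v₊`. -/
theorem IsSymmAlong.of_act
    (hG : IsPrincipalBundle (E := E) (F := F) (projRep n) act π)
    (hθ : IsCartanConnection (projRep n) (projRep n) (projAlg n) act θ)
    (htor : ∀ u X Y (i : Fin n), curvatureForm hθ u X Y i.succ 0 = 0) (u : G) (h : projP n)
    (hh : projRep n h *ᵥ vPlus n = vPlus n) {c : Fin (n + 1) → ℝ}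
    (hc : IsSymmAlong (curvatureForm hθ (act u h)) c) :
    IsSymmAlong (curvatureForm hθ u) (c ᵥ* projRep n h⁻¹) := by
  intro X Y B
  have hh' : projRep n h⁻¹ *ᵥ vPlus n = vPlus n := by
    conv_lhs => rw [← hh]
    rw [Matrix.mulVec_mulVec, rep_inv_mul, Matrix.one_mulVec]
  have hmem : ∀ X : projAlg n, ∃ X' : projAlg n,
      X'.1 = projRep n h⁻¹ * X.1 * projRep n h := by
    intro X
    refine ⟨⟨projRep n h⁻¹ * X.1 * projRep n h, ?_⟩, rfl⟩
    have hX : X.1.trace = 0 := X.2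
    change (projRep n h⁻¹ * X.1 * projRep n h).trace = 0
    rw [Matrix.trace_mul_comm, ← mul_assoc, rep_mul_inv, one_mul, hX]
  obtain ⟨X', hX'⟩ := hmem X
  obtain ⟨Y', hY'⟩ := hmem Y
  obtain ⟨B', hB'⟩ := hmem B
  have hcol : ∀ X Y, curvatureForm hθ u X Y *ᵥ vPlus n =
      curvatureForm hθ u X Y 0 0 • vPlus n := by
    intro X Y
    ext i
    rw [vPlus_mulVec]
    refine Fin.cases ?_ (fun i => ?_) i
    · simp [vPlus]
    · simp [vPlus, htor]
  have h00 : ∀ (X Y : projAlg n), (projRep n h⁻¹ * curvatureForm hθ u X Y * projRep n h) 0 0 =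
      curvatureForm hθ u X Y 0 0 := by
    intro X Y
    rw [← vPlus_mulVec (_ * _ * _), ← Matrix.mulVec_mulVec, hh, ← Matrix.mulVec_mulVec, hcol,
      Matrix.mulVec_smul, hh']
    simp [vPlus]
  have hv : ∀ {X X' : projAlg n}, X'.1 = projRep n h⁻¹ * X.1 * projRep n h →
      X'.1 *ᵥ vPlus n = projRep n h⁻¹ *ᵥ (X.1 *ᵥ vPlus n) := by
    intro X X' hX
    rw [hX, ← Matrix.mulVec_mulVec, hh, ← Matrix.mulVec_mulVec]
  have hk : ∀ (A : Matrix (Fin (n + 1)) (Fin (n + 1)) ℝ) (w : Fin (n + 1) → ℝ),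
      (projRep n h⁻¹ * A * projRep n h) *ᵥ (projRep n h⁻¹ *ᵥ w) =
        projRep n h⁻¹ *ᵥ (A *ᵥ w) := by
    intro A w
    rw [Matrix.mulVec_mulVec, mul_assoc, rep_mul_inv, mul_one, Matrix.mulVec_mulVec]
  have := hc X' Y' B'
  rw [curvatureForm_act hG hθ u h hX' hB', curvatureForm_act hG hθ u h hY' hB', h00, h00,
    hv hX', hv hY', hk, hk] at this
  simpa only [Matrix.dotProduct_mulVec] using this

/-- By equivariance, the symmetry condition along the last coordinate propagates to all
coordinates: transvections move the last coordinate covector. -/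
theorem isSymmAlong_of_last (hn : 2 < n)
    (hG : IsPrincipalBundle (E := E) (F := F) (projRep n) act π)
    (hθ : IsCartanConnection (projRep n) (projRep n) (projAlg n) act θ)
    (htor : ∀ u X Y (i : Fin n), curvatureForm hθ u X Y i.succ 0 = 0)
    (hlast : ∀ u, IsSymmAlong (curvatureForm hθ u) (Pi.single (Fin.last n) 1)) (u : G)
    (m : Fin n) : IsSymmAlong (curvatureForm hθ u) (Pi.single m.succ 1) := by
  by_cases hm : m.succ = Fin.last n
  · rw [hm]; exact hlast u
  have h0 : (Fin.last n) ≠ 0 := by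
    rw [← Fin.pos_iff_ne_zero]; exact Fin.lt_def.2 (by simp; omega)
  have hinv : Matrix.transvection (Fin.last n) m.succ (1 : ℝ) *
      Matrix.transvection (Fin.last n) m.succ (-1) = 1 := by
    rw [Matrix.transvection_mul_transvection_same _ _ (Ne.symm hm)]
    simp
  -- the inverse of `g = 1 - E_{last, m}` maps the last coordinate covector to its sum with the
  -- coordinate covector of `m`
  let g : Matrix.SpecialLinearGroup (Fin (n + 1)) ℝ :=
    ⟨Matrix.transvection (Fin.last n) m.succ (-1),
      Matrix.det_transvection_of_ne _ _ (Ne.symm hm) _⟩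
  have hg : slRep n g *ᵥ vPlus n = vPlus n := by
    change Matrix.transvection (Fin.last n) m.succ (-1) *ᵥ vPlus n = vPlus n
    ext i
    rw [vPlus_mulVec, Matrix.transvection]
    simp [vPlus, Matrix.one_apply, Pi.single_apply]
  let h : projP n := ⟨g, 1, one_pos, by rw [hg, one_smul]⟩
  have hrep : projRep n h = Matrix.transvection (Fin.last n) m.succ (-1) := rfl
  have hrep' : projRep n h⁻¹ = Matrix.transvection (Fin.last n) m.succ 1 := by
    calc projRep n h⁻¹ = (Matrix.transvection (Fin.last n) m.succ (1 : ℝ) * projRep n h) *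
          projRep n h⁻¹ := by rw [hrep, hinv, one_mul]
      _ = _ := by rw [mul_assoc, rep_mul_inv, mul_one]
  have h1 := IsSymmAlong.of_act hG hθ htor u h hg (hlast (act u h))
  have h2 := h1.sub (hlast u)
  rw [hrep'] at h2
  convert h2 using 1
  ext k
  rw [Matrix.transvection, Matrix.vecMul_add, Matrix.vecMul_one]
  simp [Matrix.single_apply, Pi.single_apply, eq_comm]

/-- In dimension at least three, a torsion-free projective Cartan connection with curvature in
`𝔭₊` is flat, by the Bianchi identity. -/
theorem isFlat_of_apply_succ_eq_zero (hn : 2 < n)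
    (hG : IsPrincipalBundle (E := E) (F := F) (projRep n) act π)
    (hθ : IsCartanConnection (projRep n) (projRep n) (projAlg n) act θ)
    (hK : ∀ u X Y (m : Fin n) b, curvatureForm hθ u X Y m.succ b = 0) : IsFlat θ := by
  have hK' : ∀ u v w (m : Fin n) b, curvature θ u v w m.succ b = 0 := by
    intro u v w m b
    rw [← curvatureForm_of_eq hθ u (A := ⟨θ u v, hθ.apply_mem u v⟩)
      (A' := ⟨θ u w, hθ.apply_mem u w⟩) rfl rfl]
    exact hK _ _ _ _ _
  refine IsFlat.of_curvatureForm hθ fun u X Y => ?_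
  ext a b
  refine eq_zero_of_projFrame (curvatureForm_eq_zero_of_mem_projAlgP hG hθ u)
    (curvatureForm_swap hθ u) _ _ (fun p j => ?_) X Y
  refine Fin.cases ?_ (fun m => hK _ _ _ m b) a
  obtain ⟨k, hkp, hkj⟩ : ∃ k : Fin n, k ≠ p ∧ k ≠ j := by
    obtain ⟨k, hk⟩ := Finset.exists_mem_notMem_of_card_lt_card (s := {p, j})
      (t := (Finset.univ : Finset (Fin n)))
      (lt_of_le_of_lt Finset.card_le_two (by simpa using hn))
    exact ⟨k, by aesop⟩
  obtain ⟨Φ, hΦ, hΦ0, hd⟩ := exists_contMDiff_mfderiv_eq u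
    (fun i : Fin 3 => Function.invFun (θ u) ((![projFrame n p, projFrame n j, projFrame n k] i :
      projAlg n) : Matrix (Fin (n + 1)) (Fin (n + 1)) ℝ))
  subst hΦ0
  set α := pullForm θ Φ with hα
  have hval : ∀ i : Fin 3, α (EuclideanSpace.single i 1) 0 =
      (![projFrame n p, projFrame n j, projFrame n k] i : projAlg n) := by
    intro i
    refine Eq.trans (congrArg (θ (Φ 0)) (hd i)) ?_
    exact hθ.apply_invFun _ (Subtype.prop _)
  have hrow : ∀ v w q (m : Fin n) b, formCurvature α v w q m.succ b = 0 := by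
    intro v w q m b
    rw [hα, ← curvature_pullback hθ.smooth hΦ]
    exact hK' _ _ _ _ _
  have hder : ∀ v w z (m : Fin n) b, matDeriv (formCurvature α v w) 0 z m.succ b = 0 := by
    intro v w z m b
    rw [matDeriv_apply]
    simp [hrow]
  have hb := congrFun₂ (formCurvature_bianchi (contDiff_pullForm hθ.smooth hΦ)
    (EuclideanSpace.single 0 1) (EuclideanSpace.single 1 1) (EuclideanSpace.single 2 1) 0) k.succ b
  have e0 : α (EuclideanSpace.single 0 1) 0 = Matrix.single p.succ 0 1 := hval 0
  have e1 : α (EuclideanSpace.single 1 1) 0 = Matrix.single j.succ 0 1 := hval 1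
  have e2 : α (EuclideanSpace.single 2 1) 0 = Matrix.single k.succ 0 1 := hval 2
  have hFl : ∀ v w (A : Matrix (Fin (n + 1)) (Fin (n + 1)) ℝ),
      (formCurvature α v w 0 * A) k.succ b = 0 := by
    intro v w A
    rw [Matrix.mul_apply]
    exact Finset.sum_eq_zero fun l _ => by rw [hrow, zero_mul]
  rw [← hα] at hb
  simp only [Matrix.add_apply, Matrix.sub_apply, hder, e0, e1, e2, hFl] at hb
  have hne : ∀ q : Fin n, k ≠ q → ∀ N : Matrix (Fin (n + 1)) (Fin (n + 1)) ℝ,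
      (Matrix.single q.succ 0 (1 : ℝ) * N : Matrix (Fin (n + 1)) (Fin (n + 1)) ℝ) k.succ b = 0 := by
    intro q hq N
    exact Matrix.single_mul_apply_of_ne _ _ _ _ _ (by simpa using hq) _
  -- in row `k` of the Bianchi identity only the product with `E_{k0}` survives
  rw [hne p hkp, hne j hkj, Matrix.single_mul_apply_same] at hb
  have hfin : formCurvature α (EuclideanSpace.single 0 1) (EuclideanSpace.single 1 1) 0 0 b = 0 := by
    linarith
  rw [hα, ← curvature_pullback hθ.smooth hΦ, ← curvatureForm_of_eq hθ (Φ 0) (hval 0) (hval 1)]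
    at hfin
  exact hfin

/-- A normal projective Cartan connection whose curvature satisfies the symmetry condition along
the last coordinate is flat. -/
theorem IsNormal.isFlat_of_isSymmAlong_last (hn : 2 < n)
    (hG : IsPrincipalBundle (E := E) (F := F) (projRep n) act π)
    (hθ : IsCartanConnection (projRep n) (projRep n) (projAlg n) act θ)
    (hN : IsNormal (projAlgP n) θ)
    (hlast : ∀ u, IsSymmAlong (curvatureForm hθ u) (Pi.single (Fin.last n) 1)) : IsFlat θ := by
  have htor := hN.torsion_eq_zero hG hθ
  refine isFlat_of_apply_succ_eq_zero hn hG hθ fun u => ?_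
  refine apply_succ_eq_zero_of_isSymmAlong (by omega)
    (curvatureForm_eq_zero_of_mem_projAlgP hG hθ u) (curvatureForm_swap hθ u) (htor u) ?_
    (isSymmAlong_of_last hn hG hθ htor hlast u)
  intro X Y
  exact trace_curvature hθ.smooth (fun u v => hθ.apply_mem u v) u _ _

end ProjectiveGeometry

/-! ### A dual frame for the conformal parabolic -/

section ConformalFrame

variable {n : ℕ}

/-- The bivector `x ∧ y`, as an element of `𝔰𝔬(n+1, n+1)`. -/
def wedgeAlg (x y : Idx n → ℝ) : confAlg n := ⟨wedge x y, wedge_mem x y⟩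

theorem hForm_vTilde (x : Idx n → ℝ) :
    hForm n x (vTilde n) = x (Sum.inl (Fin.last n)) + x (Sum.inr 0) := by
  rw [hForm_apply]
  simp [vTilde, Finset.sum_add_distrib, Pi.single_apply]

theorem vTilde_inl_succ (i : Fin n) : vTilde n (Sum.inl i.succ) = 0 := by
  simp [vTilde]

theorem vTilde_inr_zero (hn : n ≠ 0) : vTilde n (Sum.inr 0) = 0 := by
  have : (0 : Fin (n + 1)) ≠ Fin.last n := by
    intro h
    exact hn (by simpa using (congrArg Fin.val h).symm)
  simp [vTilde, this]

theorem hForm_vTilde_self (hn : n ≠ 0) : hForm n (vTilde n) (vTilde n) = 0 := by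
  rw [hForm_vTilde, vTilde_inr_zero hn]
  obtain ⟨k, rfl⟩ := Nat.exists_eq_succ_of_ne_zero hn
  rw [← Fin.succ_last, vTilde_inl_succ, add_zero]

theorem hForm_mulVec_vTilde (X : confAlg n) :
    hForm n (X.1 *ᵥ vTilde n) (vTilde n) = 0 := by
  have := hForm_mulVec_left X.2 (vTilde n) (vTilde n)
  rw [hForm_comm (vTilde n)] at this
  linarith

theorem mulVec_vTilde_sub (X Y : confAlg n) :
    (X - Y).1 *ᵥ vTilde n = X.1 *ᵥ vTilde n - Y.1 *ᵥ vTilde n :=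
  Matrix.sub_mulVec _ _ _

/-- A basis of `ṽ₊^⊥` modulo `ṽ₊`, with `h(wₛ, wₜ) = 1` if `t` is the opposite index of `s`, and
`h(wₛ, wₜ) = 0` otherwise. -/
def confBasis (n : ℕ) : Fin n ⊕ Fin n → Idx n → ℝ :=
  Sum.elim
    (fun j => Pi.single (Sum.inl j.succ) 1 -
      vTilde n (Sum.inr j.succ) • Pi.single (Sum.inr 0) 1)
    (fun j => Pi.single (Sum.inr j.succ) 1)

theorem hForm_confBasis_inl (y : Idx n → ℝ) (j : Fin n) :
    hForm n y (confBasis n (Sum.inl j)) =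
      y (Sum.inr j.succ) - vTilde n (Sum.inr j.succ) * y (Sum.inl 0) := by
  simp only [confBasis, Sum.elim_inl, map_sub, map_smul, hForm_single_right, Sum.swap_inl,
    Sum.swap_inr, smul_eq_mul]

theorem hForm_confBasis_inr (y : Idx n → ℝ) (j : Fin n) :
    hForm n y (confBasis n (Sum.inr j)) = y (Sum.inl j.succ) := by
  simp only [confBasis, Sum.elim_inr, hForm_single_right, Sum.swap_inr]

theorem hForm_vTilde_confBasis (s : Fin n ⊕ Fin n) :
    hForm n (vTilde n) (confBasis n s) = 0 := by
  rcases s with j | j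
  · rw [hForm_confBasis_inl]
    simp [vTilde]
  · rw [hForm_confBasis_inr, vTilde_inl_succ]

theorem hForm_confBasis_swap (s t : Fin n ⊕ Fin n) :
    hForm n (confBasis n s) (confBasis n t.swap) = if s = t then 1 else 0 := by
  rcases t with j | j
  · rw [Sum.swap_inl, hForm_confBasis_inr]
    rcases s with i | i <;> simp [confBasis, Pi.single_apply, eq_comm]
  · rw [Sum.swap_inr, hForm_confBasis_inl]
    rcases s with i | i <;> simp [confBasis, Pi.single_apply, eq_comm]

theorem sub_sum_confBasis (hn : n ≠ 0) (y : Idx n → ℝ) (hy : hForm n y (vTilde n) = 0) :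
    y - ∑ s, hForm n y (confBasis n s.swap) • confBasis n s = y (Sum.inl 0) • vTilde n := by
  rw [hForm_vTilde] at hy
  obtain ⟨k, rfl⟩ := Nat.exists_eq_succ_of_ne_zero hn
  ext i
  rw [Fintype.sum_sum_type]
  simp only [Sum.swap_inl, Sum.swap_inr, hForm_confBasis_inl, hForm_confBasis_inr]
  simp only [Pi.sub_apply, Pi.add_apply, Finset.sum_apply, Pi.smul_apply, smul_eq_mul, confBasis,
    Sum.elim_inl, Sum.elim_inr]
  rcases i with i | i <;> refine Fin.cases ?_ (fun i => ?_) i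
  · simp [vTilde]
  · simp [vTilde, Pi.single_apply]
  · simp [vTilde, Pi.single_apply, -Fin.succ_last]
    rw [Fin.succ_last]
    linarith
  · simp [vTilde, Pi.single_apply]

/-- The elements `wₛ ∧ f₀`, which form a basis of a complement of `𝔭̃` in `𝔰𝔬(n+1, n+1)`. -/
def confFrame (n : ℕ) (s : Fin n ⊕ Fin n) : confAlg n :=
  wedgeAlg (confBasis n s) (Pi.single (Sum.inr 0) 1)

/-- The basis of `𝔭̃₊` dual to `confFrame` for the Killing form. -/
def confCoframe (n : ℕ) (s : Fin n ⊕ Fin n) : confAlg n :=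
  (1 / (4 * n) : ℝ) • wedgeAlg (vTilde n) (confBasis n s.swap)

theorem confFrame_mulVec (s : Fin n ⊕ Fin n) :
    (confFrame n s).1 *ᵥ vTilde n = confBasis n s := by
  rw [confFrame, wedgeAlg, wedge_mulVec, hForm_comm _ (vTilde n), hForm_comm _ (vTilde n),
    hForm_vTilde_confBasis, hForm_single_right]
  simp [vTilde]

theorem killingForm_confCoframe (hn : n ≠ 0) (X : confAlg n) (s : Fin n ⊕ Fin n) :
    killingForm ℝ (confAlg n) X (confCoframe n s) =
      hForm n (confBasis n s.swap) (X.1 *ᵥ vTilde n) := by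
  have h : X.1 * (confCoframe n s).1 =
      (1 / (4 * n) : ℝ) • (X.1 * wedge (vTilde n) (confBasis n s.swap)) := Matrix.mul_smul _ _ _
  rw [killingForm_confAlg, h, Matrix.trace_smul, trace_mul_wedge X.2]
  have : (n : ℝ) ≠ 0 := by exact_mod_cast hn
  rw [smul_eq_mul]
  field_simp
  norm_num

theorem sub_sum_confFrame_mem (hn : n ≠ 0) (X : confAlg n) :
    X - ∑ s, hForm n (X.1 *ᵥ vTilde n) (confBasis n s.swap) • confFrame n s ∈ confAlgP n := by
  refine ⟨(X.1 *ᵥ vTilde n) (Sum.inl 0), ?_⟩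
  rw [← sub_sum_confBasis hn _ (hForm_mulVec_vTilde X)]
  refine (mulVec_vTilde_sub _ _).trans (congrArg _ ?_)
  rw [AddSubmonoidClass.coe_finsetSum, Matrix.sum_mulVec]
  refine Finset.sum_congr rfl fun s _ => ?_
  refine (Matrix.smul_mulVec _ _ _).trans ?_
  rw [confFrame_mulVec]

/-- Brackets with `𝔭̃₊` lie in `𝔭̃`, so that they contribute nothing to the codifferential once
the curvature is horizontal. -/
theorem lie_confCoframe_mulVec (hn : n ≠ 0) (X : confAlg n) (s : Fin n ⊕ Fin n) :
    ∃ c : ℝ, (⁅confCoframe n s, X⁆ : confAlg n).1 *ᵥ vTilde n = c • vTilde n := by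
  have h : ∀ w, (confCoframe n s).1 *ᵥ w =
      (1 / (4 * n) : ℝ) • (wedge (vTilde n) (confBasis n s.swap) *ᵥ w) :=
    fun w => Matrix.smul_mulVec _ _ _
  refine ⟨(1 / (4 * n) : ℝ) * hForm n (confBasis n s.swap) (X.1 *ᵥ vTilde n), ?_⟩
  rw [LieSubalgebra.coe_bracket, Ring.lie_def, Matrix.sub_mulVec, ← Matrix.mulVec_mulVec,
    ← Matrix.mulVec_mulVec, h, h, wedge_mulVec, wedge_mulVec, hForm_comm (vTilde n) (X.1 *ᵥ _),
    hForm_mulVec_vTilde, hForm_vTilde_self hn, hForm_comm _ (vTilde n), hForm_vTilde_confBasis]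
  simp [mul_smul]

end ConformalFrame

/-! ### Horizontality of the conformal curvature -/

section ConformalGeometry

variable {n : ℕ} {E : Type*} [NormedAddCommGroup E] [NormedSpace ℝ E] [FiniteDimensional ℝ E]
  {B : Type*} [TopologicalSpace B] [ChartedSpace E B] [IsManifold 𝓘(ℝ, E) ∞ B]
  {F : Type*} [NormedAddCommGroup F] [NormedSpace ℝ F]
  {X : Type*} [TopologicalSpace X] [ChartedSpace F X]
  {act : B → confP n → B} {π : B → X}
  {θ : ∀ u : B, TangentSpace 𝓘(ℝ, E) u →ₗ[ℝ] Matrix (Idx n) (Idx n) ℝ}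

/-- A bivector `b ∧ a` orthogonal to `ṽ₊`, with `a` not null, is tangent to a curve in `P̃`, so
that the curvature vanishes on it. -/
theorem curvatureForm_wedgeAlg_eq_zero_of_ne
    (hB : IsPrincipalBundle (E := E) (F := F) (confEmb n) act π)
    (hθ : IsCartanConnection (confEmb n) (confRep n) (confAlg n) act θ) (u : B)
    {a b : Idx n → ℝ} (hav : hForm n a (vTilde n) = 0) (hbv : hForm n b (vTilde n) = 0)
    (ha : hForm n a a ≠ 0) (Y : confAlg n) : curvatureForm hθ u (wedgeAlg b a) Y = 0 := by
  -- replace `b` by a small multiple of its component orthogonal to `a`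
  set b' := b + (-(hForm n a b / hForm n a a)) • a with hb'
  have hab' : hForm n a b' = 0 := by
    rw [hb', map_add, map_smul, smul_eq_mul]
    field_simp
    ring
  have hbv' : hForm n b' (vTilde n) = 0 := by
    rw [hb', map_add, map_smul, LinearMap.add_apply, LinearMap.smul_apply, hbv, hav]
    simp
  set D := |hForm n a a| + |hForm n b' b'| with hD
  have hpos : 0 < |hForm n a a| := abs_pos.2 ha
  have hD0 : 0 < D := by positivity
  set s := |hForm n a a| / (2 * D) with hs
  have hs0 : 0 < s := by positivity
  have hs1 : s ≤ 1 := by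
    rw [hs, div_le_one (by positivity)]
    have := abs_nonneg (hForm n b' b')
    linarith
  have hlt : |hForm n (s • b') (s • b')| < |hForm n a a| := by
    rw [map_smul, map_smul, LinearMap.smul_apply, smul_eq_mul, smul_eq_mul, abs_mul, abs_mul,
      abs_of_pos hs0]
    have h1 : s * |hForm n b' b'| ≤ s * D := by
      refine mul_le_mul_of_nonneg_left ?_ hs0.le
      linarith
    have h2 : s * D = |hForm n a a| / 2 := by
      rw [hs]
      field_simp
    have h3 : s * (s * |hForm n b' b'|) ≤ 1 * (s * |hForm n b' b'|) :=
      mul_le_mul_of_nonneg_right hs1 (by positivity)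
    linarith
  obtain ⟨c, hc, hc0, hd⟩ := exists_curve_confP (a := a) (b := s • b')
    (by rw [map_smul, hab', smul_zero]) hav
    (by rw [map_smul, LinearMap.smul_apply, hbv', smul_zero]) ha hlt
  have h1 : curvatureForm hθ u ((2 / hForm n a a) • wedgeAlg (s • b') a) Y = 0 := by
    rw [curvatureForm_apply, curvatureFunction]
    refine hθ.curvature_eq_zero_of_velocity hB hc hc0 hd u ?_ _
    exact hθ.apply_invFun u ((2 / hForm n a a) • wedgeAlg (s • b') a).2
  have h2 : wedgeAlg (s • b') a = s • wedgeAlg b a := by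
    apply Subtype.ext
    change wedge (s • b') a = s • wedge b a
    rw [wedge_smul_left, hb', wedge_add_smul_left, wedge_self, smul_zero, add_zero]
  rw [h2, smul_smul, map_smul, LinearMap.smul_apply] at h1
  exact (smul_eq_zero.1 h1).resolve_left (mul_ne_zero (div_ne_zero two_ne_zero ha) hs0.ne')

theorem curvatureForm_wedgeAlg_eq_zero (hn : 2 < n)
    (hB : IsPrincipalBundle (E := E) (F := F) (confEmb n) act π)
    (hθ : IsCartanConnection (confEmb n) (confRep n) (confAlg n) act θ) (u : B)
    {a b : Idx n → ℝ} (hav : hForm n a (vTilde n) = 0) (hbv : hForm n b (vTilde n) = 0)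
    (Y : confAlg n) : curvatureForm hθ u (wedgeAlg b a) Y = 0 := by
  by_cases ha : hForm n a a = 0
  · -- a null vector `a` is a difference of two vectors that are not null
    let k : Fin (n + 1) := ⟨1, by omega⟩
    have hk0 : (0 : Fin (n + 1)) ≠ k := by simp [k, Fin.ext_iff]
    have hkl : Fin.last n ≠ k := by simp [k, Fin.ext_iff]; omega
    set a₀ : Idx n → ℝ := Pi.single (Sum.inl k) 1 + Pi.single (Sum.inr k) 1 with ha₀
    have h0 : ∀ x, hForm n x a₀ = x (Sum.inr k) + x (Sum.inl k) := by
      intro x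
      rw [ha₀, map_add, hForm_single_right, hForm_single_right]
      rfl
    have h00 : hForm n a₀ a₀ = 2 := by
      rw [h0]
      simp [ha₀]
      norm_num
    have h0v : hForm n a₀ (vTilde n) = 0 := by
      rw [hForm_vTilde]
      simp [ha₀, hk0, hkl]
    set s := |hForm n a a₀| + 1 with hs
    have hs0 : 0 < s := by positivity
    have hne : hForm n (a + s • a₀) (a + s • a₀) ≠ 0 := by
      have h1 : hForm n (a + s • a₀) (a + s • a₀) = 2 * s * (hForm n a a₀ + s) := by
        simp only [map_add, map_smul, LinearMap.add_apply, LinearMap.smul_apply, smul_eq_mul, ha,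
          h00, hForm_comm a₀ a]
        ring
      rw [h1]
      have := neg_abs_le (hForm n a a₀)
      have h2 : 0 < hForm n a a₀ + s := by linarith
      positivity
    have h1 := curvatureForm_wedgeAlg_eq_zero_of_ne hB hθ u (a := a + s • a₀) (b := b)
      (by rw [map_add, map_smul, LinearMap.add_apply, LinearMap.smul_apply, hav, h0v]; simp) hbv
      hne Y
    have h2 := curvatureForm_wedgeAlg_eq_zero_of_ne hB hθ u (a := a₀) (b := b) h0v hbv
      (by rw [h00]; norm_num) Y
    have h3 : wedgeAlg b (a + s • a₀) = wedgeAlg b a + s • wedgeAlg b a₀ :=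
      Subtype.ext (wedge_add_smul_right b a a₀ s)
    rw [h3, map_add, map_smul, LinearMap.add_apply, LinearMap.smul_apply, h2, smul_zero,
      add_zero] at h1
    exact h1
  · exact curvatureForm_wedgeAlg_eq_zero_of_ne hB hθ u hav hbv ha Y

/-- The conformal curvature is horizontal on the annihilator of `ṽ₊`, a hyperplane in `𝔭̃`. -/
theorem curvatureForm_eq_zero_of_mulVec_eq_zero (hn : 2 < n)
    (hB : IsPrincipalBundle (E := E) (F := F) (confEmb n) act π)
    (hθ : IsCartanConnection (confEmb n) (confRep n) (confAlg n) act θ) (u : B)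
    {A : confAlg n} (hA : A.1 *ᵥ vTilde n = 0) (Y : confAlg n) : curvatureForm hθ u A Y = 0 := by
  have hA' : A = (1 / 2 : ℝ) • ∑ k, wedgeAlg (A.1 *ᵥ Pi.single k 1)
      (Pi.single k.swap 1 - vTilde n k • Pi.single (Sum.inr 0) 1) := by
    apply Subtype.ext
    refine (eq_sum_wedge_of_mulVec_eq_zero A.2 hA (Pi.single (Sum.inr 0) 1)).trans ?_
    refine Eq.trans ?_ (congrArg ((1 / 2 : ℝ) • ·)
      (AddSubmonoidClass.coe_finsetSum _ _).symm)
    rfl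
  rw [hA', map_smul, LinearMap.smul_apply, map_sum, LinearMap.sum_apply,
    Finset.sum_eq_zero, smul_zero]
  intro k _
  refine curvatureForm_wedgeAlg_eq_zero hn hB hθ u ?_ ?_ Y
  · rw [hForm_comm, map_sub, map_smul, hForm_single_right, hForm_single_right]
    simp [vTilde]
  · rw [hForm_mulVec_left A.2, hA, map_zero, neg_zero]

end ConformalGeometry

/-! ### The inclusion of `𝔰𝔩(n+1)` in `𝔰𝔬(n+1, n+1)` -/

section Inclusion

variable {n : ℕ}

/-- The inclusion of `𝔰𝔩(n+1)` in `𝔰𝔬(n+1, n+1)`, as a linear map into matrices. -/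
def algInclLin (n : ℕ) :
    Matrix (Fin (n + 1)) (Fin (n + 1)) ℝ →ₗ[ℝ] Matrix (Idx n) (Idx n) ℝ where
  toFun := algIncl n
  map_add' A B := by
    simp [algIncl, Matrix.fromBlocks_add, add_comm]
  map_smul' r A := by
    simp [algIncl, Matrix.fromBlocks_smul]

theorem algIncl_bracket (A B : Matrix (Fin (n + 1)) (Fin (n + 1)) ℝ) :
    algIncl n (A * B - B * A) =
      algIncl n A * algIncl n B - algIncl n B * algIncl n A := by
  simp only [algIncl, Matrix.fromBlocks_multiply, sub_eq_add_neg, Matrix.fromBlocks_neg,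
    Matrix.fromBlocks_add]
  simp [Matrix.transpose_mul, add_comm]

theorem algIncl_mem (A : Matrix (Fin (n + 1)) (Fin (n + 1)) ℝ) : algIncl n A ∈ confAlg n := by
  rw [mem_confAlg_iff]
  rintro (i | i) (j | j) <;> simp [algIncl]

/-- The inclusion `i' : 𝔰𝔩(n+1) → 𝔰𝔬(n+1, n+1)`. -/
def inclAlg (A : projAlg n) : confAlg n := ⟨algIncl n A.1, algIncl_mem A.1⟩

theorem algIncl_mulVec_inl (A : Matrix (Fin (n + 1)) (Fin (n + 1)) ℝ) (w : Idx n → ℝ)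
    (i : Fin (n + 1)) :
    (algIncl n A *ᵥ w) (Sum.inl i) = ∑ j, A i j * w (Sum.inl j) := by
  simp [algIncl, Matrix.mulVec, dotProduct, Fintype.sum_sum_type]

theorem algIncl_mulVec_inr (A : Matrix (Fin (n + 1)) (Fin (n + 1)) ℝ) (w : Idx n → ℝ)
    (i : Fin (n + 1)) :
    (algIncl n A *ᵥ w) (Sum.inr i) = - ∑ j, A j i * w (Sum.inr j) := by
  simp [algIncl, Matrix.mulVec, dotProduct, Fintype.sum_sum_type]

theorem algIncl_mulVec_vTilde_inl (A : Matrix (Fin (n + 1)) (Fin (n + 1)) ℝ) (i : Fin (n + 1)) :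
    (algIncl n A *ᵥ vTilde n) (Sum.inl i) = A i 0 := by
  rw [algIncl_mulVec_inl]
  simp [vTilde, Pi.single_apply]

theorem algIncl_mulVec_vTilde_inr (A : Matrix (Fin (n + 1)) (Fin (n + 1)) ℝ) (i : Fin (n + 1)) :
    (algIncl n A *ᵥ vTilde n) (Sum.inr i) = - A (Fin.last n) i := by
  rw [algIncl_mulVec_inr]
  simp [vTilde, Pi.single_apply]

/-- The orbit of `ṽ₊` under `SL(n+1)` is open in the null cone: infinitesimally, every vector
orthogonal to `ṽ₊` is attained. -/
theorem exists_algIncl_mulVec_eq (hn : 2 < n) (y : Idx n → ℝ) (hy : hForm n y (vTilde n) = 0) :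
    ∃ A : projAlg n, algIncl n A.1 *ᵥ vTilde n = y := by
  let k : Fin (n + 1) := ⟨1, by omega⟩
  have hk0 : k ≠ 0 := by simp [k, Fin.ext_iff]
  have hkl : k ≠ Fin.last n := by simp [k, Fin.ext_iff]; omega
  have h0l : (0 : Fin (n + 1)) ≠ Fin.last n := by simp [Fin.ext_iff]; omega
  rw [hForm_vTilde] at hy
  set t : ℝ := y (Sum.inr (Fin.last n)) - y (Sum.inl 0) with ht
  -- the first column and the last row are prescribed by `y`; the entry `t` corrects the trace
  let A : Matrix (Fin (n + 1)) (Fin (n + 1)) ℝ := Matrix.of fun i j =>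
    if j = 0 then y (Sum.inl i) else if i = Fin.last n then - y (Sum.inr j) else
      if i = k ∧ j = k then t else 0
  have hA : A.trace = 0 := by
    have h1 : ∀ i, A.diag i = (if i = 0 then y (Sum.inl 0) else 0) +
        (if i = Fin.last n then - y (Sum.inr (Fin.last n)) else 0) + if i = k then t else 0 := by
      intro i
      simp only [A, Matrix.diag_apply, Matrix.of_apply, and_self]
      by_cases hi : i = 0
      · subst hi; simp [h0l, hk0.symm]
      · by_cases hi' : i = Fin.last n
        · subst hi'; simp [h0l.symm, hkl.symm]
        · simp [hi, hi']
    rw [Matrix.trace, Finset.sum_congr rfl fun i _ => h1 i, Finset.sum_add_distrib,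
      Finset.sum_add_distrib]
    simp [ht]
    ring
  refine ⟨⟨A, hA⟩, ?_⟩
  ext i
  rcases i with i | i
  · rw [algIncl_mulVec_vTilde_inl]
    simp [A]
  · rw [algIncl_mulVec_vTilde_inr]
    by_cases hi : i = 0
    · subst hi; simp [A]; linarith
    · simp [A, hi]

/-- It suffices to test the symmetry condition on the frame. -/
theorem isSymmAlong_of_projFrame
    {K : projAlg n →ₗ[ℝ] projAlg n →ₗ[ℝ] Matrix (Fin (n + 1)) (Fin (n + 1)) ℝ}
    (hK : ∀ X ∈ projAlgP n, ∀ Y, K X Y = 0) (htor : ∀ X Y (i : Fin n), K X Y i.succ 0 = 0)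
    (m : Fin n)
    (h : ∀ p q B, K (projFrame n p) B m.succ q.succ +
        (if m = q then 1 else 0) * K (projFrame n p) B 0 0 =
      K (projFrame n q) B m.succ p.succ +
        (if m = p then 1 else 0) * K (projFrame n q) B 0 0) :
    IsSymmAlong K (Pi.single m.succ 1) := by
  have key : ∀ X Y B : projAlg n,
      Pi.single m.succ 1 ⬝ᵥ (K X B *ᵥ (Y.1 *ᵥ vPlus n)) +
        (Pi.single m.succ 1 ⬝ᵥ (Y.1 *ᵥ vPlus n)) * K X B 0 0 =
      ∑ q : Fin n, ∑ p : Fin n, Y.1 q.succ 0 * (X.1 p.succ 0 *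
        (K (projFrame n p) B m.succ q.succ +
          (if m = q then 1 else 0) * K (projFrame n p) B 0 0)) := by
    intro X Y B
    have h1 : ∀ a b, K X B a b = ∑ p : Fin n, X.1 p.succ 0 * K (projFrame n p) B a b := by
      intro a b
      rw [eq_sum_projFrame_left hK X B, Matrix.sum_apply]
      rfl
    have h2 : ∀ q : Fin n, ∑ p : Fin n, Y.1 q.succ 0 * (X.1 p.succ 0 *
        (K (projFrame n p) B m.succ q.succ +
          (if m = q then 1 else 0) * K (projFrame n p) B 0 0)) =
        K X B m.succ q.succ * Y.1 q.succ 0 +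
          (if m = q then Y.1 q.succ 0 * K X B 0 0 else 0) := by
      intro q
      rw [h1, h1, Finset.sum_mul]
      split_ifs with hq
      · rw [Finset.mul_sum, ← Finset.sum_add_distrib]
        exact Finset.sum_congr rfl fun p _ => by ring
      · rw [add_zero]
        exact Finset.sum_congr rfl fun p _ => by ring
    rw [Finset.sum_congr rfl fun q _ => h2 q, Finset.sum_add_distrib, Finset.sum_ite_eq]
    simp only [single_one_dotProduct, vPlus_mulVec, Finset.mem_univ, if_true]
    congr 1
    rw [Matrix.mulVec, dotProduct, Fin.sum_univ_succ, htor, zero_mul, zero_add]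
    simp only [vPlus_mulVec]
  intro X Y B
  rw [key, key, Finset.sum_comm]
  refine Finset.sum_congr rfl fun p _ => Finset.sum_congr rfl fun q _ => ?_
  rw [h p q B]
  ring

end Inclusion

theorem IsFlat.isNormal {ι : Type*} [Fintype ι] [DecidableEq ι]
    {E : Type*} [NormedAddCommGroup E] [NormedSpace ℝ E]
    {B : Type*} [TopologicalSpace B] [ChartedSpace E B]
    {𝔤 : LieSubalgebra ℝ (Matrix ι ι ℝ)} (𝔭 : LieSubalgebra ℝ 𝔤)
    {θ : ∀ u : B, TangentSpace 𝓘(ℝ, E) u →ₗ[ℝ] Matrix ι ι ℝ} (h : IsFlat θ) : IsNormal 𝔭 θ := by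
  intro m A Z _ u X
  simp [codifferential, curvatureFunction, h _ _ _]

/-! ### The induced conformal Cartan connection -/

theorem exists_extAct_toExt {n : ℕ} {G : Type*} (act : G → projP n → G)
    (a : ExtBundle act) :
    ∃ u g, a = extAct act (toExt act u) g := by
  induction a using Quot.ind with
  | mk p =>
    refine ⟨p.1, p.2, ?_⟩
    change Quot.mk _ p = Quot.mk _ (p.1, 1 * p.2)
    rw [one_mul]

section Correspondence

variable {n : ℕ} {E : Type*} [NormedAddCommGroup E] [NormedSpace ℝ E] [FiniteDimensional ℝ E]
  {G : Type*} [TopologicalSpace G] [ChartedSpace E G] [IsManifold 𝓘(ℝ, E) ∞ G]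
  {F : Type*} [NormedAddCommGroup F] [NormedSpace ℝ F]
  {M : Type*} [TopologicalSpace M] [ChartedSpace F M]
  {act : G → projP n → G} {π : G → M}
  {θ : ∀ u : G, TangentSpace 𝓘(ℝ, E) u →ₗ[ℝ] Matrix (Fin (n + 1)) (Fin (n + 1)) ℝ}
  {E' : Type*} [NormedAddCommGroup E'] [NormedSpace ℝ E'] [FiniteDimensional ℝ E']
  {F' : Type*} [NormedAddCommGroup F'] [NormedSpace ℝ F']
  {B : Type*} [TopologicalSpace B] [ChartedSpace E' B] [IsManifold 𝓘(ℝ, E') ∞ B]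
  {X : Type*} [TopologicalSpace X] [ChartedSpace F' X]
  {act' : B → confP n → B} {π' : B → X}
  {θ' : ∀ a : B, TangentSpace 𝓘(ℝ, E') a →ₗ[ℝ] Matrix (Idx n) (Idx n) ℝ} {j : G → B}

/-- The curvature of the induced conformal connection restricts to the projective curvature. -/
theorem curvature_restrict
    (hθ : ∀ i k, ContMDiff (𝓘(ℝ, E).tangent) 𝓘(ℝ, ℝ) ∞
      (fun p : TangentBundle 𝓘(ℝ, E) G => θ p.1 p.2 i k))
    (hθ' : ∀ i k, ContMDiff (𝓘(ℝ, E').tangent) 𝓘(ℝ, ℝ) ∞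
      (fun p : TangentBundle 𝓘(ℝ, E') B => θ' p.1 p.2 i k))
    (hj : ContMDiff 𝓘(ℝ, E) 𝓘(ℝ, E') ∞ j)
    (hrestr : ∀ (u : G) (v : TangentSpace 𝓘(ℝ, E) u),
      θ' (j u) (mfderiv 𝓘(ℝ, E) 𝓘(ℝ, E') j u v) = algIncl n (θ u v)) (u : G)
    (v w : TangentSpace 𝓘(ℝ, E) u) :
    curvature θ' (j u) (mfderiv 𝓘(ℝ, E) 𝓘(ℝ, E') j u v) (mfderiv 𝓘(ℝ, E) 𝓘(ℝ, E') j u w) =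
      algIncl n (curvature θ u v w) := by
  obtain ⟨Φ, hΦ, hΦ0, hd⟩ := exists_contMDiff_mfderiv_eq u ![v, w]
  subst hΦ0
  have e0 : mfderiv 𝓘(ℝ, EuclideanSpace ℝ (Fin 2)) 𝓘(ℝ, E) Φ 0 (EuclideanSpace.single 0 1) = v :=
    hd 0
  have e1 : mfderiv 𝓘(ℝ, EuclideanSpace ℝ (Fin 2)) 𝓘(ℝ, E) Φ 0 (EuclideanSpace.single 1 1) = w :=
    hd 1
  subst e0 e1
  have hcomp : ∀ (q z : EuclideanSpace ℝ (Fin 2)),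
      (mfderiv 𝓘(ℝ, EuclideanSpace ℝ (Fin 2)) 𝓘(ℝ, E') (j ∘ Φ) q z : E') =
        mfderiv 𝓘(ℝ, E) 𝓘(ℝ, E') j (Φ q)
          (mfderiv 𝓘(ℝ, EuclideanSpace ℝ (Fin 2)) 𝓘(ℝ, E) Φ q z) := by
    intro q z
    exact congrArg (fun L => (L z : E')) (mfderiv_comp q (hj.mdifferentiableAt (by simp))
      (hΦ.mdifferentiableAt (by simp)))
  have main := curvature_eq_of_pullForm_eq hθ hθ' hΦ (hj.comp hΦ) (algInclLin n) algIncl_bracket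
    (fun z q => (congrArg (θ' (j (Φ q))) (hcomp q z)).trans (hrestr _ _)) 0
    (EuclideanSpace.single 0 1) (EuclideanSpace.single 1 1)
  exact (congrArg₂ (curvature θ' (j (Φ 0))) (hcomp 0 _) (hcomp 0 _)).symm.trans main

theorem curvatureForm_inclAlg
    (hθ : IsCartanConnection (projRep n) (projRep n) (projAlg n) act θ)
    (hθ' : IsCartanConnection (confEmb n) (confRep n) (confAlg n) act' θ')
    (hj : ContMDiff 𝓘(ℝ, E) 𝓘(ℝ, E') ∞ j)
    (hrestr : ∀ (u : G) (v : TangentSpace 𝓘(ℝ, E) u),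
      θ' (j u) (mfderiv 𝓘(ℝ, E) 𝓘(ℝ, E') j u v) = algIncl n (θ u v)) (u : G) (A C : projAlg n) :
    curvatureForm hθ' (j u) (inclAlg A) (inclAlg C) = algIncl n (curvatureForm hθ u A C) := by
  have h1 : ∀ A : projAlg n, θ' (j u) (mfderiv 𝓘(ℝ, E) 𝓘(ℝ, E') j u
      (Function.invFun (θ u) A.1)) = inclAlg A := by
    intro A
    rw [hrestr, hθ.apply_invFun u A.2]
    rfl
  rw [curvatureForm_of_eq hθ' (j u) (h1 A) (h1 C), curvatureForm_apply, curvatureFunction]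
  exact curvature_restrict hθ.smooth hθ'.smooth hj hrestr u _ _

/-- Over the image of `𝒢`, the curvature of the induced conformal connection is determined by the
projective curvature. -/
theorem curvatureForm_eq_algIncl (hn : 2 < n)
    (hθ : IsCartanConnection (projRep n) (projRep n) (projAlg n) act θ)
    (hB : IsPrincipalBundle (E := E') (F := F') (confEmb n) act' π')
    (hθ' : IsCartanConnection (confEmb n) (confRep n) (confAlg n) act' θ')
    (hj : ContMDiff 𝓘(ℝ, E) 𝓘(ℝ, E') ∞ j)
    (hrestr : ∀ (u : G) (v : TangentSpace 𝓘(ℝ, E) u),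
      θ' (j u) (mfderiv 𝓘(ℝ, E) 𝓘(ℝ, E') j u v) = algIncl n (θ u v)) (u : G) {Y Z : confAlg n}
    {A C : projAlg n} (hA : algIncl n A.1 *ᵥ vTilde n = Y.1 *ᵥ vTilde n)
    (hC : algIncl n C.1 *ᵥ vTilde n = Z.1 *ᵥ vTilde n) :
    curvatureForm hθ' (j u) Y Z = algIncl n (curvatureForm hθ u A C) := by
  have key : ∀ {Y : confAlg n} {A : projAlg n}, algIncl n A.1 *ᵥ vTilde n = Y.1 *ᵥ vTilde n →
      ∀ Z, curvatureForm hθ' (j u) Y Z = curvatureForm hθ' (j u) (inclAlg A) Z := by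
    intro Y A hA
    refine curvatureForm_left_congr hθ' (j u) fun Z => ?_
    refine curvatureForm_eq_zero_of_mulVec_eq_zero hn hB hθ' (j u) ?_ Z
    rw [mulVec_vTilde_sub, sub_eq_zero]
    exact hA.symm
  rw [key hA, curvatureForm_swap, key hC, ← curvatureForm_swap,
    curvatureForm_inclAlg hθ hθ' hj hrestr]

theorem exists_curvatureForm_eq_algIncl (hn : 2 < n)
    (hθ : IsCartanConnection (projRep n) (projRep n) (projAlg n) act θ)
    (hB : IsPrincipalBundle (E := E') (F := F') (confEmb n) act' π')
    (hθ' : IsCartanConnection (confEmb n) (confRep n) (confAlg n) act' θ')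
    (hj : ContMDiff 𝓘(ℝ, E) 𝓘(ℝ, E') ∞ j)
    (hrestr : ∀ (u : G) (v : TangentSpace 𝓘(ℝ, E) u),
      θ' (j u) (mfderiv 𝓘(ℝ, E) 𝓘(ℝ, E') j u v) = algIncl n (θ u v)) (u : G) (Y Z : confAlg n) :
    ∃ A C : projAlg n, (∀ i, A.1 i 0 = (Y.1 *ᵥ vTilde n) (Sum.inl i)) ∧
      curvatureForm hθ' (j u) Y Z = algIncl n (curvatureForm hθ u A C) := by
  obtain ⟨A, hA⟩ := exists_algIncl_mulVec_eq hn _ (hForm_mulVec_vTilde Y)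
  obtain ⟨C, hC⟩ := exists_algIncl_mulVec_eq hn _ (hForm_mulVec_vTilde Z)
  refine ⟨A, C, fun i => ?_, curvatureForm_eq_algIncl hn hθ hB hθ' hj hrestr u hA hC⟩
  rw [← hA, algIncl_mulVec_vTilde_inl]

/-- The induced conformal curvature vanishes in the directions tangent to the fibres of
`𝒢/Q → M`, because there the projective curvature does. -/
theorem curvatureForm_eq_zero_of_inl_succ (hn : 2 < n)
    (hG : IsPrincipalBundle (E := E) (F := F) (projRep n) act π)
    (hθ : IsCartanConnection (projRep n) (projRep n) (projAlg n) act θ)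
    (hB : IsPrincipalBundle (E := E') (F := F') (confEmb n) act' π')
    (hθ' : IsCartanConnection (confEmb n) (confRep n) (confAlg n) act' θ')
    (hj : ContMDiff 𝓘(ℝ, E) 𝓘(ℝ, E') ∞ j)
    (hrestr : ∀ (u : G) (v : TangentSpace 𝓘(ℝ, E) u),
      θ' (j u) (mfderiv 𝓘(ℝ, E) 𝓘(ℝ, E') j u v) = algIncl n (θ u v)) (u : G) {Y : confAlg n}
    (hY : ∀ i : Fin n, (Y.1 *ᵥ vTilde n) (Sum.inl i.succ) = 0) (Z : confAlg n) :
    curvatureForm hθ' (j u) Y Z = 0 := by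
  obtain ⟨A, C, hA, h⟩ := exists_curvatureForm_eq_algIncl hn hθ hB hθ' hj hrestr u Y Z
  rw [h, curvatureForm_eq_zero_of_mem_projAlgP hG hθ u A
    ((mem_projAlgP_iff A).2 fun i => by rw [hA, hY])]
  exact map_zero (algInclLin n)

/-- Normality of the induced conformal connection, in terms of the projective curvature: the
frame elements tangent to the fibres of `𝒢/Q → M` drop out. -/
theorem IsNormal.sum_wedge_eq_zero (hn : 2 < n)
    (hG : IsPrincipalBundle (E := E) (F := F) (projRep n) act π)
    (hθ : IsCartanConnection (projRep n) (projRep n) (projAlg n) act θ)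
    (hB : IsPrincipalBundle (E := E') (F := F') (confEmb n) act' π')
    (hθ' : IsCartanConnection (confEmb n) (confRep n) (confAlg n) act' θ')
    (hj : ContMDiff 𝓘(ℝ, E) 𝓘(ℝ, E') ∞ j)
    (hrestr : ∀ (u : G) (v : TangentSpace 𝓘(ℝ, E) u),
      θ' (j u) (mfderiv 𝓘(ℝ, E) 𝓘(ℝ, E') j u v) = algIncl n (θ u v))
    (hN : IsNormal (confAlgP n) θ') (u : G) (C : projAlg n) :
    ∑ i : Fin n,
      (wedge (algIncl n (curvatureForm hθ u (projFrame n i) C) *ᵥ vTilde n)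
          (Pi.single (Sum.inr i.succ) 1) +
        wedge (vTilde n) (algIncl n (curvatureForm hθ u (projFrame n i) C) *ᵥ
          Pi.single (Sum.inr i.succ) 1)) = 0 := by
  have hn0 : n ≠ 0 := by omega
  have h := hN.sum_eq_zero hθ' (confFrame n) (confCoframe n)
    (fun s Y ⟨c, hc⟩ => by
      rw [killingForm_confCoframe hn0, hc, map_smul, hForm_comm, hForm_vTilde_confBasis, smul_zero])
    (fun s t => by
      rw [killingForm_confCoframe hn0, confFrame_mulVec, hForm_comm, hForm_confBasis_swap])
    (fun Y => ⟨_, sub_sum_confFrame_mem hn0 Y⟩) (j u) (inclAlg C)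
  have hzero := fun {Y} => curvatureForm_eq_zero_of_inl_succ hn hG hθ hB hθ' hj hrestr u (Y := Y)
  have h2 : ∑ s, curvatureForm hθ' (j u) (confFrame n s) ⁅confCoframe n s, inclAlg C⁆ = 0 := by
    refine Finset.sum_eq_zero fun s _ => curvatureForm_right_eq_zero hθ' (j u) (hzero ?_) _
    obtain ⟨c, hc⟩ := lie_confCoframe_mulVec hn0 (inclAlg C) s
    intro i
    rw [hc, Pi.smul_apply, vTilde_inl_succ, smul_zero]
  rw [h2, add_zero, Fintype.sum_sum_type] at h
  have hr : ∀ i : Fin n, curvatureForm hθ' (j u) (confFrame n (Sum.inr i)) (inclAlg C) = 0 := by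
    intro i
    refine hzero (fun k => ?_) _
    rw [confFrame_mulVec]
    simp [confBasis]
  have hl : ∀ i : Fin n, curvatureForm hθ' (j u) (confFrame n (Sum.inl i)) (inclAlg C) =
      algIncl n (curvatureForm hθ u (projFrame n i) C) := by
    intro i
    obtain ⟨A, hA⟩ := exists_algIncl_mulVec_eq hn _ (hForm_mulVec_vTilde (confFrame n (Sum.inl i)))
    rw [curvatureForm_eq_algIncl hn hθ hB hθ' hj hrestr u hA (C := C) rfl]
    congr 1
    refine curvatureForm_left_congr hθ u (fun C => ?_) C
    refine curvatureForm_eq_zero_of_mem_projAlgP hG hθ u _ ((mem_projAlgP_iff _).2 fun k => ?_) C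
    have hAk : A.1 k.succ 0 = (projFrame n i).1 k.succ 0 := by
      rw [← algIncl_mulVec_vTilde_inl A.1, hA, confFrame_mulVec, projFrame_coe]
      simp [confBasis, Matrix.single_apply, Pi.single_apply, eq_comm]
    exact sub_eq_zero.2 hAk
  simp only [hr, hl, zero_lie, Finset.sum_const_zero, add_zero] at h
  have h3 : (2 : ℝ) * (1 / (4 * n)) ≠ 0 := by
    have : (n : ℝ) ≠ 0 := by exact_mod_cast hn0
    positivity
  refine (smul_eq_zero.1 ?_).resolve_left h3
  rw [← h, mul_smul, Finset.smul_sum]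
  congr 1
  refine Finset.sum_congr rfl fun i _ => ?_
  have h4 : ((confCoframe n (Sum.inl i) : confAlg n) : Matrix (Idx n) (Idx n) ℝ) =
      (1 / (4 * n) : ℝ) • wedge (vTilde n) (Pi.single (Sum.inr i.succ) 1) := rfl
  rw [h4, ← lie_wedge (algIncl_mem _), Ring.lie_def, Ring.lie_def, Matrix.mul_smul,
    Matrix.smul_mul, smul_sub]

/-- If the induced conformal connection is normal, the projective curvature satisfies the symmetry
condition along the last coordinate. -/
theorem IsNormal.isSymmAlong_last (hn : 2 < n)
    (hG : IsPrincipalBundle (E := E) (F := F) (projRep n) act π)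
    (hθ : IsCartanConnection (projRep n) (projRep n) (projAlg n) act θ)
    (hnormal : IsNormal (projAlgP n) θ)
    (hB : IsPrincipalBundle (E := E') (F := F') (confEmb n) act' π')
    (hθ' : IsCartanConnection (confEmb n) (confRep n) (confAlg n) act' θ')
    (hj : ContMDiff 𝓘(ℝ, E) 𝓘(ℝ, E') ∞ j)
    (hrestr : ∀ (u : G) (v : TangentSpace 𝓘(ℝ, E) u),
      θ' (j u) (mfderiv 𝓘(ℝ, E) 𝓘(ℝ, E') j u v) = algIncl n (θ u v))
    (hN : IsNormal (confAlgP n) θ') (u : G) :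
    IsSymmAlong (curvatureForm hθ u) (Pi.single (Fin.last n) 1) := by
  obtain ⟨m, hm⟩ : ∃ m : Fin n, m.succ = Fin.last n :=
    Fin.exists_succ_eq.2 (by simp [Fin.ext_iff]; omega)
  rw [← hm]
  refine isSymmAlong_of_projFrame (curvatureForm_eq_zero_of_mem_projAlgP hG hθ u)
    (hnormal.torsion_eq_zero hG hθ u) m fun p q C => ?_
  -- the block of the codifferential mapping `E` to `F`; its contractions are eliminated by normality
  -- of the projective connection
  have h := congrFun₂ (hN.sum_wedge_eq_zero hn hG hθ hB hθ' hj hrestr u C)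
    (Sum.inr p.succ) (Sum.inl q.succ)
  have hp := hnormal.sum_apply_succ_succ hG hθ u C p
  have hq := hnormal.sum_apply_succ_succ hG hθ u C q
  have hv : ∀ k : Fin n, vTilde n (Sum.inr k.succ) = if m = k then 1 else 0 := by
    intro k
    simp [vTilde, ← hm, Pi.single_apply, eq_comm]
  have hL : ∀ (A : Matrix (Fin (n + 1)) (Fin (n + 1)) ℝ) (i k : Fin n),
      (algIncl n A *ᵥ Pi.single (Sum.inr i.succ) 1) (Sum.inr k.succ) = - A i.succ k.succ := by
    intro A i k
    rw [algIncl_mulVec_inr]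
    simp [Pi.single_apply]
  have hs : ∀ i k : Fin n, (Pi.single (Sum.inr i.succ) 1 : Idx n → ℝ) (Sum.inr k.succ) =
      if i = k then 1 else 0 := by
    intro i k
    simp [Pi.single_apply, eq_comm]
  rw [Matrix.sum_apply] at h
  simp only [Matrix.add_apply, wedge_apply, Sum.swap_inl, algIncl_mulVec_vTilde_inr, hL, hs, hv,
    Finset.sum_add_distrib, Finset.sum_sub_distrib, Matrix.zero_apply, ite_mul, mul_ite, one_mul,
    mul_one, zero_mul, mul_zero, Finset.sum_ite_eq', Finset.mem_univ, if_true] at h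
  rw [← hm] at h
  rw [← hp, ← hq]
  split_ifs at h ⊢
  all_goals simp at h ⊢
  all_goals linarith

/-- Flatness along the image of `𝒢` propagates along the fibres of `𝒢̃`. -/
theorem isFlat_of_isFlat (hn : 2 < n)
    (hθ : IsCartanConnection (projRep n) (projRep n) (projAlg n) act θ)
    (hB : IsPrincipalBundle (E := E') (F := F') (confEmb n) act' π')
    (hθ' : IsCartanConnection (confEmb n) (confRep n) (confAlg n) act' θ')
    (hj : ContMDiff 𝓘(ℝ, E) 𝓘(ℝ, E') ∞ j)
    (hrestr : ∀ (u : G) (v : TangentSpace 𝓘(ℝ, E) u),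
      θ' (j u) (mfderiv 𝓘(ℝ, E) 𝓘(ℝ, E') j u v) = algIncl n (θ u v))
    (hsurj : ∀ a : B, ∃ u g, a = act' (j u) g) (hflat : IsFlat θ) : IsFlat θ' := by
  have h1 : ∀ u v w, curvature θ' (j u) v w = 0 := by
    intro u v w
    rw [← curvatureForm_of_eq hθ' (j u) (A := ⟨θ' _ v, hθ'.apply_mem _ v⟩)
      (A' := ⟨θ' _ w, hθ'.apply_mem _ w⟩) rfl rfl]
    obtain ⟨A, C, -, h⟩ := exists_curvatureForm_eq_algIncl hn hθ hB hθ' hj hrestr u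
      ⟨θ' _ v, hθ'.apply_mem _ v⟩ ⟨θ' _ w, hθ'.apply_mem _ w⟩
    rw [h, curvatureForm_apply, curvatureFunction, hflat]
    exact map_zero (algInclLin n)
  intro a v w
  obtain ⟨u, g, rfl⟩ := hsurj a
  have hgen : ∀ L : E' →L[ℝ] E', Function.Injective L → Function.Surjective L :=
    fun L hL => LinearMap.injective_iff_surjective.1 hL
  have hsurj' : Function.Surjective (mfderiv 𝓘(ℝ, E') 𝓘(ℝ, E') (fun u' => act' u' g) (j u)) :=
    hgen _ (hθ'.mfderiv_act_injective g (j u))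
  obtain ⟨v, rfl⟩ := hsurj' v
  obtain ⟨w, rfl⟩ := hsurj' w
  rw [hθ'.curvature_act hB, h1, mul_zero, zero_mul]

end Correspondence

end Fefferman

end

theorem mainTheorem3 (n : ℕ) (hn : 2 < n)
    -- a normal projective Cartan geometry `(𝒢 → M, θ)` of type `(SL(n+1), P)`
    {M : Type*} [TopologicalSpace M] [ChartedSpace (EuclideanSpace ℝ (Fin n)) M]
    [IsManifold 𝓘(ℝ, EuclideanSpace ℝ (Fin n)) ∞ M]
    {E : Type*} [NormedAddCommGroup E] [NormedSpace ℝ E] [FiniteDimensional ℝ E]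
    {G : Type*} [TopologicalSpace G] [ChartedSpace E G] [IsManifold 𝓘(ℝ, E) ∞ G]
    (act : G → Fefferman.projP n → G) (π : G → M)
    (hG : Fefferman.IsPrincipalBundle (E := E) (F := EuclideanSpace ℝ (Fin n))
      (Fefferman.projRep n) act π)
    (θ : ∀ u : G, TangentSpace 𝓘(ℝ, E) u →ₗ[ℝ] Matrix (Fin (n + 1)) (Fin (n + 1)) ℝ)
    (hθ : Fefferman.IsCartanConnection (Fefferman.projRep n) (Fefferman.projRep n)
      (Fefferman.projAlg n) act θ)
    (hnormal : Fefferman.IsNormal (Fefferman.projAlgP n) θ)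
    -- the smooth structure of the correspondence space `M̃ = 𝒢/Q`, the one for which
    -- `𝒢 → M̃` is a smooth principal `Q`-bundle
    [TopologicalSpace (Fefferman.CorrSpace act)]
    [ChartedSpace (EuclideanSpace ℝ (Fin (2 * n))) (Fefferman.CorrSpace act)]
    [IsManifold 𝓘(ℝ, EuclideanSpace ℝ (Fin (2 * n))) ∞ (Fefferman.CorrSpace act)]
    (hCorr : Fefferman.IsPrincipalBundle (E := E) (F := EuclideanSpace ℝ (Fin (2 * n)))
      (Fefferman.qEmb n) (Fefferman.qAct act) (Fefferman.toCorr act))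
    -- the smooth structure of the extended bundle `𝒢̃ = 𝒢 ×_Q P̃`, the one for which `𝒢̃ → M̃` is a
    -- smooth principal `P̃`-bundle and the natural map `𝒢 → 𝒢̃` is smooth
    {E' : Type*} [NormedAddCommGroup E'] [NormedSpace ℝ E'] [FiniteDimensional ℝ E']
    [TopologicalSpace (Fefferman.ExtBundle act)] [ChartedSpace E' (Fefferman.ExtBundle act)]
    [IsManifold 𝓘(ℝ, E') ∞ (Fefferman.ExtBundle act)]
    (hExt : Fefferman.IsPrincipalBundle (E := E') (F := EuclideanSpace ℝ (Fin (2 * n)))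
      (Fefferman.confEmb n) (Fefferman.extAct act) (Fefferman.extProj act))
    (htoExt : ContMDiff 𝓘(ℝ, E) 𝓘(ℝ, E') ∞ (Fefferman.toExt act))
    -- the induced conformal Cartan connection, the unique one on `𝒢̃` that restricts to `θ` on `𝒢`
    (θ' : ∀ a : Fefferman.ExtBundle act,
      TangentSpace 𝓘(ℝ, E') a →ₗ[ℝ] Matrix (Fefferman.Idx n) (Fefferman.Idx n) ℝ)
    (hθ' : Fefferman.IsCartanConnection (Fefferman.confEmb n) (Fefferman.confRep n)
      (Fefferman.confAlg n) (Fefferman.extAct act) θ')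
    (hrestr : ∀ (u : G) (v : TangentSpace 𝓘(ℝ, E) u),
      θ' (Fefferman.toExt act u) (mfderiv 𝓘(ℝ, E) 𝓘(ℝ, E') (Fefferman.toExt act) u v) =
        Fefferman.algIncl n (θ u v)) :
    (Fefferman.IsNormal (Fefferman.confAlgP n) θ' ↔ Fefferman.IsFlat θ) ∧
      (Fefferman.IsFlat θ → Fefferman.IsFlat θ') := by
  have hflat : Fefferman.IsFlat θ → Fefferman.IsFlat θ' :=
    Fefferman.isFlat_of_isFlat hn hθ hExt hθ' htoExt hrestr (Fefferman.exists_extAct_toExt act)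
  refine ⟨⟨fun hN => ?_, fun h => (hflat h).isNormal _⟩, hflat⟩
  exact hnormal.isFlat_of_isSymmAlong_last hn hG hθ
    (hnormal.isSymmAlong_last hn hG hθ hExt hθ' htoExt hrestr hN)
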